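/- Let $\mathcal N$ be a countably infinite set of names, and let $\mathfrak S$ be the group of finite permutations of $\mathcal N$ (generated by the transpositions $(a\ b)$). A nominal set is a set with an $\mathfrak S$-action all of whose elements have finite support. A *nominal (monoidal) category* is here a strict monoidal category internal in nominal sets with the separated product, whose objects are the finite subsets of $\mathcal N$, with disjoint union as partial commutative tensor $\uplus$ (on arrows, $f\uplus g$ is defined iff the domains of $f,g$ are disjoint and the codomains of $f,g$ are disjoint), and which contains renamings $\delta_{ab}:\{a\}\to\{b\}$ with $\delta_{aa}=\mathrm{id}_a$, $\delta_{ab};\delta_{bc}=\delta_{ac}$, $\pi\cdot\delta_{ab}=\delta_{\pi(a)\pi(b)}$. An isomorphism of such categories is the identity on objects and a bijection on arrows preserving domains, codomains, identities, both compositions, renamings and the permutation actions. A *nominal monoidal theory* $(\Sigma,E)$ consists of a nominal set $\Sigma$ of generators $\gamma:A\to B$ ($A,B\subseteq\mathcal N$ finite), with $\pi\cdot\gamma:\pi\cdot A\to\pi\cdot B$, and a permutation-closed set $E$ of equations between terms of the same type. Terms are built from generators, identities, renamings $\delta_{ab}$, sequential composition $t;s$ (diagrammatic order), parallel composition $t\uplus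 s$ (whenever domains are disjoint and codomains are disjoint), and permutations $\pi\,t$. The theory *presents* the nominal category whose arrows are the terms modulo the congruence generated by $E$ and by the following equations, imposed whenever both sides are well-typed: associativity and unit laws for $;$ and $\uplus$, $\mathrm{id}_A\uplus\mathrm{id}_B=\mathrm{id}_{A\cup B}$, $t\uplus s=s\uplus t$, $(s;t)\uplus(u;v)=(s\uplus u);(t\uplus v)$; the laws of a group action, and $\pi\,\mathrm{id}_A=\mathrm{id}_{\pi\cdot A}$, $\pi\,\delta_{ab}=\delta_{\pi(a)\pi(b)}$, $\pi\,\gamma=\pi\cdot\gamma$, $\pi(t\uplus s)=\pi t\uplus\pi s$, $\pi(t;s)=\pi t;\pi s$; $\delta_{aa}=\mathrm{id}_a$, $\delta_{ab};\delta_{bc}=\delta_{ac}$; and, for every generator $\gamma$, - $\gamma;(\mathrm{id}_B\uplus\delta_{bx})=(b\ x)\gamma$ if $\gamma:A\to B\uplus\{b\}$ and $b,x\notin A$; - $(\delta_{xa}\uplus\mathrm{id}_A);\gamma=(x\ a)\gamma$ if $\gamma:\{a\}\uplus A\to B$ and $a,x\notin B$; - $\gamma;(\mathrm{id}_B\uplus\delta_{cx})=(\mathrm{id}_A\uplus\delta_{cx});(c\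 x)\gamma$ if $\gamma:A\uplus\{c\}\to B\uplus\{c\}$. Consider the families of generators (for all names $a,b,c$ subject to the stated inequalities) $$\eta_a:\varnothing\to\{a\},\qquad \mu_{abc}:\{a,b\}\to\{c\}\ (a\ne b),\qquad \hat\eta_a:\{a\}\to\varnothing,\qquad \hat\mu_{abc}:\{a\}\to\{b,c\}\ (b\neq c),$$ permuted by $\mathfrak S$ through their indices, and the following equations, for all choices of names for which both sides are well-typed: 1. for $\eta$: $\eta_a;\delta_{ab}=\eta_b$; 2. for $\mu$: $\mu_{abc};\delta_{cd}=\mu_{abd}$, $\ (\delta_{aa'}\uplus\mathrm{id}_b);\mu_{a'bc}=\mu_{abc}$, $\ (\mu_{abx}\uplus\mathrm{id}_c);\mu_{xcd}=(\mathrm{id}_a\uplus\mu_{bcy});\mu_{ayd}$, $\ \mu_{abc}=\mu_{bac}$; 3. for $\eta,\mu$: $(\eta_x\uplus\mathrm{id}_a);\mu_{xab}=\delta_{ab}$; 4. for $\hat\eta$: $\delta_{ab};\hat\eta_b=\hat\eta_a$; with $\eta$: $\eta_x;\hat\eta_x=\mathrm{id}_\varnothing$; with $\mu$: $\mu_{abx};\hat\eta_x=\hat\eta_a\uplus\hat\eta_b$;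 5. for $\hat\mu$: $\delta_{da};\hat\mu_{abc}=\hat\mu_{dbc}$, $\ \hat\mu_{abc};(\delta_{bb'}\uplus\mathrm{id}_c)=\hat\mu_{ab'c}$, $\ \hat\mu_{dxc};(\hat\mu_{xab}\uplus\mathrm{id}_c)=\hat\mu_{day};(\mathrm{id}_a\uplus\hat\mu_{ybc})$, $\ \hat\mu_{abc}=\hat\mu_{acb}$; with $\hat\eta$: $\hat\mu_{axb};(\hat\eta_x\uplus\mathrm{id}_b)=\delta_{ab}$; with $\eta$: $\eta_x;\hat\mu_{xab}=\eta_a\uplus\eta_b$; with $\mu$: $\mu_{abx};\hat\mu_{xcd}=(\hat\mu_{apq}\uplus\hat\mu_{brs});(\mu_{prc}\uplus\mu_{qsd})$ and $\hat\mu_{axy};\mu_{xyb}=\delta_{ab}$. **Theorem.** The theories with generators (i) none, (ii) $\eta$, (iii) $\mu$, (iv) $\eta,\mu$, (v) $\eta,\mu,\hat\eta$, (vi) $\eta,\mu,\hat\eta,\hat\mu$ and with those of the equations above that involve only these generators present, respectively, the nominal categories of finite subsets of $\mathcal N$ with (i) bijections $\mathsf n\mathbb B$, (ii) injections $\mathsf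 n\mathbb I$, (iii) surjections $\mathsf n\mathbb S$, (iv) functions $\mathsf n\mathbb F$, (v) partial functions $\mathsf n\mathbb P$, (vi) relations $\mathsf n\mathbb R$. (In these categories composition is composition of relations, $\uplus$ is union, $\mathfrak S$ acts by renaming, and $\delta_{ab}$ is the unique function $\{a\}\to\{b\}$.) More precisely, in each case there is an isomorphism from the presented category to the stated one which sends every generator $\gamma:A\to B$ to the full relation $A\times B$; that is, $\eta_a$ and $\mu_{abc}$ go to the unique functions of their types, $\hat\eta_a$ to the nowhere defined partial function, and $\hat\mu_{abc}$ to the relation $\{(a,b),(a,c)\}$. In particular the six calculi are complete: two terms of the same type are provably equal iff they denote the same map (relation), and every map (relation) of the respective kind is denoted by a term. -/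

import Mathlib

universe u

namespace NominalDiagrams

open scoped Pointwise

section NominalSets

/-- The group of finite permutations of the set `N` of names: the group generated by the
transpositions.  It acts on `N` by application and on `Finset N` by taking images. -/
abbrev FinPerm (N : Type u) [DecidableEq N] : Type u :=
  ↥(Subgroup.closure {σ : Equiv.Perm N | σ.IsSwap})

/-- The transposition `(a b)` as a finite permutation (the identity if `a = b`). -/
def tr {N : Type u} [DecidableEq N] (a b : N) : FinPerm N :=
  ⟨Equiv.swap a b, by
    by_cases h : a = b
    · subst h
      rw [Equiv.swap_self]
      exact Subgroup.one_mem _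
    · exact Subgroup.subset_closure ⟨a, b, h, rfl⟩⟩

/-- A nominal set: an action of the finite permutations all of whose elements are supported by
a finite set of names. -/
class NominalSet (N : Type u) [DecidableEq N] (X : Type u) extends MulAction (FinPerm N) X where
  exists_support : ∀ x : X, ∃ S : Finset N, MulAction.Supports (FinPerm N) (S : Set N) x

end NominalSets

section InternalCategories

/-- A strict monoidal category internal in nominal sets with the separated product, whose nominal
set of objects is the set of finite sets of names with disjoint union as commutative partial
tensor, and which contains the renamings `δ a b : {a} → {b}`.
`comp f g` is composition in diagrammatic order. -/
structure NominalCategory (N : Type u) [DecidableEq N] where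
  /-- the nominal set of arrows -/
  Arrow : Type u
  [nominal : NominalSet N Arrow]
  dom : Arrow → Finset N
  cod : Arrow → Finset N
  dom_smul : ∀ (π : FinPerm N) f, dom (π • f) = π • dom f
  cod_smul : ∀ (π : FinPerm N) f, cod (π • f) = π • cod f
  /-- identities -/
  id : Finset N → Arrow
  dom_id : ∀ A, dom (id A) = A
  cod_id : ∀ A, cod (id A) = A
  smul_id : ∀ (π : FinPerm N) A, π • id A = id (π • A)
  /-- sequential composition -/
  comp : ∀ f g, cod f = dom g → Arrow
  dom_comp : ∀ f g h, dom (comp f g h) = dom f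
  cod_comp : ∀ f g h, cod (comp f g h) = cod g
  smul_comp : ∀ (π : FinPerm N) f g h h', π • comp f g h = comp (π • f) (π • g) h'
  id_comp : ∀ f h, comp (id (dom f)) f h = f
  comp_id : ∀ f h, comp f (id (cod f)) h = f
  comp_assoc : ∀ f g k h₁ h₂ h₃ h₄, comp (comp f g h₁) k h₂ = comp f (comp g k h₃) h₄
  /-- parallel composition -/
  tensor : ∀ f g, Disjoint (dom f) (dom g) → Disjoint (cod f) (cod g) → Arrow
  dom_tensor : ∀ f g h₁ h₂, dom (tensor f g h₁ h₂) = dom f ∪ dom g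
  cod_tensor : ∀ f g h₁ h₂, cod (tensor f g h₁ h₂) = cod f ∪ cod g
  smul_tensor : ∀ (π : FinPerm N) f g h₁ h₂ h₃ h₄,
    π • tensor f g h₁ h₂ = tensor (π • f) (π • g) h₃ h₄
  tensor_id : ∀ A B h₁ h₂, tensor (id A) (id B) h₁ h₂ = id (A ∪ B)
  empty_tensor : ∀ f h₁ h₂, tensor (id ∅) f h₁ h₂ = f
  tensor_assoc : ∀ f g k h₁ h₂ h₃ h₄ h₅ h₆ h₇ h₈,
    tensor (tensor f g h₁ h₂) k h₃ h₄ = tensor f (tensor g k h₅ h₆) h₇ h₈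
  tensor_comm : ∀ f g h₁ h₂ h₃ h₄, tensor f g h₁ h₂ = tensor g f h₃ h₄
  interchange : ∀ s t p q h₁ h₂ h₃ h₄ h₅ h₆ h₇ h₈ h₉,
    tensor (comp s t h₁) (comp p q h₂) h₃ h₄ = comp (tensor s p h₅ h₆) (tensor t q h₇ h₈) h₉
  /-- renamings -/
  δ : N → N → Arrow
  dom_δ : ∀ a b, dom (δ a b) = {a}
  cod_δ : ∀ a b, cod (δ a b) = {b}
  smul_δ : ∀ (π : FinPerm N) a b, π • δ a b = δ (π • a) (π • b)
  δ_self : ∀ a, δ a a = id {a}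
  δ_comp_δ : ∀ a b c h, comp (δ a b) (δ b c) h = δ a c

attribute [instance] NominalCategory.nominal

/-- An isomorphism that is the identity on objects, and on arrows a bijection compatible with
the types, the permutation actions, identities, both compositions and renamings. -/
structure NominalCategory.Iso {N : Type u} [DecidableEq N] (C D : NominalCategory N) where
  equiv : C.Arrow ≃ D.Arrow
  dom_equiv : ∀ f, D.dom (equiv f) = C.dom f
  cod_equiv : ∀ f, D.cod (equiv f) = C.cod f
  map_smul : ∀ (π : FinPerm N) f, equiv (π • f) = π • equiv f
  map_id : ∀ A, equiv (C.id A) = D.id A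
  map_comp : ∀ f g h h', equiv (C.comp f g h) = D.comp (equiv f) (equiv g) h'
  map_tensor : ∀ f g h₁ h₂ h₃ h₄,
    equiv (C.tensor f g h₁ h₂) = D.tensor (equiv f) (equiv g) h₃ h₄
  map_δ : ∀ a b, equiv (C.δ a b) = D.δ a b

end InternalCategories

section Terms

/-- Raw terms over a set `Γ` of generators.  `idt A` is the identity on the finite set `A`
(the parallel composition of the `id_a`, `a ∈ A`), `ren a b` is the renaming `δ_ab`. -/
inductive Term (N : Type u) [DecidableEq N] (Γ : Type u) : Type u
  | gen (γ : Γ)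
  | idt (A : Finset N)
  | ren (a b : N)
  | tensor (t s : Term N Γ)
  | comp (t s : Term N Γ)
  | perm (π : FinPerm N) (t : Term N Γ)

/-- The action of permutations on raw terms, renaming all names. -/
def Term.act {N : Type u} [DecidableEq N] {Γ : Type u} [NominalSet N Γ] (π : FinPerm N) :
    Term N Γ → Term N Γ
  | .gen γ => .gen (π • γ)
  | .idt A => .idt (π • A)
  | .ren a b => .ren (π • a) (π • b)
  | .tensor t s => .tensor (t.act π) (s.act π)
  | .comp t s => .comp (t.act π) (s.act π)
  | .perm σ t => .perm (π * σ * π⁻¹) (t.act π)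

/-- A nominal set of generators `γ : dom γ → cod γ`. -/
structure Signature (N : Type u) [DecidableEq N] where
  Gen : Type u
  [nominal : NominalSet N Gen]
  dom : Gen → Finset N
  cod : Gen → Finset N
  dom_smul : ∀ (π : FinPerm N) γ, dom (π • γ) = π • dom γ
  cod_smul : ∀ (π : FinPerm N) γ, cod (π • γ) = π • cod γ

attribute [instance] Signature.nominal

namespace Signature

variable {N : Type u} [DecidableEq N] (S : Signature N)

/-- The inputs of a term. -/
def tdom : Term N S.Gen → Finset N
  | .gen γ => S.dom γ
  | .idt A => A
  | .ren a _ => {a}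
  | .tensor t s => tdom t ∪ tdom s
  | .comp t _ => tdom t
  | .perm π t => π • tdom t

/-- The outputs of a term. -/
def tcod : Term N S.Gen → Finset N
  | .gen γ => S.cod γ
  | .idt A => A
  | .ren _ b => {b}
  | .tensor t s => tcod t ∪ tcod s
  | .comp _ s => tcod s
  | .perm π t => π • tcod t

/-- Well-typed terms. -/
def WT : Term N S.Gen → Prop
  | .gen _ => True
  | .idt _ => True
  | .ren _ _ => True
  | .tensor t s =>
      WT t ∧ WT s ∧ Disjoint (S.tdom t) (S.tdom s) ∧ Disjoint (S.tcod t) (S.tcod s)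
  | .comp t s => WT t ∧ WT s ∧ S.tcod t = S.tdom s
  | .perm _ t => WT t

theorem wt_gen (γ : S.Gen) : S.WT (.gen γ) := trivial

theorem wt_idt (A : Finset N) : S.WT (.idt A) := trivial

theorem wt_ren (a b : N) : S.WT (.ren a b) := trivial

end Signature

/-- A nominal monoidal theory: a nominal set of generators together with a set of equations
between well-typed terms of the same type that is closed under permutations of names. -/
structure Theory (N : Type u) [DecidableEq N] extends Signature N where
  eqn : Term N Gen → Term N Gen → Prop
  eqn_act : ∀ (π : FinPerm N) t s, eqn t s → eqn (t.act π) (s.act π)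
  eqn_typed : ∀ t s, eqn t s → toSignature.WT t ∧ toSignature.WT s ∧
    toSignature.tdom t = toSignature.tdom s ∧ toSignature.tcod t = toSignature.tcod s

end Terms

namespace Theory

variable {N : Type u} [DecidableEq N]

open Term

/-- The equations of a nominal monoidal theory: its own equations, the equations of a strict
monoidal category with commutative tensor, the equations describing the permutation action, and
the equations for renamings. They are imposed whenever both sides are well-typed. -/
inductive BasicEq (T : Theory N) : Term N T.Gen → Term N T.Gen → Prop
  | eqn (t s) : T.eqn t s → BasicEq T t s
  | id_comp (t) : BasicEq T (comp (idt (T.tdom t)) t) t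
  | comp_id (t) : BasicEq T (comp t (idt (T.tcod t))) t
  | comp_assoc (t s r) : BasicEq T (comp (comp t s) r) (comp t (comp s r))
  | empty_tensor (t) : BasicEq T (tensor (idt ∅) t) t
  | tensor_empty (t) : BasicEq T (tensor t (idt ∅)) t
  | tensor_assoc (t s r) : BasicEq T (tensor (tensor t s) r) (tensor t (tensor s r))
  | tensor_comm (t s) : BasicEq T (tensor t s) (tensor s t)
  | interchange (s t p q) :
      BasicEq T (tensor (comp s t) (comp p q)) (comp (tensor s p) (tensor t q))
  | tensor_id (A B) : BasicEq T (tensor (idt A) (idt B)) (idt (A ∪ B))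
  | perm_one (t) : BasicEq T (perm 1 t) t
  | perm_mul (π σ t) : BasicEq T (perm (π * σ) t) (perm π (perm σ t))
  | perm_id (π A) : BasicEq T (perm π (idt A)) (idt (π • A))
  | perm_ren (π a b) : BasicEq T (perm π (ren a b)) (ren (π • a) (π • b))
  | perm_gen (π γ) : BasicEq T (perm π (gen γ)) (gen (π • γ))
  | perm_tensor (π t s) : BasicEq T (perm π (tensor t s)) (tensor (perm π t) (perm π s))
  | perm_comp (π t s) : BasicEq T (perm π (comp t s)) (comp (perm π t) (perm π s))
  | ren_self (a) : BasicEq T (ren a a) (idt {a})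
  | ren_comp_ren (a b c) : BasicEq T (comp (ren a b) (ren b c)) (ren a c)
  | gen_out (γ B b x) : T.cod γ = B ∪ {b} → b ∉ T.dom γ → x ∉ T.dom γ →
      BasicEq T (comp (gen γ) (tensor (idt B) (ren b x))) (perm (tr b x) (gen γ))
  | gen_in (γ A a x) : T.dom γ = {a} ∪ A → a ∉ T.cod γ → x ∉ T.cod γ →
      BasicEq T (comp (tensor (ren x a) (idt A)) (gen γ)) (perm (tr x a) (gen γ))
  | gen_both (γ A B c x) : T.dom γ = A ∪ {c} → c ∉ A → T.cod γ = B ∪ {c} → c ∉ B →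
      BasicEq T (comp (gen γ) (tensor (idt B) (ren c x)))
        (comp (tensor (idt A) (ren c x)) (perm (tr c x) (gen γ)))

/-- Derivable equality of well-typed terms: the congruence generated by `BasicEq`. -/
inductive Eqv (T : Theory N) : Term N T.Gen → Term N T.Gen → Prop
  | basic {t s} : BasicEq T t s → T.WT t → T.WT s → Eqv T t s
  | refl {t} : T.WT t → Eqv T t t
  | symm {t s} : Eqv T t s → Eqv T s t
  | trans {t s r} : Eqv T t s → Eqv T s r → Eqv T t r
  | tensor {t t' s s'} : Eqv T t t' → Eqv T s s' → T.WT (.tensor t s) →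
      Eqv T (.tensor t s) (.tensor t' s')
  | comp {t t' s s'} : Eqv T t t' → Eqv T s s' → T.WT (.comp t s) →
      Eqv T (.comp t s) (.comp t' s')
  | perm {t s} (π) : Eqv T t s → Eqv T (.perm π t) (.perm π s)

theorem tr_smul_of_notMem {A : Finset N} {a b : N} (ha : a ∉ A) (hb : b ∉ A) :
    tr a b • A = A := by
  have : ∀ c ∈ A, tr a b • c = c := fun c hc =>
    Equiv.swap_apply_of_ne_of_ne (fun h => ha (h ▸ hc)) (fun h => hb (h ▸ hc))
  ext c
  rw [Finset.mem_smul_finset]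
  constructor
  · rintro ⟨d, hd, rfl⟩
    rwa [this d hd]
  · intro hc
    exact ⟨c, hc, this c hc⟩

theorem tr_smul_left (a b : N) : tr a b • a = b := Equiv.swap_apply_left a b

theorem tr_smul_right (a b : N) : tr a b • b = a := Equiv.swap_apply_right a b

theorem BasicEq.typed {T : Theory N} {t s : Term N T.Gen} (h : BasicEq T t s) (ht : T.WT t)
    (hs : T.WT s) : T.tdom t = T.tdom s ∧ T.tcod t = T.tcod s := by
  cases h with
  | eqn t s h => exact (T.eqn_typed t s h).2.2
  | id_comp t => exact ⟨rfl, rfl⟩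
  | comp_id t => exact ⟨rfl, rfl⟩
  | comp_assoc t s r => exact ⟨rfl, rfl⟩
  | empty_tensor t => exact ⟨Finset.empty_union _, Finset.empty_union _⟩
  | tensor_empty t => exact ⟨Finset.union_empty _, Finset.union_empty _⟩
  | tensor_assoc t s r => exact ⟨Finset.union_assoc _ _ _, Finset.union_assoc _ _ _⟩
  | tensor_comm t s => exact ⟨Finset.union_comm _ _, Finset.union_comm _ _⟩
  | interchange s t p q => exact ⟨rfl, rfl⟩
  | tensor_id A B => exact ⟨rfl, rfl⟩
  | perm_one t => exact ⟨one_smul _ _, one_smul _ _⟩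
  | perm_mul π σ t => exact ⟨mul_smul _ _ _, mul_smul _ _ _⟩
  | perm_id π A => exact ⟨rfl, rfl⟩
  | perm_ren π a b => exact ⟨Finset.smul_finset_singleton _, Finset.smul_finset_singleton _⟩
  | perm_gen π γ => exact ⟨(T.dom_smul π γ).symm, (T.cod_smul π γ).symm⟩
  | perm_tensor π t s => exact ⟨Finset.smul_finset_union, Finset.smul_finset_union⟩
  | perm_comp π t s => exact ⟨rfl, rfl⟩
  | ren_self a => exact ⟨rfl, rfl⟩
  | ren_comp_ren a b c => exact ⟨rfl, rfl⟩
  | gen_out γ B b x h hb hx =>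
    simp only [Signature.WT, Signature.tdom, Signature.tcod, Finset.disjoint_singleton_right] at ht
    simp only [Signature.tdom, Signature.tcod]
    obtain ⟨-, ⟨-, -, h1, h2⟩, -⟩ := ht
    rw [tr_smul_of_notMem hb hx, h, Finset.smul_finset_union, tr_smul_of_notMem h1 h2,
      Finset.smul_finset_singleton, tr_smul_left]
    exact ⟨rfl, rfl⟩
  | gen_in γ A a x h ha hx =>
    simp only [Signature.WT, Signature.tdom, Signature.tcod, Finset.disjoint_singleton_left] at ht
    simp only [Signature.tdom, Signature.tcod]
    obtain ⟨⟨-, -, h1, h2⟩, -, -⟩ := ht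
    rw [tr_smul_of_notMem hx ha, h, Finset.smul_finset_union, tr_smul_of_notMem h1 h2,
      Finset.smul_finset_singleton, tr_smul_right]
    exact ⟨rfl, rfl⟩
  | gen_both γ A B c x h hA h' hB =>
    simp only [Signature.WT, Signature.tdom, Signature.tcod,
      Finset.disjoint_singleton_right] at ht hs
    simp only [Signature.tdom, Signature.tcod]
    obtain ⟨-, ⟨-, -, h1, h2⟩, -⟩ := ht
    obtain ⟨⟨-, -, h3, h4⟩, -, -⟩ := hs
    rw [h, h', Finset.smul_finset_union, tr_smul_of_notMem h1 h2,
      Finset.smul_finset_singleton, tr_smul_left]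
    exact ⟨rfl, rfl⟩

theorem Eqv.typed {T : Theory N} {t s : Term N T.Gen} (h : Eqv T t s) :
    T.WT t ∧ T.WT s ∧ T.tdom t = T.tdom s ∧ T.tcod t = T.tcod s := by
  induction h with
  | basic h ht hs => exact ⟨ht, hs, h.typed ht hs⟩
  | refl h => exact ⟨h, h, rfl, rfl⟩
  | symm _ ih => exact ⟨ih.2.1, ih.1, ih.2.2.1.symm, ih.2.2.2.symm⟩
  | trans _ _ ih ih' =>
    exact ⟨ih.1, ih'.2.1, ih.2.2.1.trans ih'.2.2.1, ih.2.2.2.trans ih'.2.2.2⟩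
  | tensor _ _ hw ih ih' =>
    refine ⟨hw, ?_, ?_⟩
    · obtain ⟨h1, h2, h3, h4⟩ := hw
      exact ⟨ih.2.1, ih'.2.1, ih.2.2.1 ▸ ih'.2.2.1 ▸ h3, ih.2.2.2 ▸ ih'.2.2.2 ▸ h4⟩
    · simp only [Signature.tdom, Signature.tcod, ih.2.2.1, ih'.2.2.1, ih.2.2.2, ih'.2.2.2,
        and_self]
  | comp _ _ hw ih ih' =>
    exact ⟨hw, ⟨ih.2.1, ih'.2.1, ih.2.2.2 ▸ ih'.2.2.1 ▸ hw.2.2⟩, ih.2.2.1, ih'.2.2.2⟩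
  | perm π _ ih =>
    exact ⟨ih.1, ih.2.1, congrArg (π • ·) ih.2.2.1, congrArg (π • ·) ih.2.2.2⟩

/-- Well-typed terms up to derivable equality. -/
instance setoid (T : Theory N) : Setoid {t : Term N T.Gen // T.WT t} where
  r t s := Eqv T t.1 s.1
  iseqv := ⟨fun t => Eqv.refl t.2, Eqv.symm, Eqv.trans⟩

/-- The arrows presented by a theory: well-typed terms modulo derivable equality. -/
abbrev PArrow (T : Theory N) : Type u := Quotient T.setoid

namespace PArrow

variable {T : Theory N}

/-- The arrow presented by a well-typed term. -/
def mk (t : Term N T.Gen) (h : T.WT t) : T.PArrow := Quotient.mk _ ⟨t, h⟩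

theorem mk_eq {t s : Term N T.Gen} {h : T.WT t} {h' : T.WT s} (e : Eqv T t s) :
    mk t h = mk s h' := Quotient.sound e

theorem mk_basic {t s : Term N T.Gen} {h : T.WT t} {h' : T.WT s} (e : BasicEq T t s) :
    mk t h = mk s h' := mk_eq (.basic e h h')

theorem exists_rep (f : T.PArrow) : ∃ t h, f = mk t h := by
  induction f using Quotient.inductionOn with
  | h t => exact ⟨t.1, t.2, rfl⟩

def dom : T.PArrow → Finset N :=
  Quotient.lift (fun t => T.tdom t.1) fun _ _ h => (Eqv.typed h).2.2.1

def cod : T.PArrow → Finset N :=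
  Quotient.lift (fun t => T.tcod t.1) fun _ _ h => (Eqv.typed h).2.2.2

def act (π : FinPerm N) : T.PArrow → T.PArrow :=
  Quotient.map (fun t => ⟨.perm π t.1, t.2⟩) fun _ _ h => Eqv.perm π h

@[simp] theorem dom_mk (t : Term N T.Gen) (h : T.WT t) : dom (mk t h) = T.tdom t := rfl

@[simp] theorem cod_mk (t : Term N T.Gen) (h : T.WT t) : cod (mk t h) = T.tcod t := rfl

theorem act_mk (π : FinPerm N) (t : Term N T.Gen) (h : T.WT t) :
    act π (mk t h) = mk (.perm π t) h := rfl

theorem dom_out (f : T.PArrow) : T.tdom f.out.1 = dom f := by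
  conv_rhs => rw [← Quotient.out_eq f]
  rfl

theorem cod_out (f : T.PArrow) : T.tcod f.out.1 = cod f := by
  conv_rhs => rw [← Quotient.out_eq f]
  rfl

/-- Sequential composition, on representatives: see `comp_mk`. -/
noncomputable def comp (f g : T.PArrow) (h : cod f = dom g) : T.PArrow :=
  mk (.comp f.out.1 g.out.1) ⟨f.out.2, g.out.2, by rw [cod_out, dom_out, h]⟩

/-- Parallel composition, on representatives: see `tensor_mk`. -/
noncomputable def tensor (f g : T.PArrow) (h : Disjoint (dom f) (dom g))
    (h' : Disjoint (cod f) (cod g)) : T.PArrow :=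
  mk (.tensor f.out.1 g.out.1)
    ⟨f.out.2, g.out.2, by rwa [dom_out, dom_out], by rwa [cod_out, cod_out]⟩

theorem comp_mk (t s : Term N T.Gen) (ht : T.WT t) (hs : T.WT s)
    (h : cod (mk t ht) = dom (mk s hs)) :
    comp (mk t ht) (mk s hs) h = mk (.comp t s) ⟨ht, hs, h⟩ :=
  mk_eq (Eqv.comp (Quotient.mk_out (s := T.setoid) ⟨t, ht⟩)
    (Quotient.mk_out (s := T.setoid) ⟨s, hs⟩)
    ⟨Subtype.prop _, Subtype.prop _, by rw [cod_out, dom_out]; exact h⟩)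

theorem tensor_mk (t s : Term N T.Gen) (ht : T.WT t) (hs : T.WT s)
    (h : Disjoint (dom (mk t ht)) (dom (mk s hs)))
    (h' : Disjoint (cod (mk t ht)) (cod (mk s hs))) :
    tensor (mk t ht) (mk s hs) h h' = mk (.tensor t s) ⟨ht, hs, h, h'⟩ :=
  mk_eq (Eqv.tensor (Quotient.mk_out (s := T.setoid) ⟨t, ht⟩)
    (Quotient.mk_out (s := T.setoid) ⟨s, hs⟩)
    ⟨Subtype.prop _, Subtype.prop _, by rw [dom_out, dom_out]; exact h,
      by rw [cod_out, cod_out]; exact h'⟩)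

theorem comp_eq {f g : T.PArrow} {t s : Term N T.Gen} {ht : T.WT t} {hs : T.WT s}
    (hf : f = mk t ht) (hg : g = mk s hs) (h : cod f = dom g) :
    comp f g h = mk (.comp t s) ⟨ht, hs, by subst hf hg; exact h⟩ := by
  subst hf hg
  exact comp_mk t s ht hs h

theorem tensor_eq {f g : T.PArrow} {t s : Term N T.Gen} {ht : T.WT t} {hs : T.WT s}
    (hf : f = mk t ht) (hg : g = mk s hs) (h : Disjoint (dom f) (dom g))
    (h' : Disjoint (cod f) (cod g)) :
    tensor f g h h' = mk (.tensor t s) ⟨ht, hs, by subst hf hg; exact h,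
      by subst hf hg; exact h'⟩ := by
  subst hf hg
  exact tensor_mk t s ht hs h h'

instance : MulAction (FinPerm N) T.PArrow where
  smul := act
  one_smul f := by
    obtain ⟨t, h, rfl⟩ := exists_rep f
    exact mk_basic (.perm_one t)
  mul_smul π σ f := by
    obtain ⟨t, h, rfl⟩ := exists_rep f
    exact mk_basic (.perm_mul π σ t)

theorem smul_mk (π : FinPerm N) (t : Term N T.Gen) (h : T.WT t) :
    π • mk t h = mk (.perm π t) h := rfl

theorem disjoint_smul (π : FinPerm N) {A B : Finset N} (h : Disjoint A B) :
    Disjoint (π • A) (π • B) := by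
  rw [Finset.disjoint_left] at h ⊢
  intro a ha hb
  obtain ⟨c, hc, rfl⟩ := Finset.mem_smul_finset.1 ha
  exact h hc ((Finset.smul_mem_smul_finset_iff π).1 hb)

theorem smul_eq_of_forall {π : FinPerm N} {A : Finset N} (h : ∀ a ∈ A, π • a = a) :
    π • A = A := by
  ext c
  rw [Finset.mem_smul_finset]
  constructor
  · rintro ⟨d, hd, rfl⟩
    rwa [h d hd]
  · intro hc
    exact ⟨c, hc, h c hc⟩

theorem exists_support (t : Term N T.Gen) (h : T.WT t) :
    ∃ S : Finset N, ∀ π : FinPerm N, (∀ a ∈ S, π • a = a) → Eqv T (.perm π t) t := by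
  induction t with
  | gen γ =>
    obtain ⟨S, hS⟩ := NominalSet.exists_support (N := N) γ
    refine ⟨S, fun π hπ => ?_⟩
    have := hS π (fun a ha => hπ a ha)
    have e : Eqv T (.perm π (.gen γ)) (.gen (π • γ)) := .basic (.perm_gen π γ) trivial trivial
    rwa [this] at e
  | idt A =>
    refine ⟨A, fun π hπ => ?_⟩
    have e : Eqv T (.perm π (.idt A)) (.idt (π • A)) := .basic (.perm_id π A) trivial trivial
    rwa [smul_eq_of_forall hπ] at e
  | ren a b =>
    refine ⟨{a, b}, fun π hπ => ?_⟩
    have e : Eqv T (.perm π (.ren a b)) (.ren (π • a) (π • b)) :=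
      .basic (.perm_ren π a b) trivial trivial
    rwa [hπ a (by simp), hπ b (by simp)] at e
  | tensor t s iht ihs =>
    obtain ⟨A, hA⟩ := iht h.1
    obtain ⟨B, hB⟩ := ihs h.2.1
    refine ⟨A ∪ B, fun π hπ => ?_⟩
    have hw : T.WT (.tensor (.perm π t) (.perm π s)) :=
      ⟨h.1, h.2.1, disjoint_smul π h.2.2.1, disjoint_smul π h.2.2.2⟩
    exact (Eqv.basic (.perm_tensor π t s) h hw).trans
      (.tensor (hA π fun a ha => hπ a (Finset.mem_union_left _ ha))
        (hB π fun a ha => hπ a (Finset.mem_union_right _ ha)) hw)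
  | comp t s iht ihs =>
    obtain ⟨A, hA⟩ := iht h.1
    obtain ⟨B, hB⟩ := ihs h.2.1
    refine ⟨A ∪ B, fun π hπ => ?_⟩
    have hw : T.WT (.comp (.perm π t) (.perm π s)) :=
      ⟨h.1, h.2.1, congrArg (π • ·) h.2.2⟩
    exact (Eqv.basic (.perm_comp π t s) h hw).trans
      (.comp (hA π fun a ha => hπ a (Finset.mem_union_left _ ha))
        (hB π fun a ha => hπ a (Finset.mem_union_right _ ha)) hw)
  | perm σ t iht =>
    have ht : T.WT t := h
    obtain ⟨A, hA⟩ := iht ht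
    refine ⟨σ • A, fun π hπ => ?_⟩
    have h1 : Eqv T (.perm (σ⁻¹ * π * σ) t) t := hA _ fun a ha => by
      rw [mul_smul, mul_smul, hπ _ (Finset.smul_mem_smul_finset ha), inv_smul_smul]
    have h2 : Eqv T (.perm (π * σ) t) (.perm π (.perm σ t)) :=
      .basic (.perm_mul π σ t) ht ht
    have h3 : Eqv T (.perm (σ * (σ⁻¹ * π * σ)) t) (.perm σ (.perm (σ⁻¹ * π * σ) t)) :=
      .basic (.perm_mul _ _ t) ht ht
    rw [show σ * (σ⁻¹ * π * σ) = π * σ by group] at h3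
    exact (h2.symm.trans h3).trans (.perm σ h1)

instance : NominalSet N T.PArrow where
  exists_support f := by
    obtain ⟨t, h, rfl⟩ := PArrow.exists_rep f
    obtain ⟨S, hS⟩ := exists_support t h
    exact ⟨S, fun π hπ => mk_eq (hS π fun a ha => hπ ha)⟩

end PArrow

open PArrow in
/-- The monoidal category internal in nominal sets that is freely generated by a theory. -/
noncomputable def category (T : Theory N) : NominalCategory N where
  Arrow := T.PArrow
  dom := PArrow.dom
  cod := PArrow.cod
  dom_smul π f := by obtain ⟨t, h, rfl⟩ := exists_rep f; rfl
  cod_smul π f := by obtain ⟨t, h, rfl⟩ := exists_rep f; rfl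
  id A := PArrow.mk (T := T) (Term.idt A) (T.wt_idt A)
  dom_id _ := rfl
  cod_id _ := rfl
  smul_id π A := mk_basic (.perm_id π A)
  comp := PArrow.comp
  dom_comp f g h := by
    obtain ⟨t, ht, rfl⟩ := exists_rep f
    obtain ⟨s, hs, rfl⟩ := exists_rep g
    rw [comp_mk]; rfl
  cod_comp f g h := by
    obtain ⟨t, ht, rfl⟩ := exists_rep f
    obtain ⟨s, hs, rfl⟩ := exists_rep g
    rw [comp_mk]; rfl
  smul_comp π f g h h' := by
    obtain ⟨t, ht, rfl⟩ := exists_rep f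
    obtain ⟨s, hs, rfl⟩ := exists_rep g
    rw [comp_mk]
    exact (mk_basic (.perm_comp π t s)).trans (comp_eq (smul_mk π t ht) (smul_mk π s hs) h').symm
  id_comp f h := by
    obtain ⟨t, ht, rfl⟩ := exists_rep f
    exact (comp_eq rfl rfl h).trans (mk_basic (.id_comp t))
  comp_id f h := by
    obtain ⟨t, ht, rfl⟩ := exists_rep f
    exact (comp_eq rfl rfl h).trans (mk_basic (.comp_id t))
  comp_assoc f g k h₁ h₂ h₃ h₄ := by
    obtain ⟨t, ht, rfl⟩ := exists_rep f
    obtain ⟨s, hs, rfl⟩ := exists_rep g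
    obtain ⟨r, hr, rfl⟩ := exists_rep k
    exact (comp_eq (comp_eq rfl rfl h₁) rfl h₂).trans
      ((mk_basic (.comp_assoc t s r)).trans (comp_eq rfl (comp_eq rfl rfl h₃) h₄).symm)
  tensor := PArrow.tensor
  dom_tensor f g h h' := by
    obtain ⟨t, ht, rfl⟩ := exists_rep f
    obtain ⟨s, hs, rfl⟩ := exists_rep g
    rw [tensor_mk]; rfl
  cod_tensor f g h h' := by
    obtain ⟨t, ht, rfl⟩ := exists_rep f
    obtain ⟨s, hs, rfl⟩ := exists_rep g
    rw [tensor_mk]; rfl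
  smul_tensor π f g h₁ h₂ h₃ h₄ := by
    obtain ⟨t, ht, rfl⟩ := exists_rep f
    obtain ⟨s, hs, rfl⟩ := exists_rep g
    rw [tensor_mk]
    exact (mk_basic (.perm_tensor π t s)).trans
      (tensor_eq (smul_mk π t ht) (smul_mk π s hs) h₃ h₄).symm
  tensor_id A B h₁ h₂ := by
    exact (tensor_eq rfl rfl h₁ h₂).trans (mk_basic (.tensor_id A B))
  empty_tensor f h₁ h₂ := by
    obtain ⟨t, ht, rfl⟩ := exists_rep f
    exact (tensor_eq rfl rfl h₁ h₂).trans (mk_basic (.empty_tensor t))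
  tensor_assoc f g k h₁ h₂ h₃ h₄ h₅ h₆ h₇ h₈ := by
    obtain ⟨t, ht, rfl⟩ := exists_rep f
    obtain ⟨s, hs, rfl⟩ := exists_rep g
    obtain ⟨r, hr, rfl⟩ := exists_rep k
    exact (tensor_eq (tensor_eq rfl rfl h₁ h₂) rfl h₃ h₄).trans
      ((mk_basic (.tensor_assoc t s r)).trans
        (tensor_eq rfl (tensor_eq rfl rfl h₅ h₆) h₇ h₈).symm)
  tensor_comm f g h₁ h₂ h₃ h₄ := by
    obtain ⟨t, ht, rfl⟩ := exists_rep f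
    obtain ⟨s, hs, rfl⟩ := exists_rep g
    simp only [tensor_mk]
    exact mk_basic (.tensor_comm t s)
  interchange s t p q h₁ h₂ h₃ h₄ h₅ h₆ h₇ h₈ h₉ := by
    obtain ⟨s, hs, rfl⟩ := exists_rep s
    obtain ⟨t, ht, rfl⟩ := exists_rep t
    obtain ⟨p, hp, rfl⟩ := exists_rep p
    obtain ⟨q, hq, rfl⟩ := exists_rep q
    exact (tensor_eq (comp_eq rfl rfl h₁) (comp_eq rfl rfl h₂) h₃ h₄).trans
      ((mk_basic (.interchange s t p q)).trans
        (comp_eq (tensor_eq rfl rfl h₅ h₆) (tensor_eq rfl rfl h₇ h₈) h₉).symm)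
  δ a b := PArrow.mk (T := T) (Term.ren a b) (T.wt_ren a b)
  dom_δ _ _ := rfl
  cod_δ _ _ := rfl
  smul_δ π a b := mk_basic (.perm_ren π a b)
  δ_self a := mk_basic (.ren_self a)
  δ_comp_δ a b c h := by
    exact (comp_eq rfl rfl h).trans (mk_basic (.ren_comp_ren a b c))

/-- The arrow presented by a generator. -/
def genArrow (T : Theory N) (γ : T.Gen) : T.category.Arrow := PArrow.mk (.gen γ) trivial

end Theory

section Calculi

/-- The four families of generators. -/
inductive Kind : Type
  | unit | mult | counit | comult

/-- The generators `η_a : ∅ → {a}`, `μ_abc : {a, b} → {c}` with `a ≠ b`, `η̂_a : {a} → ∅` and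
`μ̂_abc : {a} → {b, c}` with `b ≠ c`, as far as their families belong to `K`. -/
inductive CGen (N : Type u) (K : Set Kind) : Type u
  | eta (h : Kind.unit ∈ K) (a : N)
  | mu (h : Kind.mult ∈ K) (a b c : N) (hab : a ≠ b)
  | etaHat (h : Kind.counit ∈ K) (a : N)
  | muHat (h : Kind.comult ∈ K) (a b c : N) (hbc : b ≠ c)

namespace CGen

variable {N : Type u} [DecidableEq N] {K : Set Kind}

theorem smul_ne (π : FinPerm N) {a b : N} (h : a ≠ b) : π • a ≠ π • b :=
  fun e => h (MulAction.injective π e)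

instance : SMul (FinPerm N) (CGen N K) where
  smul π
    | .eta h a => .eta h (π • a)
    | .mu h a b c hab => .mu h (π • a) (π • b) (π • c) (smul_ne π hab)
    | .etaHat h a => .etaHat h (π • a)
    | .muHat h a b c hbc => .muHat h (π • a) (π • b) (π • c) (smul_ne π hbc)

theorem smul_eta (π : FinPerm N) (h : Kind.unit ∈ K) (a : N) :
    π • eta h a = eta h (π • a) := rfl

theorem smul_mu (π : FinPerm N) (h : Kind.mult ∈ K) (a b c : N) (hab : a ≠ b) :
    π • mu h a b c hab = mu h (π • a) (π • b) (π • c) (smul_ne π hab) := rfl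

theorem smul_etaHat (π : FinPerm N) (h : Kind.counit ∈ K) (a : N) :
    π • etaHat h a = etaHat h (π • a) := rfl

theorem smul_muHat (π : FinPerm N) (h : Kind.comult ∈ K) (a b c : N) (hbc : b ≠ c) :
    π • muHat h a b c hbc = muHat h (π • a) (π • b) (π • c) (smul_ne π hbc) := rfl

instance : NominalSet N (CGen N K) where
  one_smul γ := by
    cases γ <;> simp only [smul_eta, smul_mu, smul_etaHat, smul_muHat, one_smul]
  mul_smul π σ γ := by
    cases γ <;> simp only [smul_eta, smul_mu, smul_etaHat, smul_muHat, mul_smul]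
  exists_support γ := by
    cases γ with
    | eta h a =>
      refine ⟨{a}, fun π hπ => ?_⟩
      have h1 : π • a = a := hπ (by simp)
      simp only [smul_eta, h1]
    | mu h a b c hab =>
      refine ⟨{a, b, c}, fun π hπ => ?_⟩
      have h1 : π • a = a := hπ (by simp)
      have h2 : π • b = b := hπ (by simp)
      have h3 : π • c = c := hπ (by simp)
      simp only [smul_mu, h1, h2, h3]
    | etaHat h a =>
      refine ⟨{a}, fun π hπ => ?_⟩
      have h1 : π • a = a := hπ (by simp)
      simp only [smul_etaHat, h1]
    | muHat h a b c hbc =>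
      refine ⟨{a, b, c}, fun π hπ => ?_⟩
      have h1 : π • a = a := hπ (by simp)
      have h2 : π • b = b := hπ (by simp)
      have h3 : π • c = c := hπ (by simp)
      simp only [smul_muHat, h1, h2, h3]

def dom : CGen N K → Finset N
  | .eta _ _ => ∅
  | .mu _ a b _ _ => {a, b}
  | .etaHat _ a => {a}
  | .muHat _ a _ _ _ => {a}

def cod : CGen N K → Finset N
  | .eta _ a => {a}
  | .mu _ _ _ c _ => {c}
  | .etaHat _ _ => ∅
  | .muHat _ _ b c _ => {b, c}

end CGen

/-- The generators of the families in `K` with their types. -/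
def signature (N : Type u) [DecidableEq N] (K : Set Kind) : Signature N where
  Gen := CGen N K
  dom := CGen.dom
  cod := CGen.cod
  dom_smul π γ := by
    cases γ <;> simp only [CGen.smul_eta, CGen.smul_mu, CGen.smul_etaHat, CGen.smul_muHat,
      CGen.dom, Finset.smul_finset_empty, Finset.smul_finset_insert, Finset.smul_finset_singleton]
  cod_smul π γ := by
    cases γ <;> simp only [CGen.smul_eta, CGen.smul_mu, CGen.smul_etaHat, CGen.smul_muHat,
      CGen.cod, Finset.smul_finset_empty, Finset.smul_finset_insert, Finset.smul_finset_singleton]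

namespace CTerm

variable {N : Type u} [DecidableEq N] {K : Set Kind}

abbrev eta (h : Kind.unit ∈ K) (a : N) : Term N (CGen N K) := .gen (.eta h a)
abbrev mu (h : Kind.mult ∈ K) (a b c : N) (hab : a ≠ b) : Term N (CGen N K) :=
  .gen (.mu h a b c hab)
abbrev etaHat (h : Kind.counit ∈ K) (a : N) : Term N (CGen N K) := .gen (.etaHat h a)
abbrev muHat (h : Kind.comult ∈ K) (a b c : N) (hbc : b ≠ c) : Term N (CGen N K) :=
  .gen (.muHat h a b c hbc)
/-- the identity on one wire -/
abbrev wire (a : N) : Term N (CGen N K) := .idt {a}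

end CTerm

open CTerm Term in
/-- The equations between the generators, for all choices of names for which both sides are
well-typed.  An equation belongs to the theory over `K` if all its generators do. -/
inductive CEq {N : Type u} [DecidableEq N] (K : Set Kind) :
    Term N (CGen N K) → Term N (CGen N K) → Prop
  -- renaming the wires of a generator
  | eta_ren (h a b) : CEq K (comp (eta h a) (ren a b)) (eta h b)
  | mu_ren (h a b c d hab) : CEq K (comp (mu h a b c hab) (ren c d)) (mu h a b d hab)
  | ren_mu (h a a' b c hab ha'b) :
      CEq K (comp (tensor (ren a a') (wire b)) (mu h a' b c ha'b)) (mu h a b c hab)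
  | ren_etaHat (h a b) : CEq K (comp (ren a b) (etaHat h b)) (etaHat h a)
  | ren_muHat (h a d b c hbc) : CEq K (comp (ren d a) (muHat h a b c hbc)) (muHat h d b c hbc)
  | muHat_ren (h a b b' c hbc hb'c) :
      CEq K (comp (muHat h a b c hbc) (tensor (ren b b') (wire c))) (muHat h a b' c hb'c)
  -- associativity and commutativity
  | mu_assoc (h a b c x y d hab hbc hxc hay) (hac : a ≠ c) :
      CEq K (comp (tensor (mu h a b x hab) (wire c)) (mu h x c d hxc))
        (comp (tensor (wire a) (mu h b c y hbc)) (mu h a y d hay))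
  | mu_comm (h a b c hab hba) : CEq K (mu h a b c hab) (mu h b a c hba)
  -- unit
  | unit (h h' a x b hxa) :
      CEq K (comp (tensor (eta h x) (wire a)) (mu h' x a b hxa)) (ren a b)
  -- undefinedness
  | eta_etaHat (h h' x) : CEq K (comp (eta h x) (etaHat h' x)) (idt ∅)
  | mu_etaHat (h h' a b x hab) :
      CEq K (comp (mu h a b x hab) (etaHat h' x)) (tensor (etaHat h' a) (etaHat h' b))
  -- coassociativity, cocommutativity and counit
  | muHat_assoc (h d a b c x y hab hbc hxc hay) (hac : a ≠ c) :
      CEq K (comp (muHat h d x c hxc) (tensor (muHat h x a b hab) (wire c)))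
        (comp (muHat h d a y hay) (tensor (wire a) (muHat h y b c hbc)))
  | muHat_comm (h a b c hbc hcb) : CEq K (muHat h a b c hbc) (muHat h a c b hcb)
  | counit (h h' a x b hxb) :
      CEq K (comp (muHat h' a x b hxb) (tensor (etaHat h x) (wire b))) (ren a b)
  -- interaction of `η`, `μ` with `μ̂`
  | eta_muHat (h h' x a b hab) :
      CEq K (comp (eta h x) (muHat h' x a b hab)) (tensor (eta h a) (eta h b))
  | mu_muHat (h h' a b x c d p q r s hab hcd hpq hrs hpr hqs)
      (hps : p ≠ s) (hqr : q ≠ r) :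
      CEq K (comp (mu h a b x hab) (muHat h' x c d hcd))
        (comp (tensor (muHat h' a p q hpq) (muHat h' b r s hrs))
          (tensor (mu h p r c hpr) (mu h q s d hqs)))
  | muHat_mu (h h' a x y b hxy) :
      CEq K (comp (muHat h' a x y hxy) (mu h x y b hxy)) (ren a b)

theorem CEq.typed {N : Type u} [DecidableEq N] {K : Set Kind} {t s : Term N (CGen N K)}
    (h : CEq K t s) : (signature N K).WT t ∧ (signature N K).WT s ∧
      (signature N K).tdom t = (signature N K).tdom s ∧
      (signature N K).tcod t = (signature N K).tcod s := by
  cases h <;>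
    simp only [Signature.WT, Signature.tdom, Signature.tcod, signature, CGen.dom, CGen.cod,
      true_and, and_true, Finset.disjoint_singleton] <;>
    simp_all [Finset.ext_iff, Finset.disjoint_left] <;> grind

theorem CEq.act {N : Type u} [DecidableEq N] {K : Set Kind} {t s : Term N (CGen N K)}
    (h : CEq K t s) (π : FinPerm N) : CEq K (t.act π) (s.act π) := by
  cases h <;>
    simp only [Term.act, CGen.smul_eta, CGen.smul_mu, CGen.smul_etaHat, CGen.smul_muHat,
      Finset.smul_finset_singleton, Finset.smul_finset_empty] <;>
    constructor <;> exact CGen.smul_ne π ‹_›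

/-- The nominal monoidal theory with the families of generators in `K` and the equations that
concern them. -/
def calculus (N : Type u) [DecidableEq N] (K : Set Kind) : Theory N where
  toSignature := signature N K
  eqn := CEq K
  eqn_act π _ _ h := h.act π
  eqn_typed _ _ h := h.typed

end Calculi

section Relations

/-- A relation between finite sets of names. -/
@[ext]
structure RelArrow (N : Type u) where
  dom : Finset N
  cod : Finset N
  rel : N → N → Prop
  mem : ∀ {a b}, rel a b → a ∈ dom ∧ b ∈ cod

namespace RelArrow

theorem ext_of_iff {N : Type u} {R S : RelArrow N} (h₁ : R.dom = S.dom) (h₂ : R.cod = S.cod)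
    (h₃ : ∀ a b, R.rel a b ↔ S.rel a b) : R = S :=
  RelArrow.ext h₁ h₂ (by funext a b; exact propext (h₃ a b))

variable {N : Type u} [DecidableEq N]

instance : SMul (FinPerm N) (RelArrow N) where
  smul π R :=
    { dom := π • R.dom
      cod := π • R.cod
      rel := fun a b => R.rel (π⁻¹ • a) (π⁻¹ • b)
      mem := fun h => ⟨Finset.inv_smul_mem_iff.1 (R.mem h).1, Finset.inv_smul_mem_iff.1 (R.mem h).2⟩ }

theorem smul_dom (π : FinPerm N) (R : RelArrow N) : (π • R).dom = π • R.dom := rfl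
theorem smul_cod (π : FinPerm N) (R : RelArrow N) : (π • R).cod = π • R.cod := rfl
theorem smul_rel (π : FinPerm N) (R : RelArrow N) (a b : N) :
    (π • R).rel a b ↔ R.rel (π⁻¹ • a) (π⁻¹ • b) := Iff.rfl

instance : NominalSet N (RelArrow N) where
  one_smul R := ext_of_iff (one_smul _ _) (one_smul _ _) fun a b => by
    rw [smul_rel, inv_one, one_smul, one_smul]
  mul_smul π σ R := ext_of_iff (mul_smul _ _ _) (mul_smul _ _ _) fun a b => by
    simp only [smul_rel, mul_inv_rev, mul_smul]
  exists_support R := by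
    refine ⟨R.dom ∪ R.cod, fun π hπ => ?_⟩
    have h1 : ∀ a ∈ R.dom, π • a = a := fun a ha => hπ (by simp [ha])
    have h2 : ∀ a ∈ R.cod, π • a = a := fun a ha => hπ (by simp [ha])
    refine ext_of_iff (Theory.PArrow.smul_eq_of_forall h1) (Theory.PArrow.smul_eq_of_forall h2)
      fun a b => ?_
    rw [smul_rel]
    constructor
    · intro h
      have := R.mem h
      have e1 := h1 _ this.1
      have e2 := h2 _ this.2
      rw [smul_inv_smul] at e1 e2
      rwa [← e1, ← e2] at h
    · intro h
      have := R.mem h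
      rwa [inv_smul_eq_iff.2 (h1 _ this.1).symm, inv_smul_eq_iff.2 (h2 _ this.2).symm]

/-- The identity relation. -/
def id (A : Finset N) : RelArrow N where
  dom := A
  cod := A
  rel a b := a = b ∧ a ∈ A
  mem := by rintro a b ⟨rfl, h⟩; exact ⟨h, h⟩

/-- Composition of relations, in diagrammatic order. -/
def comp (R S : RelArrow N) : RelArrow N where
  dom := R.dom
  cod := S.cod
  rel a c := ∃ b, R.rel a b ∧ S.rel b c
  mem := by rintro a c ⟨b, h, h'⟩; exact ⟨(R.mem h).1, (S.mem h').2⟩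

/-- Union of relations. -/
def union (R S : RelArrow N) : RelArrow N where
  dom := R.dom ∪ S.dom
  cod := R.cod ∪ S.cod
  rel a b := R.rel a b ∨ S.rel a b
  mem := by
    rintro a b (h | h)
    · exact ⟨Finset.mem_union_left _ (R.mem h).1, Finset.mem_union_left _ (R.mem h).2⟩
    · exact ⟨Finset.mem_union_right _ (S.mem h).1, Finset.mem_union_right _ (S.mem h).2⟩

/-- The full relation `A × B`. -/
def full (A B : Finset N) : RelArrow N where
  dom := A
  cod := B
  rel a b := a ∈ A ∧ b ∈ B
  mem h := h

/-- Every input is related to at most one output. -/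
def SingleValued (R : RelArrow N) : Prop := ∀ a b b', R.rel a b → R.rel a b' → b = b'

/-- Every input is related to some output. -/
def Total (R : RelArrow N) : Prop := ∀ a ∈ R.dom, ∃ b, R.rel a b

/-- No two distinct inputs are related to the same output. -/
def Injective (R : RelArrow N) : Prop := ∀ a a' b, R.rel a b → R.rel a' b → a = a'

/-- Every output is related to some input. -/
def Surjective (R : RelArrow N) : Prop := ∀ b ∈ R.cod, ∃ a, R.rel a b

def IsPartialFunction (R : RelArrow N) : Prop := R.SingleValued

def IsFunction (R : RelArrow N) : Prop := R.SingleValued ∧ R.Total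

def IsInjection (R : RelArrow N) : Prop := R.IsFunction ∧ R.Injective

def IsSurjection (R : RelArrow N) : Prop := R.IsFunction ∧ R.Surjective

def IsBijection (R : RelArrow N) : Prop := R.IsFunction ∧ R.Injective ∧ R.Surjective

end RelArrow

/-- The nominal category of finite sets of names and relations. -/
def nRel (N : Type u) [DecidableEq N] : NominalCategory N where
  Arrow := RelArrow N
  dom := RelArrow.dom
  cod := RelArrow.cod
  dom_smul _ _ := rfl
  cod_smul _ _ := rfl
  id := RelArrow.id
  dom_id _ := rfl
  cod_id _ := rfl
  smul_id π A := RelArrow.ext_of_iff rfl rfl fun a b => by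
    simp only [RelArrow.smul_rel, RelArrow.id, smul_left_cancel_iff, Finset.inv_smul_mem_iff]
  comp R S _ := R.comp S
  dom_comp _ _ _ := rfl
  cod_comp _ _ _ := rfl
  smul_comp π R S h h' := RelArrow.ext_of_iff rfl rfl fun a c => by
    simp only [RelArrow.smul_rel, RelArrow.comp]
    constructor
    · rintro ⟨b, h⟩
      exact ⟨π • b, by simpa using h⟩
    · rintro ⟨b, h⟩
      exact ⟨π⁻¹ • b, h⟩
  id_comp R h := RelArrow.ext_of_iff rfl rfl fun a b => by
    simp only [RelArrow.comp, RelArrow.id]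
    exact ⟨by rintro ⟨c, ⟨rfl, -⟩, h⟩; exact h, fun h => ⟨a, ⟨rfl, (R.mem h).1⟩, h⟩⟩
  comp_id R h := RelArrow.ext_of_iff rfl rfl fun a b => by
    simp only [RelArrow.comp, RelArrow.id]
    exact ⟨by rintro ⟨c, h, ⟨rfl, -⟩⟩; exact h, fun h => ⟨b, h, ⟨rfl, (R.mem h).2⟩⟩⟩
  comp_assoc R S Q _ _ _ _ := RelArrow.ext_of_iff rfl rfl fun a b => by
    simp only [RelArrow.comp]
    exact ⟨by rintro ⟨c, ⟨d, h, h'⟩, h''⟩; exact ⟨d, h, c, h', h''⟩,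
      by rintro ⟨d, h, c, h', h''⟩; exact ⟨c, ⟨d, h, h'⟩, h''⟩⟩
  tensor R S _ _ := R.union S
  dom_tensor _ _ _ _ := rfl
  cod_tensor _ _ _ _ := rfl
  smul_tensor π R S _ _ _ _ :=
    RelArrow.ext_of_iff Finset.smul_finset_union Finset.smul_finset_union fun a b => Iff.rfl
  tensor_id A B _ _ := RelArrow.ext_of_iff rfl rfl fun a b => by
    simp only [RelArrow.union, RelArrow.id, Finset.mem_union, and_or_left]
  empty_tensor R _ _ :=
    RelArrow.ext_of_iff (Finset.empty_union _) (Finset.empty_union _) fun a b => by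
      simp only [RelArrow.union, RelArrow.id, Finset.notMem_empty, and_false, false_or]
  tensor_assoc R S Q _ _ _ _ _ _ _ _ :=
    RelArrow.ext_of_iff (Finset.union_assoc _ _ _) (Finset.union_assoc _ _ _) fun a b => or_assoc
  tensor_comm R S _ _ _ _ :=
    RelArrow.ext_of_iff (Finset.union_comm _ _) (Finset.union_comm _ _) fun a b => or_comm
  interchange s t p q h₁ h₂ h₃ h₄ h₅ h₆ h₇ h₈ h₉ := RelArrow.ext_of_iff rfl rfl fun a c => by
    simp only [RelArrow.union, RelArrow.comp]
    constructor
    · rintro (⟨b, h, h'⟩ | ⟨b, h, h'⟩)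
      · exact ⟨b, .inl h, .inl h'⟩
      · exact ⟨b, .inr h, .inr h'⟩
    · rintro ⟨b, h | h, h' | h'⟩
      · exact .inl ⟨b, h, h'⟩
      · exact absurd (q.mem h').1 (h₂ ▸ Finset.disjoint_left.1 h₆ (s.mem h).2)
      · exact absurd (t.mem h').1 (h₁ ▸ Finset.disjoint_right.1 h₆ (p.mem h).2)
      · exact .inr ⟨b, h, h'⟩
  δ a b := RelArrow.full {a} {b}
  dom_δ _ _ := rfl
  cod_δ _ _ := rfl
  smul_δ π a b := RelArrow.ext_of_iff (Finset.smul_finset_singleton _)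
    (Finset.smul_finset_singleton _) fun x y => by
      simp only [RelArrow.smul_rel, RelArrow.full, Finset.mem_singleton, inv_smul_eq_iff]
  δ_self a := RelArrow.ext_of_iff rfl rfl fun x y => by
    simp only [RelArrow.full, RelArrow.id, Finset.mem_singleton]
    exact ⟨by rintro ⟨rfl, rfl⟩; exact ⟨rfl, rfl⟩, by rintro ⟨rfl, rfl⟩; exact ⟨rfl, rfl⟩⟩
  δ_comp_δ a b c _ := RelArrow.ext_of_iff rfl rfl fun x y => by
    simp only [RelArrow.full, RelArrow.comp, Finset.mem_singleton]
    exact ⟨by rintro ⟨z, ⟨h, -⟩, -, h'⟩; exact ⟨h, h'⟩, fun h => ⟨b, ⟨h.1, rfl⟩, rfl, h.2⟩⟩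

/-- A class of relations that is closed under all the operations. -/
structure Closed {N : Type u} [DecidableEq N] (P : RelArrow N → Prop) : Prop where
  smul : ∀ (π : FinPerm N) R, P R → P (π • R)
  id : ∀ A, P (RelArrow.id A)
  comp : ∀ R S, P R → P S → R.cod = S.dom → P (R.comp S)
  union : ∀ R S, P R → P S → Disjoint R.dom S.dom → Disjoint R.cod S.cod → P (R.union S)
  δ : ∀ a b, P (RelArrow.full {a} {b})

namespace Closed

variable {N : Type u} [DecidableEq N]

theorem and {P Q : RelArrow N → Prop} (hP : Closed P) (hQ : Closed Q) :
    Closed fun R => P R ∧ Q R where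
  smul π R h := ⟨hP.smul π R h.1, hQ.smul π R h.2⟩
  id A := ⟨hP.id A, hQ.id A⟩
  comp R S h h' e := ⟨hP.comp R S h.1 h'.1 e, hQ.comp R S h.2 h'.2 e⟩
  union R S h h' e e' := ⟨hP.union R S h.1 h'.1 e e', hQ.union R S h.2 h'.2 e e'⟩
  δ a b := ⟨hP.δ a b, hQ.δ a b⟩

theorem singleValued : Closed (RelArrow.SingleValued (N := N)) where
  smul π R h a b b' h₁ h₂ := MulAction.injective π⁻¹ (h _ _ _ h₁ h₂)
  id A := by rintro a b b' ⟨rfl, -⟩ ⟨rfl, -⟩; rfl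
  comp R S h h' _ := by
    rintro a b b' ⟨c, h₁, h₂⟩ ⟨c', h₃, h₄⟩
    obtain rfl := h _ _ _ h₁ h₃
    exact h' _ _ _ h₂ h₄
  union R S h h' e _ := by
    rintro a b b' (h₁ | h₁) (h₂ | h₂)
    · exact h _ _ _ h₁ h₂
    · exact absurd (S.mem h₂).1 (Finset.disjoint_left.1 e (R.mem h₁).1)
    · exact absurd (S.mem h₁).1 (Finset.disjoint_left.1 e (R.mem h₂).1)
    · exact h' _ _ _ h₁ h₂
  δ a b := by
    rintro x y y' ⟨-, h⟩ ⟨-, h'⟩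
    rw [Finset.mem_singleton.1 h, Finset.mem_singleton.1 h']

theorem total : Closed (RelArrow.Total (N := N)) where
  smul π R h a ha := by
    obtain ⟨b, hb⟩ := h _ (Finset.inv_smul_mem_iff.2 ha)
    exact ⟨π • b, by rwa [RelArrow.smul_rel, inv_smul_smul]⟩
  id A a ha := ⟨a, rfl, ha⟩
  comp R S h h' e a ha := by
    obtain ⟨b, hb⟩ := h a ha
    obtain ⟨c, hc⟩ := h' b (e ▸ (R.mem hb).2)
    exact ⟨c, b, hb, hc⟩
  union R S h h' _ _ a ha := by
    rcases Finset.mem_union.1 ha with ha | ha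
    · exact (h a ha).imp fun _ => .inl
    · exact (h' a ha).imp fun _ => .inr
  δ a b x hx := ⟨b, hx, Finset.mem_singleton_self b⟩

theorem injective : Closed (RelArrow.Injective (N := N)) where
  smul π R h a b b' h₁ h₂ := MulAction.injective π⁻¹ (h _ _ _ h₁ h₂)
  id A := by rintro a b b' ⟨rfl, -⟩ ⟨rfl, -⟩; rfl
  comp R S h h' _ := by
    rintro a a' b ⟨c, h₁, h₂⟩ ⟨c', h₃, h₄⟩
    obtain rfl := h' _ _ _ h₂ h₄
    exact h _ _ _ h₁ h₃
  union R S h h' _ e := by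
    rintro a b b' (h₁ | h₁) (h₂ | h₂)
    · exact h _ _ _ h₁ h₂
    · exact absurd (S.mem h₂).2 (Finset.disjoint_left.1 e (R.mem h₁).2)
    · exact absurd (S.mem h₁).2 (Finset.disjoint_left.1 e (R.mem h₂).2)
    · exact h' _ _ _ h₁ h₂
  δ a b := by
    rintro x x' y ⟨h, -⟩ ⟨h', -⟩
    rw [Finset.mem_singleton.1 h, Finset.mem_singleton.1 h']

theorem surjective : Closed (RelArrow.Surjective (N := N)) where
  smul π R h b hb := by
    obtain ⟨a, ha⟩ := h _ (Finset.inv_smul_mem_iff.2 hb)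
    exact ⟨π • a, by rwa [RelArrow.smul_rel, inv_smul_smul]⟩
  id A a ha := ⟨a, rfl, ha⟩
  comp R S h h' e c hc := by
    obtain ⟨b, hb⟩ := h' c hc
    obtain ⟨a, ha⟩ := h b (e ▸ (S.mem hb).1)
    exact ⟨a, b, ha, hb⟩
  union R S h h' _ _ b hb := by
    rcases Finset.mem_union.1 hb with hb | hb
    · exact (h b hb).imp fun _ => .inl
    · exact (h' b hb).imp fun _ => .inr
  δ a b x hx := ⟨a, Finset.mem_singleton_self a, hx⟩

theorem isFunction : Closed (RelArrow.IsFunction (N := N)) := singleValued.and total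

/-- The nominal subcategory of `nRel N` given by a closed class of relations. -/
def category {P : RelArrow N → Prop} (hP : Closed P) : NominalCategory N where
  Arrow := {R : RelArrow N // P R}
  nominal :=
    { smul := fun π R => ⟨π • R.1, hP.smul π R.1 R.2⟩
      one_smul := fun R => Subtype.ext (one_smul _ R.1)
      mul_smul := fun π σ R => Subtype.ext (mul_smul π σ R.1)
      exists_support := fun R => (NominalSet.exists_support R.1).imp
        fun _ hS π hπ => Subtype.ext (hS π hπ) }
  dom R := R.1.dom
  cod R := R.1.cod
  dom_smul _ _ := rfl
  cod_smul _ _ := rfl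
  id A := ⟨RelArrow.id A, hP.id A⟩
  dom_id _ := rfl
  cod_id _ := rfl
  smul_id π A := Subtype.ext ((nRel N).smul_id π A)
  comp R S h := ⟨R.1.comp S.1, hP.comp _ _ R.2 S.2 h⟩
  dom_comp _ _ _ := rfl
  cod_comp _ _ _ := rfl
  smul_comp π R S h h' := Subtype.ext ((nRel N).smul_comp π R.1 S.1 h h')
  id_comp R h := Subtype.ext ((nRel N).id_comp R.1 h)
  comp_id R h := Subtype.ext ((nRel N).comp_id R.1 h)
  comp_assoc R S Q h₁ h₂ h₃ h₄ := Subtype.ext ((nRel N).comp_assoc R.1 S.1 Q.1 h₁ h₂ h₃ h₄)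
  tensor R S h h' := ⟨R.1.union S.1, hP.union _ _ R.2 S.2 h h'⟩
  dom_tensor _ _ _ _ := rfl
  cod_tensor _ _ _ _ := rfl
  smul_tensor π R S h₁ h₂ h₃ h₄ := Subtype.ext ((nRel N).smul_tensor π R.1 S.1 h₁ h₂ h₃ h₄)
  tensor_id A B h₁ h₂ := Subtype.ext ((nRel N).tensor_id A B h₁ h₂)
  empty_tensor R h₁ h₂ := Subtype.ext ((nRel N).empty_tensor R.1 h₁ h₂)
  tensor_assoc R S Q h₁ h₂ h₃ h₄ h₅ h₆ h₇ h₈ :=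
    Subtype.ext ((nRel N).tensor_assoc R.1 S.1 Q.1 h₁ h₂ h₃ h₄ h₅ h₆ h₇ h₈)
  tensor_comm R S h₁ h₂ h₃ h₄ := Subtype.ext ((nRel N).tensor_comm R.1 S.1 h₁ h₂ h₃ h₄)
  interchange s t p q h₁ h₂ h₃ h₄ h₅ h₆ h₇ h₈ h₉ :=
    Subtype.ext ((nRel N).interchange s.1 t.1 p.1 q.1 h₁ h₂ h₃ h₄ h₅ h₆ h₇ h₈ h₉)
  δ a b := ⟨RelArrow.full {a} {b}, hP.δ a b⟩
  dom_δ _ _ := rfl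
  cod_δ _ _ := rfl
  smul_δ π a b := Subtype.ext ((nRel N).smul_δ π a b)
  δ_self a := Subtype.ext ((nRel N).δ_self a)
  δ_comp_δ a b c h := Subtype.ext ((nRel N).δ_comp_δ a b c h)

/-- The underlying relation of an arrow. -/
def val {P : RelArrow N → Prop} {hP : Closed P} (f : hP.category.Arrow) : RelArrow N :=
  Subtype.val (p := P) f

end Closed

/-- The nominal category of finite sets of names and partial functions. -/
def nPFun (N : Type u) [DecidableEq N] : NominalCategory N :=
  Closed.category (P := RelArrow.IsPartialFunction (N := N)) Closed.singleValued

/-- The nominal category of finite sets of names and functions. -/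
def nFun (N : Type u) [DecidableEq N] : NominalCategory N :=
  Closed.category (P := RelArrow.IsFunction (N := N)) Closed.isFunction

/-- The nominal category of finite sets of names and surjections. -/
def nSurj (N : Type u) [DecidableEq N] : NominalCategory N :=
  Closed.category (P := RelArrow.IsSurjection (N := N)) (Closed.isFunction.and Closed.surjective)

/-- The nominal category of finite sets of names and injections. -/
def nInj (N : Type u) [DecidableEq N] : NominalCategory N :=
  Closed.category (P := RelArrow.IsInjection (N := N)) (Closed.isFunction.and Closed.injective)

/-- The nominal category of finite sets of names and bijections. -/
def nBij (N : Type u) [DecidableEq N] : NominalCategory N :=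
  Closed.category (P := RelArrow.IsBijection (N := N))
    (Closed.isFunction.and (Closed.injective.and Closed.surjective))

/-- The intended meaning of a generator `γ : A → B`: the full relation `A × B`. In particular
`η_a` and `μ_abc` are the unique functions of their types, `η̂_a` is the unique partial function
of its type and `μ̂_abc` relates `a` to both `b` and `c`. -/
def CGen.meaning {N : Type u} [DecidableEq N] {K : Set Kind} (γ : CGen N K) : RelArrow N :=
  RelArrow.full γ.dom γ.cod

end Relations

end NominalDiagrams

/-! Soundness is a check of each equation for relations, so every arrow of a presented category
denotes a relation (`interp`), which lies in the stated class because the class is closed under the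
operations and contains the generators. What remains is that `interp` is injective and that it
reaches the whole class. Both follow from normal forms that are determined by the denoted relation.

Without `μ̂` an arrow is a parallel composition: for each output `b` the inputs in a fibre `p b` are
merged into `b`, and the inputs in a set `U` are discarded (`CX.exists_fibers`). The relation
determines `p` and `U`, so equal relations give equal arrows (`interp_injective_of_notMem`).
Conversely a partial function has such a form as soon as `η` is available for empty fibres, `μ` for
fibres with at least two elements and `η̂` for undefined inputs (`exists_interp_eq`).

With all generators the normal form starts from the empty relation, where all inputs are discarded
and all outputs created, and adds pairs one at a time: for `(a, b)` the wire `a` is copied to a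
fresh wire, which runs beside the old arrow and is merged into `b` (`CX.addEdge`). Associativity and
commutativity let edges commute, and `μ̂;μ = id` makes them idempotent, so only the set of pairs
matters (`CX.edges_congr`).

Normal forms exist because they survive composition with a layer, that is, one renaming or generator
beside identities, and every arrow is a sequence of layers (`Theory.induction_layers`). The delicate
point there is names: cutting an arrow into layers may put an intermediate name next to an equal
name on another wire. Moving wires to fresh names and back avoids the clash.

Both compositions are partial. Adjoining a value `0` for undefined results makes them total and
turns parallel composition into a commutative monoid with zero, which removes most side conditions.
-/

namespace NominalDiagrams

/-! ### Nominal categories with a zero adjoined: total compositions and interchange. -/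

section PartialArrows

/-- The arrows of a nominal category with an additional element `0`, the value of undefined
compositions. -/
def PX {N : Type u} [DecidableEq N] (C : NominalCategory N) : Type u := Option C.Arrow

namespace PX

variable {N : Type u} [DecidableEq N] {C : NominalCategory N}

/-- An arrow as a defined element. -/
def of (f : C.Arrow) : PX C := some f

instance : Zero (PX C) := ⟨none⟩

theorem of_injective : Function.Injective (of : C.Arrow → PX C) := Option.some_injective _

theorem of_ne_zero (f : C.Arrow) : of f ≠ 0 := Option.some_ne_none f

theorem eq_zero_or (f : PX C) : f = 0 ∨ ∃ g, f = of g := by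
  rcases f with _ | g
  · exact .inl rfl
  · exact .inr ⟨g, rfl⟩

/-- Total parallel composition. -/
def tensor : PX C → PX C → PX C
  | some f, some g =>
    if h : Disjoint (C.dom f) (C.dom g) ∧ Disjoint (C.cod f) (C.cod g) then
      of (C.tensor f g h.1 h.2) else 0
  | _, _ => 0

/-- Total sequential composition. -/
def comp : PX C → PX C → PX C
  | some f, some g => if h : C.cod f = C.dom g then of (C.comp f g h) else 0
  | _, _ => 0

infixl:65 " ⨾ " => PX.comp

/-- The identity on `A`. -/
def I (C : NominalCategory N) (A : Finset N) : PX C := of (C.id A)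

/-- Renamings. -/
def ren (C : NominalCategory N) (a b : N) : PX C := of (C.δ a b)

theorem tensor_of {f g : C.Arrow} (h : Disjoint (C.dom f) (C.dom g))
    (h' : Disjoint (C.cod f) (C.cod g)) : tensor (of f) (of g) = of (C.tensor f g h h') :=
  dif_pos ⟨h, h'⟩

theorem tensor_of_not {f g : C.Arrow}
    (h : ¬ (Disjoint (C.dom f) (C.dom g) ∧ Disjoint (C.cod f) (C.cod g))) :
    tensor (of f) (of g) = 0 := dif_neg h

theorem comp_of {f g : C.Arrow} (h : C.cod f = C.dom g) : of f ⨾ of g = of (C.comp f g h) :=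
  dif_pos h

theorem comp_of_not {f g : C.Arrow} (h : C.cod f ≠ C.dom g) : of f ⨾ of g = 0 := dif_neg h

theorem tensor_zero_left (f : PX C) : tensor 0 f = 0 := rfl

theorem tensor_zero_right (f : PX C) : tensor f 0 = 0 := by rcases f with _ | f <;> rfl

@[simp] theorem zero_comp (f : PX C) : 0 ⨾ f = 0 := rfl

@[simp] theorem comp_zero (f : PX C) : f ⨾ 0 = 0 := by rcases f with _ | f <;> rfl

theorem tensor_comm (f g : PX C) : tensor f g = tensor g f := by
  rcases eq_zero_or f with rfl | ⟨f, rfl⟩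
  · rw [tensor_zero_left, tensor_zero_right]
  rcases eq_zero_or g with rfl | ⟨g, rfl⟩
  · rw [tensor_zero_left, tensor_zero_right]
  by_cases h : Disjoint (C.dom f) (C.dom g) ∧ Disjoint (C.cod f) (C.cod g)
  · rw [tensor_of h.1 h.2, tensor_of h.1.symm h.2.symm, C.tensor_comm]
  · rw [tensor_of_not h, tensor_of_not fun h' => h ⟨h'.1.symm, h'.2.symm⟩]

/-- Either bracketing of three arrows is defined exactly when the arrows have pairwise disjoint
domains and pairwise disjoint codomains; otherwise both are `0`. -/
theorem tensor_assoc (f g k : PX C) : tensor (tensor f g) k = tensor f (tensor g k) := by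
  rcases eq_zero_or f with rfl | ⟨f, rfl⟩
  · rfl
  rcases eq_zero_or g with rfl | ⟨g, rfl⟩
  · simp only [tensor_zero_left, tensor_zero_right]
  rcases eq_zero_or k with rfl | ⟨k, rfl⟩
  · simp only [tensor_zero_right]
  by_cases h : Disjoint (C.dom f) (C.dom g) ∧ Disjoint (C.cod f) (C.cod g)
  · rw [tensor_of h.1 h.2]
    by_cases h' : Disjoint (C.dom g) (C.dom k) ∧ Disjoint (C.cod g) (C.cod k)
    · rw [tensor_of h'.1 h'.2]
      by_cases h'' : Disjoint (C.dom f) (C.dom k) ∧ Disjoint (C.cod f) (C.cod k)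
      · have h1 : Disjoint (C.dom (C.tensor f g h.1 h.2)) (C.dom k) := by
          rw [C.dom_tensor, Finset.disjoint_union_left]; exact ⟨h''.1, h'.1⟩
        have h2 : Disjoint (C.cod (C.tensor f g h.1 h.2)) (C.cod k) := by
          rw [C.cod_tensor, Finset.disjoint_union_left]; exact ⟨h''.2, h'.2⟩
        have h3 : Disjoint (C.dom f) (C.dom (C.tensor g k h'.1 h'.2)) := by
          rw [C.dom_tensor, Finset.disjoint_union_right]; exact ⟨h.1, h''.1⟩
        have h4 : Disjoint (C.cod f) (C.cod (C.tensor g k h'.1 h'.2)) := by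
          rw [C.cod_tensor, Finset.disjoint_union_right]; exact ⟨h.2, h''.2⟩
        rw [tensor_of h1 h2, tensor_of h3 h4, C.tensor_assoc]
      · rw [tensor_of_not, tensor_of_not] <;>
        · rw [C.dom_tensor, C.cod_tensor]
          simp only [Finset.disjoint_union_left, Finset.disjoint_union_right]
          tauto
    · rw [tensor_of_not h', tensor_zero_right, tensor_of_not]
      rw [C.dom_tensor, C.cod_tensor]
      simp only [Finset.disjoint_union_left]
      tauto
  · rw [tensor_of_not h, tensor_zero_left]
    by_cases h' : Disjoint (C.dom g) (C.dom k) ∧ Disjoint (C.cod g) (C.cod k)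
    · rw [tensor_of h'.1 h'.2, tensor_of_not]
      rw [C.dom_tensor, C.cod_tensor]
      simp only [Finset.disjoint_union_right]
      tauto
    · rw [tensor_of_not h', tensor_zero_right]

theorem empty_tensor (f : PX C) : tensor (I C ∅) f = f := by
  rcases eq_zero_or f with rfl | ⟨f, rfl⟩
  · exact tensor_zero_right _
  · have h1 : Disjoint (C.dom (C.id ∅)) (C.dom f) := by
      rw [C.dom_id]; exact Finset.disjoint_empty_left _
    have h2 : Disjoint (C.cod (C.id ∅)) (C.cod f) := by
      rw [C.cod_id]; exact Finset.disjoint_empty_left _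
    rw [I, tensor_of h1 h2, C.empty_tensor]

/-- This makes `Finset` products available for families of parallel arrows, and `ac_rfl` for
rearranging wires. -/
instance : CommMonoidWithZero (PX C) where
  mul := tensor
  mul_assoc := tensor_assoc
  one := I C ∅
  one_mul := empty_tensor
  mul_one f := (tensor_comm f _).trans (empty_tensor f)
  mul_comm := tensor_comm
  zero_mul := tensor_zero_left
  mul_zero := tensor_zero_right

theorem I_empty : I C ∅ = 1 := rfl

theorem mul_of {f g : C.Arrow} (h : Disjoint (C.dom f) (C.dom g))
    (h' : Disjoint (C.cod f) (C.cod g)) : of f * of g = of (C.tensor f g h h') :=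
  tensor_of h h'

theorem mul_of_not {f g : C.Arrow}
    (h : ¬ (Disjoint (C.dom f) (C.dom g) ∧ Disjoint (C.cod f) (C.cod g))) :
    of f * of g = 0 := tensor_of_not h

theorem comp_assoc (f g k : PX C) : f ⨾ g ⨾ k = f ⨾ (g ⨾ k) := by
  rcases eq_zero_or f with rfl | ⟨f, rfl⟩
  · rfl
  rcases eq_zero_or g with rfl | ⟨g, rfl⟩
  · simp only [comp_zero, zero_comp]
  rcases eq_zero_or k with rfl | ⟨k, rfl⟩
  · simp only [comp_zero]
  by_cases h : C.cod f = C.dom g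
  · rw [comp_of h]
    by_cases h' : C.cod g = C.dom k
    · rw [comp_of h', comp_of ((C.cod_comp f g h).trans h'),
        comp_of (h.trans (C.dom_comp g k h').symm), C.comp_assoc]
    · rw [comp_of_not h', comp_zero, comp_of_not]
      rwa [C.cod_comp]
  · rw [comp_of_not h, zero_comp]
    by_cases h' : C.cod g = C.dom k
    · rw [comp_of h', comp_of_not]
      rwa [C.dom_comp]
    · rw [comp_of_not h', comp_zero]

/-- If `f` is defined then it has domain `A` and codomain `B`. -/
def Ty (f : PX C) (A B : Finset N) : Prop := ∀ g, f = of g → C.dom g = A ∧ C.cod g = B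

theorem ty_of (f : C.Arrow) : Ty (of f) (C.dom f) (C.cod f) := by
  intro g h
  rw [of_injective h]
  exact ⟨rfl, rfl⟩

theorem ty_zero (A B : Finset N) : Ty (0 : PX C) A B := fun _ h => absurd h.symm (of_ne_zero _)

theorem ty_I (A : Finset N) : Ty (I C A) A A := by
  have := ty_of (C.id A)
  rwa [C.dom_id, C.cod_id] at this

theorem ty_one : Ty (1 : PX C) ∅ ∅ := ty_I ∅

theorem ty_ren (a b : N) : Ty (ren C a b) {a} {b} := by
  have := ty_of (C.δ a b)
  rwa [C.dom_δ, C.cod_δ] at this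

theorem Ty.mul {f g : PX C} {A A' B B' : Finset N} (hf : Ty f A B) (hg : Ty g A' B') :
    Ty (f * g) (A ∪ A') (B ∪ B') := by
  rcases eq_zero_or f with rfl | ⟨f, rfl⟩
  · rw [zero_mul]; exact ty_zero _ _
  rcases eq_zero_or g with rfl | ⟨g, rfl⟩
  · rw [mul_zero]; exact ty_zero _ _
  by_cases h : Disjoint (C.dom f) (C.dom g) ∧ Disjoint (C.cod f) (C.cod g)
  · rw [mul_of h.1 h.2, ← (hf f rfl).1, ← (hf f rfl).2, ← (hg g rfl).1, ← (hg g rfl).2,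
      ← C.dom_tensor, ← C.cod_tensor]
    exact ty_of _
  · rw [mul_of_not h]; exact ty_zero _ _

theorem Ty.comp {f g : PX C} {A B B' D : Finset N} (hf : Ty f A B) (hg : Ty g B' D) :
    Ty (f ⨾ g) A D := by
  rcases eq_zero_or f with rfl | ⟨f, rfl⟩
  · exact ty_zero _ _
  rcases eq_zero_or g with rfl | ⟨g, rfl⟩
  · rw [comp_zero]; exact ty_zero _ _
  by_cases h : C.cod f = C.dom g
  · rw [comp_of h, ← (hf f rfl).1, ← (hg g rfl).2, ← C.dom_comp f g h, ← C.cod_comp f g h]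
    exact ty_of _
  · rw [comp_of_not h]; exact ty_zero _ _

theorem Ty.cast {f : PX C} {A A' B B' : Finset N} (hf : Ty f A B) (h : A = A') (h' : B = B') :
    Ty f A' B' := h ▸ h' ▸ hf

theorem Ty.id_comp {f : PX C} {A B : Finset N} (hf : Ty f A B) : I C A ⨾ f = f := by
  rcases eq_zero_or f with rfl | ⟨f, rfl⟩
  · exact comp_zero _
  obtain ⟨rfl, -⟩ := hf f rfl
  rw [I, comp_of (C.cod_id _), C.id_comp]

theorem Ty.comp_id {f : PX C} {A B : Finset N} (hf : Ty f A B) : f ⨾ I C B = f := by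
  rcases eq_zero_or f with rfl | ⟨f, rfl⟩
  · exact zero_comp _
  obtain ⟨-, rfl⟩ := hf f rfl
  rw [I, comp_of (C.dom_id _).symm, C.comp_id]

theorem comp_ne_zero {f g : PX C} {A B D : Finset N} (hf : Ty f A B) (hg : Ty g B D)
    (h : f ≠ 0) (h' : g ≠ 0) : f ⨾ g ≠ 0 := by
  obtain ⟨f, rfl⟩ := (eq_zero_or f).resolve_left h
  obtain ⟨g, rfl⟩ := (eq_zero_or g).resolve_left h'
  rw [comp_of ((hf f rfl).2.trans (hg g rfl).1.symm)]
  exact of_ne_zero _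

theorem mul_ne_zero' {f g : PX C} {A A' B B' : Finset N} (hf : Ty f A B) (hg : Ty g A' B')
    (h : f ≠ 0) (h' : g ≠ 0) (hA : Disjoint A A') (hB : Disjoint B B') : f * g ≠ 0 := by
  obtain ⟨f, rfl⟩ := (eq_zero_or f).resolve_left h
  obtain ⟨g, rfl⟩ := (eq_zero_or g).resolve_left h'
  obtain ⟨rfl, rfl⟩ := hf f rfl
  obtain ⟨rfl, rfl⟩ := hg g rfl
  rw [mul_of hA hB]
  exact of_ne_zero _

theorem disjoint_of_mul_ne_zero {f g : PX C} {A A' B B' : Finset N} (hf : Ty f A B)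
    (hg : Ty g A' B') (h : f * g ≠ 0) : Disjoint A A' ∧ Disjoint B B' := by
  obtain ⟨f, rfl⟩ := (eq_zero_or f).resolve_left (left_ne_zero_of_mul h)
  obtain ⟨g, rfl⟩ := (eq_zero_or g).resolve_left (right_ne_zero_of_mul h)
  obtain ⟨rfl, rfl⟩ := hf f rfl
  obtain ⟨rfl, rfl⟩ := hg g rfl
  by_contra h'
  exact h (mul_of_not h')

theorem mul_eq_zero_of_dom {f g : PX C} {A A' B B' : Finset N} (hf : Ty f A B)
    (hg : Ty g A' B') (h : ¬ Disjoint A A') : f * g = 0 := by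
  by_contra h'
  exact h (disjoint_of_mul_ne_zero hf hg h').1

theorem mul_eq_zero_of_cod {f g : PX C} {A A' B B' : Finset N} (hf : Ty f A B)
    (hg : Ty g A' B') (h : ¬ Disjoint B B') : f * g = 0 := by
  by_contra h'
  exact h (disjoint_of_mul_ne_zero hf hg h').2

/-- A clash between the outer interfaces makes both sides `0`, so only the inner interfaces need a
hypothesis. If `B` and `B'` met, the left side would vanish while the right side could still be
defined. -/
theorem mul_comp_mul {s t p q : PX C} {A A' B B' D D' : Finset N} (hs : Ty s A B)
    (ht : Ty t B D) (hp : Ty p A' B') (hq : Ty q B' D') (h : Disjoint B B') :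
    (s * p) ⨾ (t * q) = (s ⨾ t) * (p ⨾ q) := by
  by_cases hA : Disjoint A A'
  swap
  · rw [mul_eq_zero_of_dom hs hp hA, mul_eq_zero_of_dom (hs.comp ht) (hp.comp hq) hA, zero_comp]
  by_cases hD : Disjoint D D'
  swap
  · rw [mul_eq_zero_of_cod ht hq hD, mul_eq_zero_of_cod (hs.comp ht) (hp.comp hq) hD, comp_zero]
  rcases eq_zero_or s with rfl | ⟨s, rfl⟩
  · simp only [zero_mul, zero_comp]
  rcases eq_zero_or t with rfl | ⟨t, rfl⟩
  · simp only [zero_mul, comp_zero]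
  rcases eq_zero_or p with rfl | ⟨p, rfl⟩
  · simp only [mul_zero, zero_comp]
  rcases eq_zero_or q with rfl | ⟨q, rfl⟩
  · simp only [mul_zero, comp_zero]
  obtain ⟨rfl, rfl⟩ := hs s rfl
  obtain ⟨ht1, rfl⟩ := ht t rfl
  obtain ⟨rfl, rfl⟩ := hp p rfl
  obtain ⟨hq1, rfl⟩ := hq q rfl
  have h1 : Disjoint (C.dom t) (C.dom q) := by rwa [ht1, hq1]
  have h2 : Disjoint (C.dom (C.comp s t ht1.symm)) (C.dom (C.comp p q hq1.symm)) := by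
    rwa [C.dom_comp, C.dom_comp]
  have h3 : Disjoint (C.cod (C.comp s t ht1.symm)) (C.cod (C.comp p q hq1.symm)) := by
    rwa [C.cod_comp, C.cod_comp]
  have h4 : C.cod (C.tensor s p hA h) = C.dom (C.tensor t q h1 hD) := by
    rw [C.cod_tensor, C.dom_tensor, ht1, hq1]
  rw [comp_of ht1.symm, comp_of hq1.symm, mul_of hA h, mul_of h1 hD, mul_of h2 h3, comp_of h4,
    C.interchange]

theorem I_ne_zero (A : Finset N) : I C A ≠ 0 := of_ne_zero _

theorem ren_ne_zero (a b : N) : ren C a b ≠ 0 := of_ne_zero _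

theorem I_union {A B : Finset N} (h : Disjoint A B) : I C (A ∪ B) = I C A * I C B := by
  have h1 : Disjoint (C.dom (C.id A)) (C.dom (C.id B)) := by rwa [C.dom_id, C.dom_id]
  have h2 : Disjoint (C.cod (C.id A)) (C.cod (C.id B)) := by rwa [C.cod_id, C.cod_id]
  rw [I, I, I, mul_of h1 h2, C.tensor_id]

theorem I_insert {a : N} {A : Finset N} (h : a ∉ A) : I C (insert a A) = I C {a} * I C A := by
  rw [Finset.insert_eq, I_union (Finset.disjoint_singleton_left.2 h)]

theorem I_eq_erase {a : N} {A : Finset N} (h : a ∈ A) :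
    I C A = I C {a} * I C (A.erase a) := by
  rw [← I_insert (Finset.notMem_erase a A), Finset.insert_erase h]

theorem ren_self (a : N) : ren C a a = I C {a} := by rw [ren, C.δ_self, I]

theorem ren_comp_ren (a b c : N) : ren C a b ⨾ ren C b c = ren C a c := by
  rw [ren, ren, comp_of ((C.cod_δ a b).trans (C.dom_δ b c).symm), C.δ_comp_δ, ren]

theorem id_mul_comp {f g : PX C} {A B D W : Finset N} (hf : Ty f A B) (hg : Ty g B D)
    (h : Disjoint W B) : (I C W * f) ⨾ (I C W * g) = I C W * (f ⨾ g) := by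
  rw [mul_comp_mul (ty_I W) (ty_I W) hf hg h, (ty_I W).id_comp]

theorem comp_mul_id {f g : PX C} {A B D W : Finset N} (hf : Ty f A B) (hg : Ty g B D)
    (h : Disjoint B W) : (f * I C W) ⨾ (g * I C W) = (f ⨾ g) * I C W := by
  rw [mul_comp_mul hf hg (ty_I W) (ty_I W) h, (ty_I W).id_comp]

/-- `f` and `g` act on different wires. -/
theorem mul_eq_comp {f g : PX C} {A B A' B' : Finset N} (hf : Ty f A B) (hg : Ty g A' B')
    (h : Disjoint B A') : f * g = (f * I C A') ⨾ (I C B * g) := by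
  rw [mul_comp_mul hf (ty_I B) (ty_I A') hg h, hf.comp_id, hg.id_comp]

theorem mul_eq_comp' {f g : PX C} {A B A' B' : Finset N} (hf : Ty f A B) (hg : Ty g A' B')
    (h : Disjoint A B') : f * g = (I C A * g) ⨾ (f * I C B') := by
  rw [mul_comp_mul (ty_I A) hf hg (ty_I B') h, hf.id_comp, hg.comp_id]

theorem ty_prod {ι : Type*} [DecidableEq ι] (s : Finset ι) (f : ι → PX C) (A B : ι → Finset N)
    (h : ∀ i ∈ s, Ty (f i) (A i) (B i)) : Ty (∏ i ∈ s, f i) (s.biUnion A) (s.biUnion B) := by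
  induction s using Finset.induction_on with
  | empty => exact ty_one
  | insert i s hi ih =>
    rw [Finset.prod_insert hi, Finset.biUnion_insert, Finset.biUnion_insert]
    exact (h i (Finset.mem_insert_self _ _)).mul
      (ih fun j hj => h j (Finset.mem_insert_of_mem hj))

end PX

end PartialArrows

/-! ### Evaluation of raw terms, and the equations of the calculi for total operations. -/

section CalculusArrows

open PX

namespace Theory

variable {N : Type u} [DecidableEq N] {T : Theory N}

open Classical in
/-- The arrow presented by a raw term, `0` if the term is not well-typed. -/
noncomputable def ev (t : Term N T.Gen) : PX T.category :=
  if h : T.WT t then PX.of (C := T.category) (PArrow.mk t h) else 0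

theorem ev_of_wt {t : Term N T.Gen} (h : T.WT t) :
    ev t = PX.of (C := T.category) (PArrow.mk t h) := dif_pos h

theorem ev_of_not_wt {t : Term N T.Gen} (h : ¬ T.WT t) : ev t = 0 := dif_neg h

theorem ev_idt (A : Finset N) : ev (T := T) (.idt A) = I _ A :=
  ev_of_wt (t := .idt A) (T.wt_idt A)

theorem ev_ren (a b : N) : ev (T := T) (.ren a b) = ren _ a b :=
  ev_of_wt (t := .ren a b) (T.wt_ren a b)

/-- Ill-typed terms go to `0`, as do undefined compositions, so evaluation is a homomorphism without
typing hypotheses. -/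
theorem ev_comp (t s : Term N T.Gen) : ev (.comp t s) = ev t ⨾ ev s := by
  by_cases ht : T.WT t
  swap
  · rw [ev_of_not_wt ht, ev_of_not_wt (t := .comp t s) fun h => ht h.1, zero_comp]
  by_cases hs : T.WT s
  swap
  · rw [ev_of_not_wt hs, ev_of_not_wt (t := .comp t s) fun h => hs h.2.1, comp_zero]
  by_cases h : T.tcod t = T.tdom s
  · rw [ev_of_wt ht, ev_of_wt hs, ev_of_wt (t := .comp t s) ⟨ht, hs, h⟩]
    exact (congrArg _ (PArrow.comp_mk t s ht hs h).symm).trans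
      (comp_of (C := T.category) (f := PArrow.mk t ht) (g := PArrow.mk s hs) h).symm
  · rw [ev_of_wt ht, ev_of_wt hs, ev_of_not_wt (t := .comp t s) fun h' => h h'.2.2]
    exact (comp_of_not (C := T.category) (f := PArrow.mk t ht) (g := PArrow.mk s hs) h).symm

theorem ev_tensor (t s : Term N T.Gen) : ev (.tensor t s) = ev t * ev s := by
  by_cases ht : T.WT t
  swap
  · rw [ev_of_not_wt ht, ev_of_not_wt (t := .tensor t s) fun h => ht h.1, zero_mul]
  by_cases hs : T.WT s
  swap
  · rw [ev_of_not_wt hs, ev_of_not_wt (t := .tensor t s) fun h => hs h.2.1, mul_zero]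
  by_cases h : Disjoint (T.tdom t) (T.tdom s) ∧ Disjoint (T.tcod t) (T.tcod s)
  · rw [ev_of_wt ht, ev_of_wt hs, ev_of_wt (t := .tensor t s) ⟨ht, hs, h.1, h.2⟩]
    exact (congrArg _ (PArrow.tensor_mk t s ht hs h.1 h.2).symm).trans
      (mul_of (C := T.category) (f := PArrow.mk t ht) (g := PArrow.mk s hs) h.1 h.2).symm
  · rw [ev_of_wt ht, ev_of_wt hs, ev_of_not_wt (t := .tensor t s) fun h' => h h'.2.2]
    exact (mul_of_not (C := T.category) (f := PArrow.mk t ht) (g := PArrow.mk s hs) h).symm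

theorem ev_eq_of_eqv {t s : Term N T.Gen} (h : Eqv T t s) : ev t = ev s := by
  rw [ev_of_wt h.typed.1, ev_of_wt h.typed.2.1]
  exact congrArg _ (PArrow.mk_eq h)

end Theory

/-- The arrows presented by the calculus over `K`, and `0`. -/
abbrev CX (N : Type u) [DecidableEq N] (K : Set Kind) : Type u := PX (calculus N K).category

namespace CX

variable {N : Type u} [DecidableEq N] {K : Set Kind}

/-- The arrow presented by a raw term, `0` if the term is not well-typed. -/
noncomputable def ev (t : Term N (CGen N K)) : CX N K := Theory.ev (T := calculus N K) t

theorem ev_idt (A : Finset N) : ev (K := K) (.idt A) = I _ A := Theory.ev_idt A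

theorem ev_ren (a b : N) : ev (K := K) (.ren a b) = ren _ a b := Theory.ev_ren a b

theorem ev_comp (t s : Term N (CGen N K)) : ev (.comp t s) = ev t ⨾ ev s :=
  Theory.ev_comp (T := calculus N K) t s

theorem ev_tensor (t s : Term N (CGen N K)) : ev (.tensor t s) = ev t * ev s :=
  Theory.ev_tensor (T := calculus N K) t s

theorem ev_eq_of_cEq {t s : Term N (CGen N K)} (h : CEq K t s) : ev t = ev s :=
  Theory.ev_eq_of_eqv (.basic (.eqn (T := calculus N K) t s h) h.typed.1 h.typed.2.1)

/-- The arrow presented by a generator. -/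
noncomputable def gen (γ : CGen N K) : CX N K :=
  PX.of (C := (calculus N K).category) ((calculus N K).genArrow γ)

theorem ev_gen (γ : CGen N K) : ev (.gen γ) = gen γ :=
  Theory.ev_of_wt (T := calculus N K) (t := .gen γ) ((calculus N K).wt_gen γ)

theorem gen_ne_zero (γ : CGen N K) : gen γ ≠ 0 := of_ne_zero _

theorem ty_gen (γ : CGen N K) : Ty (gen γ) γ.dom γ.cod :=
  ty_of (C := (calculus N K).category) _

section Generators

variable (K)

-- Generators are made total as well: they are `0` if their family is absent or if two names that
-- must differ coincide. Many equations then hold for all `K` and all outer names.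
open Classical in
noncomputable def eta (a : N) : CX N K := if h : Kind.unit ∈ K then gen (.eta h a) else 0

open Classical in
noncomputable def mu (a b c : N) : CX N K :=
  if h : Kind.mult ∈ K ∧ a ≠ b then gen (.mu h.1 a b c h.2) else 0

open Classical in
noncomputable def etaHat (a : N) : CX N K :=
  if h : Kind.counit ∈ K then gen (.etaHat h a) else 0

open Classical in
noncomputable def muHat (a b c : N) : CX N K :=
  if h : Kind.comult ∈ K ∧ b ≠ c then gen (.muHat h.1 a b c h.2) else 0

theorem ty_eta (a : N) : Ty (eta K a) ∅ {a} := by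
  unfold eta; split_ifs
  · exact ty_gen _
  · exact ty_zero _ _

theorem ty_mu (a b c : N) : Ty (mu K a b c) ({a} ∪ {b}) {c} := by
  unfold mu; split_ifs
  · exact ty_gen _
  · exact ty_zero _ _

theorem ty_etaHat (a : N) : Ty (etaHat K a) {a} ∅ := by
  unfold etaHat; split_ifs
  · exact ty_gen _
  · exact ty_zero _ _

theorem ty_muHat (a b c : N) : Ty (muHat K a b c) {a} ({b} ∪ {c}) := by
  unfold muHat; split_ifs
  · exact ty_gen _
  · exact ty_zero _ _

end Generators

theorem eta_def (h : Kind.unit ∈ K) (a : N) : eta K a = ev (CTerm.eta h a) :=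
  (dif_pos h).trans (ev_gen _).symm

theorem mu_def (h : Kind.mult ∈ K) {a b : N} (hab : a ≠ b) (c : N) :
    mu K a b c = ev (CTerm.mu h a b c hab) :=
  (dif_pos (⟨h, hab⟩ : _ ∧ _)).trans (ev_gen _).symm

theorem etaHat_def (h : Kind.counit ∈ K) (a : N) : etaHat K a = ev (CTerm.etaHat h a) :=
  (dif_pos h).trans (ev_gen _).symm

theorem muHat_def (h : Kind.comult ∈ K) (a : N) {b c : N} (hbc : b ≠ c) :
    muHat K a b c = ev (CTerm.muHat h a b c hbc) :=
  (dif_pos (⟨h, hbc⟩ : _ ∧ _)).trans (ev_gen _).symm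

theorem eta_zero (h : Kind.unit ∉ K) (a : N) : eta K a = 0 := dif_neg h

theorem mu_zero (h : Kind.mult ∉ K) (a b c : N) : mu K a b c = 0 := dif_neg fun h' => h h'.1

theorem mu_self (a c : N) : mu K a a c = 0 := dif_neg fun h' => h'.2 rfl

theorem etaHat_zero (h : Kind.counit ∉ K) (a : N) : etaHat K a = 0 := dif_neg h

theorem muHat_zero (h : Kind.comult ∉ K) (a b c : N) : muHat K a b c = 0 :=
  dif_neg fun h' => h h'.1

theorem muHat_self (a b : N) : muHat K a b b = 0 := dif_neg fun h' => h'.2 rfl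

theorem eta_ren (a b : N) : eta K a ⨾ ren _ a b = eta K b := by
  by_cases h : Kind.unit ∈ K
  · rw [eta_def h, eta_def h, ← ev_ren, ← ev_comp]
    exact ev_eq_of_cEq (.eta_ren h a b)
  · rw [eta_zero h, eta_zero h, zero_comp]

theorem mu_ren (a b c d : N) : mu K a b c ⨾ ren _ c d = mu K a b d := by
  by_cases h : Kind.mult ∈ K
  · by_cases hab : a = b
    · subst hab; rw [mu_self, mu_self, zero_comp]
    rw [mu_def h hab, mu_def h hab, ← ev_ren, ← ev_comp]
    exact ev_eq_of_cEq (.mu_ren h a b c d hab)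
  · rw [mu_zero h, mu_zero h, zero_comp]

/-- If the outer names `a` and `b` coincide, both sides are `0`. The inner name `a'` must be kept
apart from `b`, since a clash there would affect the left side only. -/
theorem ren_mu {a' b : N} (hb : a' ≠ b) (a c : N) :
    (ren _ a a' * I _ {b}) ⨾ mu K a' b c = mu K a b c := by
  by_cases h : Kind.mult ∈ K
  · by_cases hab : a = b
    · subst hab
      rw [mu_self, mul_eq_zero_of_dom (ty_ren _ _) (ty_I _) (by simp), zero_comp]
    rw [mu_def h hab, mu_def h hb, ← ev_ren, ← ev_idt, ← ev_tensor, ← ev_comp]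
    exact ev_eq_of_cEq (.ren_mu h a a' b c hab hb)
  · rw [mu_zero h, mu_zero h, comp_zero]

theorem ren_etaHat (a b : N) : ren _ a b ⨾ etaHat K b = etaHat K a := by
  by_cases h : Kind.counit ∈ K
  · rw [etaHat_def h, etaHat_def h, ← ev_ren, ← ev_comp]
    exact ev_eq_of_cEq (.ren_etaHat h a b)
  · rw [etaHat_zero h, etaHat_zero h, comp_zero]

theorem ren_muHat (d a b c : N) : ren _ d a ⨾ muHat K a b c = muHat K d b c := by
  by_cases h : Kind.comult ∈ K
  · by_cases hbc : b = c
    · subst hbc; rw [muHat_self, muHat_self, comp_zero]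
    rw [muHat_def h _ hbc, muHat_def h _ hbc, ← ev_ren, ← ev_comp]
    exact ev_eq_of_cEq (.ren_muHat h a d b c hbc)
  · rw [muHat_zero h, muHat_zero h, comp_zero]

theorem muHat_ren {b c : N} (hbc : b ≠ c) (a b' : N) :
    muHat K a b c ⨾ (ren _ b b' * I _ {c}) = muHat K a b' c := by
  by_cases h : Kind.comult ∈ K
  · by_cases hbc' : b' = c
    · subst hbc'
      rw [muHat_self, mul_eq_zero_of_cod (ty_ren _ _) (ty_I _) (by simp), comp_zero]
    rw [muHat_def h _ hbc, muHat_def h _ hbc', ← ev_ren, ← ev_idt, ← ev_tensor, ← ev_comp]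
    exact ev_eq_of_cEq (.muHat_ren h a b b' c hbc hbc')
  · rw [muHat_zero h, muHat_zero h, zero_comp]

theorem mu_comm (a b c : N) : mu K a b c = mu K b a c := by
  by_cases h : Kind.mult ∈ K
  · by_cases hab : a = b
    · rw [hab]
    rw [mu_def h hab, mu_def h (Ne.symm hab)]
    exact ev_eq_of_cEq (.mu_comm h a b c hab (Ne.symm hab))
  · rw [mu_zero h, mu_zero h]

theorem muHat_comm (a b c : N) : muHat K a b c = muHat K a c b := by
  by_cases h : Kind.comult ∈ K
  · by_cases hbc : b = c
    · rw [hbc]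
    rw [muHat_def h _ hbc, muHat_def h _ (Ne.symm hbc)]
    exact ev_eq_of_cEq (.muHat_comm h a b c hbc (Ne.symm hbc))
  · rw [muHat_zero h, muHat_zero h]

/-- Only the inner names `x` and `y` carry hypotheses; any coincidence among the inputs `a`, `b`,
`c` makes both sides `0`. -/
theorem mu_assoc {a c x y : N} (hx : x ≠ c) (hy : a ≠ y) (b d : N) :
    (mu K a b x * I _ {c}) ⨾ mu K x c d = (I _ {a} * mu K b c y) ⨾ mu K a y d := by
  by_cases h : Kind.mult ∈ K
  swap
  · simp only [mu_zero h, comp_zero]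
  by_cases hab : a = b
  · subst hab
    rw [mu_self, zero_mul, zero_comp, mul_eq_zero_of_dom (ty_I _) (ty_mu _ _ _ _) (by simp),
      zero_comp]
  by_cases hbc : b = c
  · subst hbc
    rw [mu_self, mul_zero, zero_comp, mul_eq_zero_of_dom (ty_mu _ _ _ _) (ty_I _) (by simp),
      zero_comp]
  by_cases hac : a = c
  · subst hac
    rw [mul_eq_zero_of_dom (ty_mu _ _ _ _) (ty_I _) (by simp), zero_comp,
      mul_eq_zero_of_dom (ty_I _) (ty_mu _ _ _ _) (by simp), zero_comp]
  rw [mu_def h hab, mu_def h hbc, mu_def h hx, mu_def h hy, ← ev_idt, ← ev_idt, ← ev_tensor,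
    ← ev_tensor, ← ev_comp, ← ev_comp]
  exact ev_eq_of_cEq (.mu_assoc h a b c x y d hab hbc hx hy hac)

theorem muHat_assoc {a c x y : N} (hx : x ≠ c) (hy : a ≠ y) (b d : N) :
    muHat K d x c ⨾ (muHat K x a b * I _ {c}) = muHat K d a y ⨾ (I _ {a} * muHat K y b c) := by
  by_cases h : Kind.comult ∈ K
  swap
  · simp only [muHat_zero h, zero_comp]
  by_cases hab : a = b
  · subst hab
    rw [muHat_self, zero_mul, comp_zero, mul_eq_zero_of_cod (ty_I _) (ty_muHat _ _ _ _) (by simp),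
      comp_zero]
  by_cases hbc : b = c
  · subst hbc
    rw [muHat_self, mul_zero, comp_zero, mul_eq_zero_of_cod (ty_muHat _ _ _ _) (ty_I _) (by simp),
      comp_zero]
  by_cases hac : a = c
  · subst hac
    rw [mul_eq_zero_of_cod (ty_muHat _ _ _ _) (ty_I _) (by simp), comp_zero,
      mul_eq_zero_of_cod (ty_I _) (ty_muHat _ _ _ _) (by simp), comp_zero]
  rw [muHat_def h _ hab, muHat_def h _ hbc, muHat_def h _ hx, muHat_def h _ hy, ← ev_idt,
    ← ev_idt, ← ev_tensor, ← ev_tensor, ← ev_comp, ← ev_comp]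
  exact ev_eq_of_cEq (.muHat_assoc h d a b c x y hab hbc hx hy hac)

theorem eta_mu (h : Kind.unit ∈ K) (h' : Kind.mult ∈ K) {x a : N} (hx : x ≠ a) (b : N) :
    (eta K x * I _ {a}) ⨾ mu K x a b = ren _ a b := by
  rw [eta_def h, mu_def h' hx, ← ev_idt, ← ev_tensor, ← ev_comp, ← ev_ren]
  exact ev_eq_of_cEq (.unit h h' a x b hx)

theorem muHat_etaHat (h : Kind.counit ∈ K) (h' : Kind.comult ∈ K) {x b : N} (hx : x ≠ b) (a : N) :
    muHat K a x b ⨾ (etaHat K x * I _ {b}) = ren _ a b := by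
  rw [etaHat_def h, muHat_def h' _ hx, ← ev_idt, ← ev_tensor, ← ev_comp, ← ev_ren]
  exact ev_eq_of_cEq (.counit h h' a x b hx)

theorem eta_etaHat (h : Kind.unit ∈ K) (h' : Kind.counit ∈ K) (x : N) :
    eta K x ⨾ etaHat K x = 1 := by
  rw [eta_def h, etaHat_def h', ← I_empty, ← ev_idt, ← ev_comp]
  exact ev_eq_of_cEq (.eta_etaHat h h' x)

theorem mu_etaHat (h : Kind.mult ∈ K) {a b : N} (hab : a ≠ b) (x : N) :
    mu K a b x ⨾ etaHat K x = etaHat K a * etaHat K b := by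
  by_cases h' : Kind.counit ∈ K
  · rw [mu_def h hab, etaHat_def h', etaHat_def h', etaHat_def h', ← ev_tensor, ← ev_comp]
    exact ev_eq_of_cEq (.mu_etaHat h h' a b x hab)
  · simp only [etaHat_zero h', comp_zero, zero_mul]

theorem eta_muHat (h : Kind.comult ∈ K) {a b : N} (hab : a ≠ b) (x : N) :
    eta K x ⨾ muHat K x a b = eta K a * eta K b := by
  by_cases h' : Kind.unit ∈ K
  · rw [muHat_def h _ hab, eta_def h', eta_def h', eta_def h', ← ev_tensor, ← ev_comp]
    exact ev_eq_of_cEq (.eta_muHat h' h x a b hab)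
  · simp only [eta_zero h', zero_comp, zero_mul]

theorem mu_muHat (h : Kind.mult ∈ K) (h' : Kind.comult ∈ K) {a b c d p q r s : N} (hab : a ≠ b)
    (hcd : c ≠ d) (hpq : p ≠ q) (hrs : r ≠ s) (hpr : p ≠ r) (hqs : q ≠ s) (hps : p ≠ s)
    (hqr : q ≠ r) (x : N) :
    mu K a b x ⨾ muHat K x c d =
      (muHat K a p q * muHat K b r s) ⨾ (mu K p r c * mu K q s d) := by
  rw [mu_def h hab, muHat_def h' _ hcd, muHat_def h' _ hpq, muHat_def h' _ hrs, mu_def h hpr,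
    mu_def h hqs, ← ev_tensor, ← ev_tensor, ← ev_comp, ← ev_comp]
  exact ev_eq_of_cEq (.mu_muHat h h' a b x c d p q r s hab hcd hpq hrs hpr hqs hps hqr)

theorem muHat_mu (h : Kind.mult ∈ K) (h' : Kind.comult ∈ K) {x y : N} (hxy : x ≠ y) (a b : N) :
    muHat K a x y ⨾ mu K x y b = ren _ a b := by
  rw [mu_def h hxy, muHat_def h' _ hxy, ← ev_comp, ← ev_ren]
  exact ev_eq_of_cEq (.muHat_mu h h' a x y b hxy)

theorem ren_mu_right {a b' : N} (hb : a ≠ b') (b c : N) :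
    (I _ {a} * ren _ b b') ⨾ mu K a b' c = mu K a b c := by
  rw [mul_comm, mu_comm a b', ren_mu (Ne.symm hb), mu_comm]

theorem muHat_ren_right {b c : N} (hbc : b ≠ c) (a c' : N) :
    muHat K a b c ⨾ (I _ {b} * ren _ c c') = muHat K a b c' := by
  rw [mul_comm, muHat_comm, muHat_ren (Ne.symm hbc), muHat_comm]

end CX

end CalculusArrows

open scoped Pointwise

/-! ### Cutting arrows into layers, with fresh names for bystanding wires. -/

section Layers

open PX

/-- Countability embeds all names into `ℕ`, and `ℕ` embeds into the infinite complement of `V`. -/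
theorem exists_fresh_renaming {N : Type u} [Countable N] [Infinite N] (V : Finset N) :
    ∃ σ : N → N, Function.Injective σ ∧ ∀ a, σ a ∉ V := by
  obtain ⟨f, hf⟩ := exists_injective_nat N
  have hV : ((V : Set N)ᶜ).Infinite := V.finite_toSet.infinite_compl
  refine ⟨fun a => hV.natEmbedding _ (f a), fun a b h => hf ?_, fun a => ?_⟩
  · exact (hV.natEmbedding _).injective (Subtype.ext h)
  · exact (hV.natEmbedding _ (f a)).2

variable {N : Type u} [DecidableEq N]

namespace PX

variable {C : NominalCategory N}

/-- The parallel composition of the renamings of `σ d` to `τ d` for `d ∈ D`. -/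
def rens (C : NominalCategory N) (σ τ : N → N) (D : Finset N) : PX C :=
  ∏ d ∈ D, ren C (σ d) (τ d)

theorem ty_rens (σ τ : N → N) (D : Finset N) : Ty (rens C σ τ D) (D.image σ) (D.image τ) := by
  rw [← Finset.biUnion_singleton, ← Finset.biUnion_singleton]
  exact ty_prod D _ _ _ fun d _ => ty_ren _ _

theorem rens_insert (σ τ : N → N) {d : N} {D : Finset N} (h : d ∉ D) :
    rens C σ τ (insert d D) = ren C (σ d) (τ d) * rens C σ τ D := Finset.prod_insert h

theorem rens_self (σ : N → N) (hσ : Function.Injective σ) (D : Finset N) :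
    rens C σ σ D = I C (D.image σ) := by
  induction D using Finset.induction_on with
  | empty => rfl
  | insert d D hd ih =>
    rw [rens_insert σ σ hd, ih, Finset.image_insert, I_insert, ren_self]
    rwa [hσ.mem_finset_image]

/-- Injectivity of `τ` keeps the intermediate wires distinct, as interchange demands. -/
theorem rens_comp_rens (σ τ υ : N → N) (hτ : Function.Injective τ) (D : Finset N) :
    rens C σ τ D ⨾ rens C τ υ D = rens C σ υ D := by
  induction D using Finset.induction_on with
  | empty => exact ty_one.id_comp
  | insert d D hd ih =>
    rw [rens_insert σ τ hd, rens_insert τ υ hd, rens_insert σ υ hd,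
      mul_comp_mul (ty_ren _ _) (ty_ren _ _) (ty_rens _ _ _) (ty_rens _ _ _), ih, ren_comp_ren]
    rwa [Finset.disjoint_singleton_left, hτ.mem_finset_image]

end PX

namespace Theory

variable {T : Theory N}

/-- Arrows built from identities, renamings and generators. -/
inductive Built : Finset N → Finset N → PX T.category → Prop
  | id (A) : Built A A (I _ A)
  | ren (a b) : Built {a} {b} (PX.ren _ a b)
  | gen (γ : T.Gen) : Built (T.dom γ) (T.cod γ) (PX.of (T.genArrow γ))
  | mul {A A' B B' f g} : Built A B f → Built A' B' g → Disjoint A A' → Disjoint B B' →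
      Built (A ∪ A') (B ∪ B') (f * g)
  | comp {A B D f g} : Built A B f → Built B D g → Built A D (f ⨾ g)

theorem Built.ty {A B : Finset N} {f : PX T.category} (h : Built A B f) : Ty f A B := by
  induction h with
  | id A => exact ty_I A
  | ren a b => exact ty_ren a b
  | gen γ => exact ty_of _
  | mul _ _ _ _ ih ih' => exact ih.mul ih'
  | comp _ _ ih ih' => exact ih.comp ih'

/-- Composition with `t`, in parallel with identities, preserves the property `Φ`. -/
def Step (Φ : Finset N → PX T.category → Prop) (A B : Finset N) (t : PX T.category) : Prop :=
  ∀ D f, Disjoint D A → Disjoint D B → Φ (D ∪ A) f → Φ (D ∪ B) (f ⨾ (I _ D * t))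

namespace Step

variable {Φ : Finset N → PX T.category → Prop}

theorem id (hΦ : ∀ B f, Φ B f → ∃ A, Ty f A B) (A : Finset N) : Step Φ A A (I _ A) := by
  intro D f h _ hf
  obtain ⟨A', hA'⟩ := hΦ _ _ hf
  rwa [← I_union h, hA'.comp_id]

theorem whisker {A B E : Finset N} {t : PX T.category} (ht : Step Φ A B t)
    (hA : Disjoint E A) (hB : Disjoint E B) : Step Φ (E ∪ A) (E ∪ B) (I _ E * t) := by
  intro D f h h' hf
  rw [Finset.disjoint_union_right] at h h'
  rw [← mul_assoc, ← I_union h.1, ← Finset.union_assoc]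
  rw [← Finset.union_assoc] at hf
  exact ht _ _ (Finset.disjoint_union_left.2 ⟨h.2, hA⟩) (Finset.disjoint_union_left.2 ⟨h'.2, hB⟩) hf

/-- The easy case of composition: the bystanders `D` also avoid the intermediate names `B`, so the
two steps can follow each other directly. -/
theorem comp_of_disjoint {A B E D : Finset N} {t s : PX T.category} (ht : Step Φ A B t)
    (hs : Step Φ B E s) (ht' : Ty t A B) (hs' : Ty s B E) {f : PX T.category} (hA : Disjoint D A)
    (hB : Disjoint D B) (hE : Disjoint D E) (hf : Φ (D ∪ A) f) :
    Φ (D ∪ E) (f ⨾ (I _ D * (t ⨾ s))) := by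
  rw [← id_mul_comp ht' hs' hB, ← comp_assoc]
  exact hs _ _ hB hE (ht _ _ hA hB hf)

/-- The wires are renamed one after the other. Since the two images are disjoint, a new name never
meets the old name of a wire that is still waiting. -/
theorem rens (hΦ : ∀ B f, Φ B f → ∃ A, Ty f A B) (hr : ∀ a b, Step Φ {a} {b} (PX.ren _ a b))
    {σ τ : N → N} (hσ : Function.Injective σ) (hτ : Function.Injective τ) (D : Finset N)
    (h : Disjoint (D.image σ) (D.image τ)) :
    Step Φ (D.image σ) (D.image τ) (PX.rens _ σ τ D) := by
  induction D using Finset.induction_on with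
  | empty => exact id hΦ ∅
  | insert d D hd ih =>
    have h1 := h
    rw [Finset.image_insert, Finset.image_insert, Finset.disjoint_insert_left,
      Finset.disjoint_insert_right] at h1
    have h2 : σ d ∉ D.image τ := fun h' => h1.1 (Finset.mem_insert_of_mem h')
    have h3 : σ d ∉ D.image σ := by rwa [hσ.mem_finset_image]
    have h4 : τ d ∉ D.image τ := by rwa [hτ.mem_finset_image]
    rw [rens_insert _ _ hd, mul_eq_comp' (ty_ren _ _) (ty_rens _ _ _)
      (Finset.disjoint_singleton_left.2 h2), Finset.image_insert, Finset.image_insert]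
    intro E f hE hE' hf
    simp only [Finset.disjoint_insert_right] at hE hE'
    have s1 := (ih h1.2.2).whisker (Finset.disjoint_singleton_left.2 h3)
      (Finset.disjoint_singleton_left.2 h2)
    have s2 := (hr (σ d) (τ d)).whisker (E := D.image τ) (Finset.disjoint_singleton_right.2 h2)
      (Finset.disjoint_singleton_right.2 h4)
    rw [mul_comm (PX.ren _ _ _), Finset.insert_eq, Finset.union_comm {τ d}]
    rw [Finset.union_comm (D.image τ) {σ d}] at s2
    refine comp_of_disjoint s1 s2 ((ty_I _).mul (ty_rens _ _ _))
      (((ty_I _).mul (ty_ren _ _)).cast (Finset.union_comm _ _) rfl) ?_ ?_ ?_ hf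
    · simpa [Finset.disjoint_union_right] using hE
    · simpa [Finset.disjoint_union_right] using ⟨hE.1, hE'.2⟩
    · simpa [Finset.disjoint_union_right] using hE'

variable [Countable N] [Infinite N]

/-- The bystanders `D` avoid `A` and `E` but may meet the intermediate names `B`. They are moved to
fresh names, `t` and `s` are applied, and they are moved back. -/
theorem comp (hΦ : ∀ B f, Φ B f → ∃ A, Ty f A B) (hr : ∀ a b, Step Φ {a} {b} (PX.ren _ a b))
    {A B E : Finset N} {t s : PX T.category} (ht : Step Φ A B t)
    (hs : Step Φ B E s) (ht' : Ty t A B) (hs' : Ty s B E) : Step Φ A E (t ⨾ s) := by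
  intro D f hA hE hf
  obtain ⟨σ, hσ, h⟩ := exists_fresh_renaming (D ∪ A ∪ B ∪ E)
  have h' : Disjoint (D.image σ) (D ∪ A ∪ B ∪ E) := by
    rw [Finset.disjoint_left]
    intro x hx
    obtain ⟨d, -, rfl⟩ := Finset.mem_image.1 hx
    exact h d
  simp only [Finset.disjoint_union_right] at h'
  obtain ⟨⟨⟨hD', hA'⟩, hB'⟩, hE'⟩ := h'
  have i := Function.injective_id (α := N)
  have r1 := (rens hΦ hr i hσ D (by rw [Finset.image_id]; exact hD'.symm))
  have r2 := (rens hΦ hr hσ i D (by rw [Finset.image_id]; exact hD'))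
  have ty1 := ty_rens (C := T.category) _root_.id σ D
  have ty2 := ty_rens (C := T.category) σ _root_.id D
  rw [Finset.image_id] at r1 r2 ty1 ty2
  have s1 : Φ (A ∪ D.image σ) _ := r1 A f hA.symm hA'.symm (by rwa [Finset.union_comm])
  rw [Finset.union_comm] at s1
  have s2 : Φ _ _ := comp_of_disjoint ht hs ht' hs' hA' hB' hE' s1
  rw [Finset.union_comm] at s2
  have s3 := r2 E _ hE'.symm hE.symm s2
  rw [Finset.union_comm] at s3
  -- By interchange the renamings of `D` there and back become adjacent and cancel, which leaves the
  -- identity on `D`.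
  convert s3 using 1
  rw [comp_assoc, comp_assoc]
  congr 1
  rw [mul_comm _ (PX.rens _ _ _ _), mul_comm _ (PX.rens _ _ _ _),
    mul_comp_mul (ty_I _) ty2 (ht'.comp hs') (ty_I _) hE',
    ty2.id_comp, (ht'.comp hs').comp_id,
    mul_comp_mul ty1 ty2 (ty_I _) (ht'.comp hs') hA', (ht'.comp hs').id_comp,
    rens_comp_rens _ _ _ hσ, rens_self _ i, Finset.image_id]

/-- Running `t` first would put its outputs `B` beside the inputs `A'`, which they may meet. So `A'`
is parked on fresh names while `t` runs. -/
theorem mul (hΦ : ∀ B f, Φ B f → ∃ A, Ty f A B) (hr : ∀ a b, Step Φ {a} {b} (PX.ren _ a b))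
    {A B A' B' : Finset N} {t s : PX T.category} (ht : Step Φ A B t)
    (hs : Step Φ A' B' s) (ht' : Ty t A B) (hs' : Ty s A' B') (hA : Disjoint A A')
    (hB : Disjoint B B') : Step Φ (A ∪ A') (B ∪ B') (t * s) := by
  obtain ⟨σ, hσ, h⟩ := exists_fresh_renaming (A ∪ A' ∪ B)
  have h' : Disjoint (A'.image σ) (A ∪ A' ∪ B) := by
    rw [Finset.disjoint_left]
    intro x hx
    obtain ⟨d, -, rfl⟩ := Finset.mem_image.1 hx
    exact h d
  simp only [Finset.disjoint_union_right] at h'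
  obtain ⟨⟨h1, h2⟩, h3⟩ := h'
  have i := Function.injective_id (α := N)
  have r1 := (rens hΦ hr i hσ A' (by rw [Finset.image_id]; exact h2.symm))
  have r2 := (rens hΦ hr hσ i A' (by rw [Finset.image_id]; exact h2))
  have ty1 := ty_rens (C := T.category) _root_.id σ A'
  have ty2 := ty_rens (C := T.category) σ _root_.id A'
  rw [Finset.image_id] at r1 r2 ty1 ty2
  have s1 := r1.whisker hA h1.symm
  have s2 := ht.whisker h1 h3
  -- Moving back to `A'` beside `B` is not possible either; hence the renaming and `s` are composed
  -- into a single step before `B` is added as a bystander.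
  have s3 := (comp hΦ hr r2 hs ty2 hs').whisker h3.symm hB
  rw [Finset.union_comm, Finset.union_comm _ B] at s2
  have ty4 := ((ty_I (C := T.category) (A'.image σ)).mul ht').cast
    (Finset.union_comm _ _) (Finset.union_comm _ _)
  have s4 := comp hΦ hr s1 s2 ((ty_I _).mul ty1) ty4
  have s5 := comp hΦ hr s4 s3 (((ty_I _).mul ty1).comp ty4) ((ty_I _).mul (ty2.comp hs'))
  convert s5 using 1
  rw [mul_comm _ t, mul_comp_mul (ty_I _) ht' ty1 (ty_I _) h1.symm, ht'.id_comp, ty1.comp_id,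
    mul_comp_mul ht' (ty_I _) ty1 (ty2.comp hs') h3.symm, ht'.comp_id, ← comp_assoc,
    rens_comp_rens _ _ _ hσ, rens_self _ i, Finset.image_id, hs'.id_comp]

/-- A property that is preserved by renamings and generators is preserved by all arrows. -/
theorem of_built (hΦ : ∀ B f, Φ B f → ∃ A, Ty f A B)
    (hr : ∀ a b, Step Φ {a} {b} (PX.ren _ a b))
    (hg : ∀ γ : T.Gen, Step Φ (T.dom γ) (T.cod γ) (PX.of (T.genArrow γ)))
    {A B : Finset N} {t : PX T.category} (h : Built A B t) : Step Φ A B t := by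
  induction h with
  | id A => exact id hΦ A
  | ren a b => exact hr a b
  | gen γ => exact hg γ
  | mul h h' hA hB ih ih' => exact mul hΦ hr ih ih' h.ty h'.ty hA hB
  | comp h h' ih ih' => exact comp hΦ hr ih ih' h.ty h'.ty

end Step

/-- Permutations are pushed down to the leaves, where a permuted generator is again a generator. The
statement is for all `π` so that nested permutations can accumulate in it. -/
theorem built_perm (t : Term N (T.Gen)) (h : T.WT t) (π : FinPerm N) :
    Built (π • (T.tdom t : Finset N)) (π • (T.tcod t : Finset N))
      (ev (.perm π t)) := by
  induction t generalizing π with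
  | gen γ =>
    rw [ev_eq_of_eqv (.basic (.perm_gen (T := T) π γ) trivial trivial)]
    have := Built.gen (π • γ)
    rw [Signature.tdom, Signature.tcod, ← T.dom_smul, ← T.cod_smul, 
      ev_of_wt (t := .gen (π • γ)) (T.wt_gen _)]
    exact this
  | idt A =>
    rw [ev_eq_of_eqv (.basic (.perm_id π A) trivial trivial),
      ev_idt]
    exact .id _
  | ren a b =>
    rw [ev_eq_of_eqv (.basic (.perm_ren π a b) trivial trivial),
      ev_ren]
    rw [Signature.tdom, Signature.tcod, Finset.smul_finset_singleton,
      Finset.smul_finset_singleton]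
    exact .ren _ _
  | tensor t s iht ihs =>
    have h3 := PArrow.disjoint_smul π h.2.2.1
    have h4 := PArrow.disjoint_smul π h.2.2.2
    rw [ev_eq_of_eqv (.basic (.perm_tensor π t s) h
      ⟨h.1, h.2.1, h3, h4⟩), ev_tensor]
    have := (iht h.1 π).mul (ihs h.2.1 π) h3 h4
    rwa [← Finset.smul_finset_union, ← Finset.smul_finset_union] at this
  | comp t s iht ihs =>
    have h3 := congrArg (π • ·) h.2.2
    rw [ev_eq_of_eqv (.basic (.perm_comp π t s) h
      ⟨h.1, h.2.1, h3⟩), ev_comp]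
    exact (iht h.1 π).comp (by rw [h.2.2]; exact ihs h.2.1 π)
  | perm σ t iht =>
    rw [← ev_eq_of_eqv (.basic (.perm_mul π σ t) h h)]
    have := iht h (π * σ)
    rwa [mul_smul, mul_smul] at this

/-- A property of arrows that holds for identities and is preserved by composition with
renamings and generators, in parallel with identities, holds for all arrows. -/
theorem induction_layers [Countable N] [Infinite N] {Φ : Finset N → PX T.category → Prop}
    (hΦ : ∀ B f, Φ B f → ∃ A, Ty f A B)
    (hr : ∀ a b, Step Φ {a} {b} (PX.ren _ a b))
    (hg : ∀ γ : T.Gen, Step Φ (T.dom γ) (T.cod γ) (PX.of (T.genArrow γ)))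
    (f : T.category.Arrow) 
    (hA : Φ (T.category.dom f) (I _ (T.category.dom f))) :
    Φ (T.category.cod f) (PX.of f) := by
  have hb : Built (T.category.dom f) (T.category.cod f) (PX.of f) := by
    obtain ⟨t, h, rfl⟩ := PArrow.exists_rep f
    have := built_perm t h 1
    rw [one_smul, one_smul,
      ev_eq_of_eqv (.basic (.perm_one t) h h), ev_of_wt h] at this
    exact this
  have h := Step.of_built hΦ hr hg hb ∅ (I _ (T.category.dom f))
    (Finset.disjoint_empty_left _)
    (Finset.disjoint_empty_left _) (by rwa [Finset.empty_union])
  rwa [Finset.empty_union, I_empty, one_mul, hb.ty.id_comp] at h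

end Theory

end Layers

/-! ### Merging several wires into one. -/

section Merging

open PX

namespace CX

variable {N : Type u} [DecidableEq N] {K : Set Kind} [Infinite N]

/-- Renaming the two inputs in turn may produce a clash halfway, for instance if `a' = b`. The
detour of the first wire through `z` avoids it. -/
theorem ren_mul_ren_mu (a b : N) {a' b' : N} (h' : a' ≠ b') (c : N) :
    (ren _ a a' * ren _ b b') ⨾ mu K a' b' c = mu K a b c := by
  obtain ⟨z, hz⟩ := Infinite.exists_notMem_finset ({b, b'} : Finset N)
  simp only [Finset.mem_insert, Finset.mem_singleton, not_or] at hz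
  rw [← ren_comp_ren a z a', ← (ty_ren b b').id_comp,
    ← mul_comp_mul (ty_ren _ _) (ty_ren _ _) (ty_I _) (ty_ren _ _)
      (Finset.disjoint_singleton.2 hz.1),
    mul_eq_comp' (ty_ren z a') (ty_ren b b') (Finset.disjoint_singleton.2 hz.2), comp_assoc,
    comp_assoc, ren_mu h', ren_mu_right hz.2, ren_mu hz.1]

/-- An element different from `a`. -/
noncomputable def other (a : N) : N := (exists_ne a).choose

omit [DecidableEq N] in
theorem other_ne (a : N) : other a ≠ a := (exists_ne a).choose_spec

variable (K) in
/-- The arrow that merges the inputs in the list into the single output `b`. -/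
noncomputable def merge : List N → N → CX N K
  | [], b => eta K b
  | [a], b => ren _ a b
  | a :: c :: l, b => (I _ {a} * merge (c :: l) (other a)) ⨾ mu K a (other a) b

theorem ty_merge (l : List N) (b : N) : Ty (merge K l b) l.toFinset {b} := by
  induction l generalizing b with
  | nil => exact ty_eta K b
  | cons a l ih =>
    cases l with
    | nil => exact ty_ren a b
    | cons c l =>
      rw [List.toFinset_cons, Finset.insert_eq]
      exact ((ty_I _).mul (ih _)).comp (ty_mu K _ _ _)

theorem merge_ren (l : List N) (a b : N) : merge K l a ⨾ ren _ a b = merge K l b := by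
  match l with
  | [] => exact eta_ren a b
  | [c] => exact ren_comp_ren c a b
  | c :: d :: l => rw [merge, merge, comp_assoc, mu_ren]

/-- The choice of the internal name in `merge` does not matter, because `μ` absorbs renamings of its
inputs. For the empty list the equation would be a unit law, which is not available for every `K`.
-/
theorem merge_cons {l : List N} (hl : l ≠ []) {a x : N} (hx : a ≠ x) (b : N) :
    (I _ {a} * merge K l x) ⨾ mu K a x b = merge K (a :: l) b := by
  cases l with
  | nil => exact absurd rfl hl
  | cons c l =>
    rw [merge, ← merge_ren _ (other a) x, ← id_mul_comp (ty_merge _ _) (ty_ren _ _)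
      (Finset.disjoint_singleton.2 (other_ne a).symm), comp_assoc, ren_mu_right hx]

theorem merge_mul_merge_mu {a b a' b' : N} (h : a ≠ b) (h' : a' ≠ b') (l l' : List N) (c : N) :
    (merge K l a * merge K l' b) ⨾ mu K a b c = (merge K l a' * merge K l' b') ⨾ mu K a' b' c := by
  rw [← merge_ren l a a', ← merge_ren l' b b',
    ← mul_comp_mul (ty_merge _ _) (ty_ren _ _) (ty_merge _ _) (ty_ren _ _)
      (Finset.disjoint_singleton.2 h), comp_assoc, ren_mul_ren_mu a b h']

/-- Associativity, with the unit law when a list is empty. In that case `η` must be present, since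
otherwise the merge of the empty list is `0`. -/
theorem merge_append (hK : Kind.mult ∈ K) {l l' : List N} (hl : l = [] → Kind.unit ∈ K)
    (hl' : l' = [] → Kind.unit ∈ K) {a b : N} (h : a ≠ b) (c : N) :
    (merge K l a * merge K l' b) ⨾ mu K a b c = merge K (l ++ l') c := by
  have unit_left (h : Kind.unit ∈ K) (l : List N) {a b : N} (c : N) (hab : a ≠ b) :
      (eta K a * merge K l b) ⨾ mu K a b c = merge K l c := by
    rw [mul_eq_comp' (ty_eta K a) (ty_merge l b) (Finset.disjoint_empty_left _), comp_assoc,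
      eta_mu h hK hab, I_empty, one_mul, merge_ren]
  induction l generalizing a b c with
  | nil => exact unit_left (hl rfl) l' c h
  | cons d l ih =>
    obtain ⟨z, hz⟩ := Infinite.exists_notMem_finset ({d} : Finset N)
    rw [Finset.mem_singleton] at hz
    -- The left internal wire receives the name `d` itself, so that merging `[d]` into it is an
    -- identity.
    rw [merge_mul_merge_mu h (Ne.symm hz)]
    cases l with
    | nil =>
      cases l' with
      | nil =>
        rw [mul_comm, mu_comm]
        exact unit_left (hl' rfl) _ c hz
      | cons e l' =>
        rw [merge, ren_self, merge_cons (List.cons_ne_nil _ _) (Ne.symm hz)]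
        rfl
    | cons e l =>
      obtain ⟨x, hx⟩ := Infinite.exists_notMem_finset ({d, z} : Finset N)
      simp only [Finset.mem_insert, Finset.mem_singleton, not_or] at hx
      rw [← merge_cons (List.cons_ne_nil _ _) (Ne.symm hx.1),
        ← (ty_merge l' z).comp_id,
        ← mul_comp_mul ((ty_I _).mul (ty_merge _ _)) (ty_mu K _ _ _) (ty_merge _ _) (ty_I _)
          (by simp [hz, Ne.symm hx.2]),
        comp_assoc, mu_assoc (Ne.symm hz) (Ne.symm hx.1), mul_assoc, ← comp_assoc,
        mul_comp_mul (ty_I _) (ty_I _) ((ty_merge _ _).mul (ty_merge _ _)) (ty_mu K _ _ _)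
          (by simp [Ne.symm hz, Ne.symm hx.1]), (ty_I _).id_comp]
      rw [ih (fun h => absurd h (List.cons_ne_nil _ _)) hx.2, merge_cons (by simp)
        (Ne.symm hx.1)]
      rfl

theorem merge_perm {l l' : List N} (h : l.Perm l') (b : N) : merge K l b = merge K l' b := by
  by_cases hK : Kind.mult ∈ K
  swap
  · cases l with
    | nil => rw [List.nil_perm.1 h]
    | cons a l =>
      cases l with
      | nil => rw [List.singleton_perm.1 h]
      | cons c l =>
        have := h.length_eq
        match l', this with
        | _ :: _ :: _, _ => rw [merge, merge, mu_zero hK, mu_zero hK, comp_zero, comp_zero]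
  induction h generalizing b with
  | nil => rfl
  | @cons a l l' h ih =>
    by_cases hl : l = []
    · subst hl
      rw [List.nil_perm.1 h]
    · rw [← merge_cons hl (other_ne a).symm, ih,
        merge_cons (fun h' => hl (List.perm_nil.1 (h' ▸ h))) (other_ne a).symm]
  | swap a c l =>
    have two (b : N) : merge K [c, a] b = merge K [a, c] b := by
      by_cases hac : a = c
      · rw [hac]
      rw [← merge_cons (List.cons_ne_nil _ _) (Ne.symm hac),
        ← merge_cons (List.cons_ne_nil _ _) hac, merge, merge, ren_self, ren_self, mul_comm,
        mu_comm]
    cases l with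
    | nil => exact two b
    | cons d l =>
      -- The list splits into its first two entries and a nonempty rest, so no unit is needed to
      -- take it apart and reassemble it.
      have key (a c : N) (two : merge K [c, a] c = merge K [a, c] c) :
          merge K ([c, a] ++ d :: l) b = merge K ([a, c] ++ d :: l) b := by
        rw [← merge_append hK (by simp) (by simp) (other_ne c).symm, two,
          merge_append hK (by simp) (by simp) (other_ne c).symm]
      exact key a c (two c)
  | trans _ _ ih ih' => exact (ih b).trans (ih' b)

/-- Discarding the output of `μ` discards both inputs. Nonvanishing matters already for the empty
list: without `η` the left side is `0`, while the empty product is `1`. -/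
theorem merge_comp_etaHat (hK : Kind.counit ∈ K) (l : List N) (b : N) (h : merge K l b ≠ 0) :
    merge K l b ⨾ etaHat K b = (l.map (etaHat K)).prod := by
  induction l generalizing b with
  | nil =>
    by_cases hK' : Kind.unit ∈ K
    · exact eta_etaHat hK' hK b
    · exact absurd (eta_zero hK' b) h
  | cons a l ih =>
    cases l with
    | nil => rw [merge, ren_etaHat, List.map_singleton, List.prod_singleton]
    | cons c l =>
      have h1 : Kind.mult ∈ K := by
        by_contra h1
        rw [merge, mu_zero h1, comp_zero] at h
        exact h rfl
      have h2 : merge K (c :: l) (other a) ≠ 0 := by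
        intro h2
        rw [merge, h2, mul_zero, zero_comp] at h
        exact h rfl
      rw [merge, comp_assoc, mu_etaHat h1 (other_ne a).symm,
        mul_comp_mul (ty_I _) (ty_etaHat K _) (ty_merge _ _) (ty_etaHat K _)
          (Finset.disjoint_singleton.2 (other_ne a).symm), (ty_etaHat K _).id_comp, ih _ h2]
      rfl

variable (K) in
/-- The arrow that merges all elements of `S` into the single output `b`. -/
noncomputable def mergeSet (S : Finset N) (b : N) : CX N K := merge K S.toList b

theorem ty_mergeSet (S : Finset N) (b : N) : Ty (mergeSet K S b) S {b} := by
  have := ty_merge (K := K) S.toList b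
  rwa [Finset.toList_toFinset] at this

theorem mergeSet_empty (b : N) : mergeSet K ∅ b = eta K b := by
  rw [mergeSet, Finset.toList_empty, merge]

theorem mergeSet_singleton (a b : N) : mergeSet K {a} b = ren _ a b := by
  rw [mergeSet, Finset.toList_singleton, merge]

theorem mergeSet_ren (S : Finset N) (a b : N) :
    mergeSet K S a ⨾ ren _ a b = mergeSet K S b := merge_ren _ _ _

theorem merge_ne_nil {l : List N} {b : N} (h : merge K l b ≠ 0) (hl : l = []) :
    Kind.unit ∈ K := by
  by_contra hK
  subst hl
  exact h (eta_zero hK b)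

/-- The hypothesis `h` packs all side conditions: disjointness of `S` and `T`, `a ≠ b`, and the
presence of `η` if one of the sets is empty. The arbitrary order chosen by `Finset.toList` is
harmless by `merge_perm`. -/
theorem mergeSet_mul_mu (hK : Kind.mult ∈ K) {S T : Finset N} {a b : N}
    (h : mergeSet K S a * mergeSet K T b ≠ 0) (c : N) :
    (mergeSet K S a * mergeSet K T b) ⨾ mu K a b c = mergeSet K (S ∪ T) c := by
  obtain ⟨hST, hab⟩ := disjoint_of_mul_ne_zero (ty_mergeSet S a) (ty_mergeSet T b) h
  rw [mergeSet, mergeSet, merge_append hK (merge_ne_nil (left_ne_zero_of_mul h))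
    (merge_ne_nil (right_ne_zero_of_mul h)) (Finset.disjoint_singleton.1 hab), mergeSet]
  refine merge_perm ((List.perm_ext_iff_of_nodup ?_ (Finset.nodup_toList _)).2 fun x => ?_) c
  · refine (Finset.nodup_toList S).append (Finset.nodup_toList T) fun x hx hx' => ?_
    exact Finset.disjoint_left.1 hST (Finset.mem_toList.1 hx) (Finset.mem_toList.1 hx')
  · simp

theorem mergeSet_comp_etaHat (hK : Kind.counit ∈ K) {S : Finset N} {b : N}
    (h : mergeSet K S b ≠ 0) : mergeSet K S b ⨾ etaHat K b = ∏ a ∈ S, etaHat K a := by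
  rw [mergeSet, merge_comp_etaHat hK _ _ h, Finset.prod_map_toList]

end CX

end Merging

/-! ### Normal forms without comultiplication. -/

section PartialFunctionForms

open PX

namespace CX

variable {N : Type u} [DecidableEq N] {K : Set Kind}

variable (K) in
/-- The arrow that discards all elements of `U`. -/
noncomputable def discard (U : Finset N) : CX N K := ∏ u ∈ U, etaHat K u

theorem ty_discard (U : Finset N) : Ty (discard K U) U ∅ := by
  refine (ty_prod U _ _ _ fun u _ => ty_etaHat K u).cast Finset.biUnion_singleton_eq_self ?_
  ext x; simp

theorem discard_union {U V : Finset N} (h : Disjoint U V) :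
    discard K (U ∪ V) = discard K U * discard K V := Finset.prod_union h

theorem discard_singleton (u : N) : discard K {u} = etaHat K u := Finset.prod_singleton _ _

variable [Infinite N]

variable (K) in
/-- The arrow that merges the elements of `p b` into `b`, for all `b ∈ B`. -/
noncomputable def fibers (B : Finset N) (p : N → Finset N) : CX N K := ∏ b ∈ B, mergeSet K (p b) b

theorem fibers_congr {B : Finset N} {p q : N → Finset N} (h : ∀ b ∈ B, p b = q b) :
    fibers K B p = fibers K B q := Finset.prod_congr rfl fun b hb => by rw [h b hb]

theorem fibers_union {A B : Finset N} (h : Disjoint A B) (p : N → Finset N) :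
    fibers K (A ∪ B) p = fibers K A p * fibers K B p := Finset.prod_union h

theorem fibers_singleton (b : N) (p : N → Finset N) :
    fibers K {b} p = mergeSet K (p b) b := Finset.prod_singleton _ _

theorem ty_fibers (B : Finset N) (p : N → Finset N) : Ty (fibers K B p) (B.biUnion p) B :=
  (ty_prod B _ _ _ fun b _ => ty_mergeSet (p b) b).cast rfl Finset.biUnion_singleton_eq_self

/-- An arrow `f : A → B`, possibly `0`, in the normal form of partial functions. -/
def IsFibers (A B : Finset N) (f : CX N K) : Prop :=
  -- No normal form is asked of `0`, so definedness does not have to be tracked through the layers.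
  Ty f A B ∧ (f ≠ 0 → ∃ p U, f = fibers K B p * discard K U)

theorem isFibers_id (A : Finset N) : IsFibers A A (I (calculus N K).category A) := by
  refine ⟨ty_I A, fun h0 => ⟨fun a => {a}, ∅, ?_⟩⟩
  clear h0
  rw [discard, Finset.prod_empty, mul_one]
  induction A using Finset.induction_on with
  | empty => rfl
  | insert a A ha ih =>
    rw [I_insert ha, ih, fibers, fibers, Finset.prod_insert ha, mergeSet_singleton, PX.ren_self]

/-- The normal form is a product over the outputs, so `g` meets only the fibres over its own inputs
`G`. The fibres over `D` and the discarded wires, which have no outputs, stand aside by interchange.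
-/
theorem step_isFibers {A G H : Finset N} {g : CX N K} (hg : Ty g G H)
    (h : ∀ p, fibers K G p ≠ 0 → ∃ q V, fibers K G p ⨾ g = fibers K H q * discard K V) :
    Theory.Step (IsFibers (K := K) A) G H g := by
  intro D f hDG hDH ⟨hf, hf'⟩
  refine ⟨hf.comp ((ty_I D).mul hg), fun h0 => ?_⟩
  obtain ⟨p, U, rfl⟩ := hf' (by rintro rfl; exact h0 (zero_comp _))
  have e1 : (fibers K (D ∪ G) p * discard K U) ⨾ (I _ D * g) =
      fibers K D p * (fibers K G p ⨾ g) * discard K U := by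
    rw [fibers_union hDG, mul_assoc,
      mul_comp_mul (ty_fibers D p) (ty_I D)
        (((ty_fibers G p).mul (ty_discard U)).cast rfl (Finset.union_empty _)) hg hDG,
      (ty_fibers D p).comp_id, mul_assoc]
    congr 1
    have := mul_comp_mul (ty_fibers G p) hg (ty_discard U) ty_one (Finset.disjoint_empty_right _)
    rw [mul_one] at this
    rw [this, ← I_empty, (ty_discard U).comp_id]
  rw [e1] at h0
  obtain ⟨q, V, hq⟩ := h p (by
    intro h1
    rw [h1, zero_comp, mul_zero, zero_mul] at h0
    exact h0 rfl)
  rw [hq] at e1 h0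
  rw [← mul_assoc, mul_assoc] at h0
  have hUV : discard K V * discard K U ≠ 0 := by
    intro h1
    rw [h1, mul_zero] at h0
    exact h0 rfl
  refine ⟨fun b => if b ∈ D then p b else q b, V ∪ U, ?_⟩
  rw [e1, discard_union (disjoint_of_mul_ne_zero (ty_discard V) (ty_discard U) hUV).1,
    fibers_union hDH, mul_assoc, mul_assoc, mul_assoc]
  congr 1
  · exact fibers_congr fun b hb => by rw [if_pos hb]
  · congr 1
    exact fibers_congr fun b hb => by rw [if_neg (Finset.disjoint_right.1 hDH hb)]

theorem isFibers_ren (A : Finset N) (a b : N) :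
    Theory.Step (IsFibers (K := K) A) {a} {b} (PX.ren _ a b) :=
  step_isFibers (ty_ren a b) fun p _ => ⟨fun _ => p a, ∅, by
    rw [fibers_singleton, fibers_singleton, mergeSet_ren, discard, Finset.prod_empty, mul_one]⟩

/-- `η` contributes an empty fibre, `μ` unites two fibres, and `η̂` turns a fibre into discarded
inputs. -/
theorem isFibers_gen (hK : Kind.comult ∉ K) (A : Finset N) (γ : CGen N K) :
    Theory.Step (IsFibers (K := K) A) γ.dom γ.cod (gen γ) := by
  refine step_isFibers (ty_gen γ) fun p hp => ?_
  cases γ with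
  | eta h a =>
    refine ⟨fun _ => ∅, ∅, ?_⟩
    rw [← ev_gen, ← eta_def h, CGen.dom, CGen.cod, fibers_singleton, mergeSet_empty, fibers,
      discard, Finset.prod_empty, Finset.prod_empty, mul_one, ← I_empty, (ty_eta K a).id_comp]
  | mu h a b c hab =>
    refine ⟨fun _ => p a ∪ p b, ∅, ?_⟩
    rw [CGen.dom, fibers, Finset.prod_pair hab] at hp
    rw [← ev_gen, ← mu_def h hab, CGen.dom, CGen.cod, fibers_singleton, fibers,
      Finset.prod_pair hab, mergeSet_mul_mu h hp, discard, Finset.prod_empty, mul_one]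
  | etaHat h a =>
    rw [CGen.dom, fibers_singleton] at hp
    refine ⟨fun _ => ∅, p a, ?_⟩
    rw [← ev_gen, ← etaHat_def h, CGen.dom, CGen.cod, fibers_singleton,
      mergeSet_comp_etaHat h hp, fibers, Finset.prod_empty, one_mul, discard]
  | muHat h a b c hbc => exact absurd h hK

/-- Without the comultiplication every arrow is in the normal form of partial functions. -/
theorem exists_fibers [Countable N] (hK : Kind.comult ∉ K) (f : (calculus N K).category.Arrow) :
    ∃ p U, PX.of f = fibers K ((calculus N K).category.cod f) p * discard K U :=
  (Theory.induction_layers (Φ := IsFibers ((calculus N K).category.dom f))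
    (fun _ _ h => ⟨_, h.1⟩) (isFibers_ren _) (isFibers_gen hK _) f (isFibers_id _)).2 (of_ne_zero f)

end CX

end PartialFunctionForms

local notation "𝒰" => (Set.univ : Set Kind)

/-! ### Adding a pair to a relation: commutation and idempotence of edges. -/

section RelationForms

open PX

namespace CX

variable {N : Type u} [DecidableEq N]

/-- Copies the wire `a ∈ A` to the additional output `x`. -/
noncomputable def fork (A : Finset N) (a x : N) : CX N 𝒰 := muHat _ a a x * I _ (A.erase a)

/-- Merges the additional input `x` into the wire `b ∈ B`. -/
noncomputable def join (B : Finset N) (x b : N) : CX N 𝒰 := mu _ x b b * I _ (B.erase b)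

theorem ty_fork {A : Finset N} {a : N} (ha : a ∈ A) (x : N) : Ty (fork A a x) A (A ∪ {x}) := by
  refine ((ty_muHat _ a a x).mul (ty_I (A.erase a))).cast ?_ ?_
  · rw [← Finset.insert_eq, Finset.insert_erase ha]
  · rw [Finset.union_right_comm, ← Finset.insert_eq, Finset.insert_erase ha]

theorem ty_join {B : Finset N} {b : N} (hb : b ∈ B) (x : N) : Ty (join B x b) (B ∪ {x}) B := by
  refine ((ty_mu _ x b b).mul (ty_I (B.erase b))).cast ?_ ?_
  · rw [Finset.union_assoc, ← Finset.insert_eq b, Finset.insert_erase hb, Finset.union_comm]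
  · rw [← Finset.insert_eq, Finset.insert_erase hb]

theorem fork_union {A E : Finset N} {a : N} (ha : a ∈ A) (h : Disjoint A E) (x : N) :
    fork (A ∪ E) a x = fork A a x * I _ E := by
  rw [fork, fork, Finset.erase_union_distrib,
    Finset.erase_eq_of_notMem (Finset.disjoint_left.1 h ha),
    I_union (h.mono_left (Finset.erase_subset _ _)), mul_assoc]

theorem join_union {B E : Finset N} {b : N} (hb : b ∈ B) (h : Disjoint B E) (x : N) :
    join (B ∪ E) x b = join B x b * I _ E := by
  rw [join, join, Finset.erase_union_distrib,
    Finset.erase_eq_of_notMem (Finset.disjoint_left.1 h hb),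
    I_union (h.mono_left (Finset.erase_subset _ _)), mul_assoc]

theorem fork_singleton (a x : N) : fork {a} a x = muHat _ a a x := by
  rw [fork, Finset.erase_singleton, I_empty, mul_one]

theorem join_singleton (x b : N) : join {b} x b = mu _ x b b := by
  rw [join, Finset.erase_singleton, I_empty, mul_one]

theorem fork_ren {A : Finset N} {a y : N} (ha : a ∈ A) (hy : y ∉ A) (x : N) :
    fork A a y ⨾ (I _ A * ren _ y x) = fork A a x := by
  have hya : a ≠ y := fun h => hy (h ▸ ha)
  rw [I_eq_erase ha, mul_right_comm, fork,
    mul_comp_mul (ty_muHat _ _ _ _) ((ty_I _).mul (ty_ren _ _)) (ty_I _) (ty_I _),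
    muHat_ren_right hya, (ty_I _).comp_id, fork]
  simp [Finset.disjoint_left, hy]

theorem ren_join {B : Finset N} {b x : N} (hb : b ∈ B) (hx : x ∉ B) (y : N) :
    (I _ B * ren _ y x) ⨾ join B x b = join B y b := by
  have hxb : x ≠ b := fun h => hx (h ▸ hb)
  rw [I_eq_erase hb, mul_right_comm, mul_comm (I _ {b}), join,
    mul_comp_mul ((ty_ren _ _).mul (ty_I _)) (ty_mu _ _ _ _) (ty_I _) (ty_I _),
    ren_mu hxb, (ty_I _).comp_id, join]
  simp [Finset.disjoint_left, hx]

theorem fork_etaHat {A : Finset N} {a x : N} (ha : a ∈ A) (hx : x ∉ A) :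
    fork A a x ⨾ (I _ A * etaHat _ x) = I _ A := by
  have hxa : x ≠ a := fun h => hx (h ▸ ha)
  rw [I_eq_erase ha, mul_right_comm, fork,
    mul_comp_mul (ty_muHat _ _ _ _) (((ty_I _).mul (ty_etaHat _ _)).cast rfl (Finset.union_empty _))
      (ty_I _) (ty_I _),
    muHat_comm, mul_comm (I _ {a}), muHat_etaHat (Set.mem_univ _) (Set.mem_univ _) hxa, (ty_I _).comp_id, ren_self]
  simp [Finset.disjoint_left, hx]

/-- Coassociativity and cocommutativity: a second copy of `a` may as well be taken from the first
copy `x`. -/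
theorem fork_fork_self {A : Finset N} {a x : N} (ha : a ∈ A) (hx : x ∉ A) (y : N) :
    fork A a x ⨾ (fork A a y * I _ {x}) = fork A a x ⨾ (I _ A * muHat _ x x y) := by
  have hax : a ≠ x := fun h => hx (h ▸ ha)
  have hd : Disjoint ({a} ∪ {x}) (A.erase a) := by simp [Finset.disjoint_left, hx]
  rw [I_eq_erase ha, mul_right_comm, fork, fork, mul_right_comm,
    mul_comp_mul (ty_muHat _ _ _ _) ((ty_muHat _ _ _ _).mul (ty_I _)) (ty_I _) (ty_I _) hd,
    mul_comp_mul (ty_muHat _ _ _ _) ((ty_I _).mul (ty_muHat _ _ _ _)) (ty_I _) (ty_I _) hd,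
    muHat_assoc hax hax, muHat_comm x y x]

theorem join_join_self {B : Finset N} {b x : N} (hb : b ∈ B) (hx : x ∉ B) (y : N) :
    (join B y b * I _ {x}) ⨾ join B x b = (I _ B * mu _ x y x) ⨾ join B x b := by
  have hbx : b ≠ x := fun h => hx (h ▸ hb)
  have hd : Disjoint ({b} ∪ {x}) (B.erase b) := by simp [Finset.disjoint_left, hx]
  have hd' : Disjoint ({x} ∪ {b}) (B.erase b) := by rwa [Finset.union_comm]
  rw [I_eq_erase hb, mul_right_comm, join, join, mul_right_comm, mul_comm (I _ {b}),
    mul_comp_mul ((ty_mu _ _ _ _).mul (ty_I _)) ((ty_mu _ _ _ _).cast (Finset.union_comm _ _) rfl)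
      (ty_I _) (ty_I _) hd,
    mul_comp_mul ((ty_mu _ _ _ _).mul (ty_I _)) (ty_mu _ _ _ _) (ty_I _) (ty_I _) hd',
    mu_assoc hbx.symm hbx.symm, mul_comm (I _ {x})]

/-- Copies of different wires happen side by side. The parallel form shows the symmetry that
`fork_comm` needs. -/
theorem fork_fork_ne {A : Finset N} {a c x y : N} (ha : a ∈ A) (hc : c ∈ A) (hac : a ≠ c)
    (hx : x ∉ A) :
    fork A a x ⨾ (fork A c y * I _ {x}) =
      muHat _ a a x * muHat _ c c y * I _ ((A.erase a).erase c) := by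
  have hc' : c ∈ A.erase a := Finset.mem_erase.2 ⟨hac.symm, hc⟩
  have ha' : a ∈ A.erase c := Finset.mem_erase.2 ⟨hac, ha⟩
  have e1 : fork A a x = muHat _ a a x * (I _ {c} * I _ ((A.erase a).erase c)) := by
    rw [fork, I_eq_erase hc']
  have e2 : fork A c y * I _ {x} = (I _ {a} * I _ {x}) *
      (muHat _ c c y * I _ ((A.erase a).erase c)) := by
    rw [fork, I_eq_erase ha', Finset.erase_right_comm]; ac_rfl
  have hcx : c ≠ x := fun h => hx (h ▸ hc)
  have hax : a ≠ x := fun h => hx (h ▸ ha)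
  rw [e1, e2, mul_comp_mul (ty_muHat _ _ _ _) ((ty_I _).mul (ty_I _))
    ((ty_I _).mul (ty_I _)) ((ty_muHat _ _ _ _).mul (ty_I _)),
    mul_comp_mul (ty_I _) (ty_muHat _ _ _ _) (ty_I _) (ty_I _), (ty_I _).comp_id,
    (ty_muHat _ _ _ _).id_comp, ← I_union, (ty_muHat _ _ _ _).comp_id, mul_assoc]
  · simpa using hax
  · simp
  · simp [Finset.disjoint_left, hx, hac, hcx.symm]

theorem join_join_ne {B : Finset N} {b d x y : N} (hb : b ∈ B) (hd : d ∈ B) (hbd : b ≠ d)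
    (hx : x ∉ B) :
    (join B y d * I _ {x}) ⨾ join B x b =
      mu _ x b b * mu _ y d d * I _ ((B.erase b).erase d) := by
  have hd' : d ∈ B.erase b := Finset.mem_erase.2 ⟨hbd.symm, hd⟩
  have hb' : b ∈ B.erase d := Finset.mem_erase.2 ⟨hbd, hb⟩
  have e1 : join B x b = mu _ x b b * (I _ {d} * I _ ((B.erase b).erase d)) := by
    rw [join, I_eq_erase hd']
  have e2 : join B y d * I _ {x} = (I _ {x} * I _ {b}) *
      (mu _ y d d * I _ ((B.erase b).erase d)) := by
    rw [join, I_eq_erase hb', Finset.erase_right_comm]; ac_rfl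
  have hdx : d ≠ x := fun h => hx (h ▸ hd)
  have hbx : b ≠ x := fun h => hx (h ▸ hb)
  rw [e1, e2, mul_comp_mul ((ty_I _).mul (ty_I _)) (ty_mu _ _ _ _)
    ((ty_mu _ _ _ _).mul (ty_I _)) ((ty_I _).mul (ty_I _)),
    mul_comp_mul (ty_mu _ _ _ _) (ty_I _) (ty_I _) (ty_I _), (ty_I _).comp_id,
    (ty_mu _ _ _ _).comp_id, ← I_union, (ty_mu _ _ _ _).id_comp, mul_assoc]
  · simpa using hbx.symm
  · simp
  · simp [Finset.disjoint_left, hx, hbd, hdx.symm]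

theorem fork_comm {A : Finset N} {a c x y : N} (ha : a ∈ A) (hc : c ∈ A) (hx : x ∉ A)
    (hy : y ∉ A) :
    fork A a x ⨾ (fork A c y * I _ {x}) = fork A c y ⨾ (fork A a x * I _ {y}) := by
  by_cases hac : a = c
  · subst hac
    -- Both sides now copy a copy of `a`; they differ by exchanging `x` and `y`, which
    -- cocommutativity undoes.
    rw [fork_fork_self ha hx, fork_fork_self ha hy, ← fork_ren ha hy x, comp_assoc,
      id_mul_comp (ty_ren _ _) (ty_muHat _ _ _ _) (by simpa using hx), ren_muHat, muHat_comm]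
  · rw [fork_fork_ne ha hc hac hx, fork_fork_ne hc ha (Ne.symm hac) hy, Finset.erase_right_comm,
      mul_comm (muHat _ a a x)]

theorem join_comm {B : Finset N} {b d x y : N} (hb : b ∈ B) (hd : d ∈ B) (hx : x ∉ B)
    (hy : y ∉ B) :
    (join B y d * I _ {x}) ⨾ join B x b = (join B x b * I _ {y}) ⨾ join B y d := by
  by_cases hbd : b = d
  · subst hbd
    rw [join_join_self hb hx, join_join_self hb hy, ← ren_join hb hx y, ← comp_assoc,
      id_mul_comp (ty_mu _ _ _ _) (ty_ren _ _) (by simpa using hy), mu_ren, mu_comm]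
  · rw [join_join_ne hb hd hbd hx, join_join_ne hd hb (Ne.symm hbd) hy, Finset.erase_right_comm,
      mul_comm (mu _ x b b)]

variable [Infinite N]

/-- A name outside `A`. -/
noncomputable def freshName (A : Finset N) : N := (Infinite.exists_notMem_finset A).choose

omit [DecidableEq N] in
theorem freshName_notMem (A : Finset N) : freshName A ∉ A :=
  (Infinite.exists_notMem_finset A).choose_spec

/-- Adds the pair `(a, b)` to the relation from `A` to `B` denoted by `f`. -/
noncomputable def addEdge (A B : Finset N) (a b : N) (f : CX N 𝒰) : CX N 𝒰 :=
  fork A a (freshName (A ∪ B)) ⨾ (f * I _ {freshName (A ∪ B)}) ⨾ join B (freshName (A ∪ B)) b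

variable {A B : Finset N} {a b : N} {f : CX N 𝒰}

/-- Any fresh name serves for the extra wire: a renaming emitted by the fork slides past `f` and is
absorbed by the join. -/
theorem addEdge_eq (ha : a ∈ A) (hb : b ∈ B) (hf : Ty f A B) {x : N} (hx : x ∉ A) (hx' : x ∉ B) :
    addEdge A B a b f = fork A a x ⨾ (f * I _ {x}) ⨾ join B x b := by
  have hy := freshName_notMem (A ∪ B)
  rw [Finset.mem_union, not_or] at hy
  rw [addEdge]
  generalize freshName (A ∪ B) = y at hy
  rw [← fork_ren ha hx y, ← ren_join hb hy.2 x, comp_assoc, comp_assoc, comp_assoc,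
    ← comp_assoc (I _ A * _), ← comp_assoc (f * _),
    mul_comp_mul (ty_I A) hf (ty_ren _ _) (ty_I _) (by simpa using hy.1), hf.id_comp,
    (ty_ren _ _).comp_id,
    mul_comp_mul hf (ty_I B) (ty_I _) (ty_ren _ _) (by simpa using hx'), hf.comp_id,
    (ty_ren _ _).id_comp]

theorem ty_addEdge (ha : a ∈ A) (hb : b ∈ B) (hf : Ty f A B) : Ty (addEdge A B a b f) A B :=
  ((ty_fork ha _).comp (hf.mul (ty_I _))).comp (ty_join hb _)

/-- Collecting both forks before `f` and both joins after it reduces questions about two edges to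
questions about two forks and two joins. -/
theorem addEdge_addEdge {c d x y : N} (ha : a ∈ A) (hb : b ∈ B) (hc : c ∈ A) (hd : d ∈ B)
    (hf : Ty f A B) (hx : x ∉ A) (hx' : x ∉ B) (hy : y ∉ A) (hy' : y ∉ B) (hxy : x ≠ y) :
    addEdge A B a b (addEdge A B c d f) =
      (fork A a x ⨾ (fork A c y * I _ {x})) ⨾ (f * I _ {y} * I _ {x}) ⨾
        ((join B y d * I _ {x}) ⨾ join B x b) := by
  have h1 : Disjoint (A ∪ {y}) {x} := by simp [hx, hxy]
  have h2 : Disjoint (B ∪ {y}) {x} := by simp [hx', hxy]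
  rw [addEdge_eq ha hb (ty_addEdge hc hd hf) hx hx', addEdge_eq hc hd hf hy hy',
    ← comp_mul_id ((ty_fork hc y).comp (hf.mul (ty_I _))) (ty_join hd y) h2,
    ← comp_mul_id (ty_fork hc y) (hf.mul (ty_I _)) h1]
  simp only [comp_assoc]

theorem exists_fresh_pair (V : Finset N) : ∃ x y : N, x ∉ V ∧ y ∉ V ∧ x ≠ y := by
  refine ⟨freshName V, freshName (insert (freshName V) V), freshName_notMem V, fun h => ?_,
    fun h => ?_⟩
  · exact freshName_notMem (insert (freshName V) V) (Finset.mem_insert_of_mem h)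
  · exact freshName_notMem (insert (freshName V) V) (Finset.mem_insert.2 (.inl h.symm))

theorem addEdge_comm {c d : N} (ha : a ∈ A) (hb : b ∈ B) (hc : c ∈ A) (hd : d ∈ B)
    (hf : Ty f A B) :
    addEdge A B a b (addEdge A B c d f) = addEdge A B c d (addEdge A B a b f) := by
  obtain ⟨x, y, hx, hy, hxy⟩ := exists_fresh_pair (A ∪ B)
  rw [Finset.mem_union, not_or] at hx hy
  rw [addEdge_addEdge ha hb hc hd hf hx.1 hx.2 hy.1 hy.2 hxy,
    addEdge_addEdge hc hd ha hb hf hy.1 hy.2 hx.1 hx.2 hxy.symm, fork_comm ha hc hx.1 hy.1,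
    join_comm hb hd hx.2 hy.2, mul_right_comm]

/-- A doubled edge is a single extra wire that is split and merged again beside `f`, and `μ̂;μ` is
the identity. -/
theorem addEdge_self (ha : a ∈ A) (hb : b ∈ B) (hf : Ty f A B) :
    addEdge A B a b (addEdge A B a b f) = addEdge A B a b f := by
  obtain ⟨x, y, hx, hy, hxy⟩ := exists_fresh_pair (A ∪ B)
  rw [Finset.mem_union, not_or] at hx hy
  have h1 : Disjoint A ({x} ∪ {y}) := by simp [hx.1, hy.1]
  have h2 : Disjoint B ({x} ∪ {y}) := by simp [hx.2, hy.2]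
  have mid : (I _ A * muHat _ x x y) ⨾ (f * I _ {y} * I _ {x}) ⨾ (I _ B * mu _ x y x) =
      f * I _ {x} := by
    rw [mul_assoc, mul_comm (I _ {y}), ← I_union (by simpa using hxy),
      mul_comp_mul (ty_I A) hf (ty_muHat _ _ _ _) (ty_I _) h1, hf.id_comp,
      (ty_muHat _ _ _ _).comp_id, mul_comp_mul hf (ty_I B) (ty_muHat _ _ _ _) (ty_mu _ _ _ _) h2,
      hf.comp_id, muHat_mu (Set.mem_univ _) (Set.mem_univ _) hxy, ren_self]
  rw [addEdge_addEdge ha hb ha hb hf hx.1 hx.2 hy.1 hy.2 hxy, fork_fork_self ha hx.1,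
    join_join_self hb hx.2, addEdge_eq ha hb hf hx.1 hx.2, ← mid]
  simp only [comp_assoc]

end CX

end RelationForms

/-! ### Normal forms of relations and their passage through generators. -/

section RelationLayers

open PX

namespace CX

variable {N : Type u} [DecidableEq N]

/-- The arrow that creates all elements of `B`. -/
noncomputable def spawn (B : Finset N) : CX N 𝒰 := ∏ b ∈ B, eta _ b

theorem ty_spawn (B : Finset N) : Ty (spawn B) ∅ B := by
  refine (ty_prod B _ _ _ fun b _ => ty_eta _ b).cast ?_ Finset.biUnion_singleton_eq_self
  ext x; simp

theorem spawn_union {A B : Finset N} (h : Disjoint A B) : spawn (A ∪ B) = spawn A * spawn B :=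
  Finset.prod_union h

theorem spawn_singleton (b : N) : spawn {b} = eta _ b := Finset.prod_singleton _ _

theorem join_union_right {D G : Finset N} {b : N} (h : Disjoint D G) (hb : b ∈ G) (x : N) :
    join (D ∪ G) x b = I _ D * join G x b := by
  rw [Finset.union_comm, join_union hb h.symm, mul_comm]

variable [Infinite N]

/-- The normal form of the relation with the given list of pairs. -/
noncomputable def edges (A B : Finset N) (l : List (N × N)) : CX N 𝒰 :=
  l.foldr (fun p f => addEdge A B p.1 p.2 f) (discard _ A * spawn B)

variable {A B B' : Finset N} {a b : N} {f g : CX N 𝒰}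

theorem edges_cons (A B : Finset N) (p : N × N) (l : List (N × N)) :
    edges A B (p :: l) = addEdge A B p.1 p.2 (edges A B l) := rfl

theorem ty_edges {l : List (N × N)} (hl : ∀ p ∈ l, p.1 ∈ A ∧ p.2 ∈ B) : Ty (edges A B l) A B := by
  induction l with
  | nil => exact ((ty_discard A).mul (ty_spawn B)).cast (Finset.union_empty _) (Finset.empty_union _)
  | cons p l ih =>
    rw [List.forall_mem_cons] at hl
    exact ty_addEdge hl.1.1 hl.1.2 (ih hl.2)

/-- The edge commutes inward until it meets its twin, which absorbs it. -/
theorem addEdge_edges_of_mem {p : N × N} {l : List (N × N)} (hp : p ∈ l)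
    (hl : ∀ p ∈ l, p.1 ∈ A ∧ p.2 ∈ B) : addEdge A B p.1 p.2 (edges A B l) = edges A B l := by
  induction l with
  | nil => exact absurd hp (List.not_mem_nil)
  | cons q l ih =>
    have hp' := hl p hp
    rw [List.forall_mem_cons] at hl
    have ht := ty_edges hl.2
    rcases List.mem_cons.1 hp with rfl | hp
    · rw [edges_cons, addEdge_self hl.1.1 hl.1.2 ht]
    · rw [edges_cons, addEdge_comm hp'.1 hp'.2 hl.1.1 hl.1.2 ht, ih hp hl.2]

theorem edges_append_of_subset {l l' : List (N × N)} (h : l ⊆ l')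
    (hl : ∀ p ∈ l', p.1 ∈ A ∧ p.2 ∈ B) : edges A B (l ++ l') = edges A B l' := by
  induction l with
  | nil => rfl
  | cons p l ih =>
    rw [List.cons_subset] at h
    rw [List.cons_append, edges_cons, ih h.2, addEdge_edges_of_mem h.1 hl]

theorem edges_perm {l l' : List (N × N)} (h : l.Perm l') (hl : ∀ p ∈ l, p.1 ∈ A ∧ p.2 ∈ B) :
    edges A B l = edges A B l' := by
  induction h with
  | nil => rfl
  | cons p _ ih =>
    rw [List.forall_mem_cons] at hl
    rw [edges_cons, ih hl.2, edges_cons]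
  | swap p q l =>
    simp only [List.forall_mem_cons] at hl
    exact addEdge_comm hl.1.1 hl.1.2 hl.2.1.1 hl.2.1.2 (ty_edges hl.2.2)
  | trans h _ ih ih' => exact (ih hl).trans (ih' fun p hp => hl p (h.mem_iff.2 hp))

/-- Up to order, both lists have the normal form of `l ++ l'`, because edges that occur again
further on are absorbed. -/
theorem edges_congr {l l' : List (N × N)} (h : ∀ p, p ∈ l ↔ p ∈ l')
    (hl : ∀ p ∈ l, p.1 ∈ A ∧ p.2 ∈ B) : edges A B l = edges A B l' := by
  have hl' : ∀ p ∈ l', p.1 ∈ A ∧ p.2 ∈ B := fun p hp => hl p ((h p).2 hp)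
  rw [← edges_append_of_subset (fun p hp => (h p).1 hp) hl',
    edges_perm List.perm_append_comm, edges_append_of_subset (fun p hp => (h p).2 hp) hl]
  exact fun p hp => (List.mem_append.1 hp).elim (hl p) (hl' p)

theorem addEdge_comp_one (ha : a ∈ A) (hb : b ∈ B) {d : N} (hd : d ∈ B') (hf : Ty f A B)
    (hg : Ty g B B')
    (h : ∀ x, x ∉ B → x ∉ B' → join B x b ⨾ g = (g * I _ {x}) ⨾ join B' x d) :
    addEdge A B a b f ⨾ g = addEdge A B' a d (f ⨾ g) := by
  obtain ⟨x, hx⟩ := Infinite.exists_notMem_finset (A ∪ B ∪ B')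
  simp only [Finset.mem_union, not_or] at hx
  rw [addEdge_eq ha hb hf hx.1.1 hx.1.2, addEdge_eq ha hd (hf.comp hg) hx.1.1 hx.2, comp_assoc,
    h x hx.1.2 hx.2, ← comp_mul_id hf hg (by simpa using hx.1.2)]
  simp only [comp_assoc]

/-- The extra wire ends up discarded, and a copy that is discarded leaves no trace by the counit
law. -/
theorem addEdge_comp_zero (ha : a ∈ A) (hb : b ∈ B) (hf : Ty f A B) (hg : Ty g B B')
    (h : ∀ x, x ∉ B → join B x b ⨾ g = g * etaHat _ x) :
    addEdge A B a b f ⨾ g = f ⨾ g := by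
  obtain ⟨x, hx⟩ := Infinite.exists_notMem_finset (A ∪ B)
  rw [Finset.mem_union, not_or] at hx
  have ht := ty_etaHat 𝒰 x
  rw [addEdge_eq ha hb hf hx.1 hx.2, comp_assoc, h x hx.2, comp_assoc,
    mul_comp_mul hf hg (ty_I _) ht (by simpa using hx.2), ht.id_comp,
    mul_eq_comp' (hf.comp hg) ht (Finset.disjoint_empty_right _), ← comp_assoc,
    fork_etaHat ha hx.1, I_empty, mul_one, (hf.comp hg).id_comp]

/-- The extra wire is split and its halves are joined behind `g`. Splitting a copy of `a` amounts to
copying `a` twice, which gives two edges. -/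
theorem addEdge_comp_two (ha : a ∈ A) (hb : b ∈ B) {c d : N} (hc : c ∈ B') (hd : d ∈ B')
    (hf : Ty f A B) (hg : Ty g B B')
    (h : ∀ x y, x ∉ B → x ∉ B' → y ∉ B → y ∉ B' → x ≠ y →
      join B x b ⨾ g = (g * muHat _ x x y) ⨾ ((join B' y d * I _ {x}) ⨾ join B' x c)) :
    addEdge A B a b f ⨾ g = addEdge A B' a c (addEdge A B' a d (f ⨾ g)) := by
  obtain ⟨x, y, hx, hy, hxy⟩ := exists_fresh_pair (A ∪ B ∪ B')
  simp only [Finset.mem_union, not_or] at hx hy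
  have hm := ty_muHat 𝒰 x x y
  have h1 : Disjoint A ({x} ∪ {y}) := by simp [hx.1.1, hy.1.1]
  rw [addEdge_eq ha hb hf hx.1.1 hx.1.2, comp_assoc, h x y hx.1.2 hx.2 hy.1.2 hy.2 hxy,
    addEdge_addEdge ha hc ha hd (hf.comp hg) hx.1.1 hx.2 hy.1.1 hy.2 hxy,
    fork_fork_self ha hx.1.1, ← comp_assoc _ (g * _), comp_assoc _ _ (g * _),
    mul_comp_mul hf hg (ty_I _) hm (by simpa using hx.1.2), hm.id_comp, mul_assoc _ (I _ {y}),
    mul_comm (I _ {y}), ← I_union (by simpa using hxy), comp_assoc (fork A a x) (I _ A * _),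
    mul_comp_mul (ty_I A) (hf.comp hg) hm (ty_I _) h1, (hf.comp hg).id_comp, hm.comp_id]

/-- Edges to `b` can be moved past `g`, in parallel with identities. -/
def Passes (G H : Finset N) (g : CX N 𝒰) (b : N) : Prop :=
  ∃ l : List N, (∀ c ∈ l, c ∈ H) ∧ ∀ (A D : Finset N) (a : N) (f : CX N 𝒰), a ∈ A →
    Disjoint D G → Disjoint D H → Ty f A (D ∪ G) →
    addEdge A (D ∪ G) a b f ⨾ (I _ D * g) =
      l.foldr (fun c f => addEdge A (D ∪ H) a c f) (f ⨾ (I _ D * g))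

/-- A join at a wire in `G` does not touch the bystanders `D`, so a law for `g` alone suffices. -/
theorem passes_one {G H : Finset N} {g : CX N 𝒰} {b d : N} (hb : b ∈ G) (hd : d ∈ H)
    (hg : Ty g G H)
    (h : ∀ x, x ∉ G → x ∉ H → join G x b ⨾ g = (g * I _ {x}) ⨾ join H x d) :
    Passes G H g b := by
  refine ⟨[d], by simpa using hd, fun A D a f ha hG hH hf => ?_⟩
  refine addEdge_comp_one ha (Finset.mem_union_right _ hb) (Finset.mem_union_right _ hd) hf
    ((ty_I D).mul hg) fun x hx hx' => ?_
  rw [Finset.mem_union, not_or] at hx hx'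
  rw [join_union_right hG hb, join_union_right hH hd, id_mul_comp (ty_join hb x) hg hG,
    h x hx.2 hx'.2, mul_assoc, id_mul_comp (hg.mul (ty_I _)) (ty_join hd x)]
  simpa [Finset.disjoint_union_right, hx.1] using hH

theorem passes_zero {G : Finset N} {g : CX N 𝒰} {b : N} (hb : b ∈ G) (hg : Ty g G ∅)
    (h : ∀ x, x ∉ G → join G x b ⨾ g = g * etaHat _ x) : Passes G ∅ g b := by
  refine ⟨[], by simp, fun A D a f ha hG hH hf => ?_⟩
  refine addEdge_comp_zero ha (Finset.mem_union_right _ hb) hf ((ty_I D).mul hg) fun x hx => ?_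
  rw [Finset.mem_union, not_or] at hx
  rw [join_union_right hG hb, id_mul_comp (ty_join hb x) hg hG, h x hx.2, mul_assoc]

theorem passes_two {G H : Finset N} {g : CX N 𝒰} {b c d : N} (hb : b ∈ G) (hc : c ∈ H)
    (hd : d ∈ H) (hg : Ty g G H)
    (h : ∀ x y, x ∉ G → x ∉ H → y ∉ G → y ∉ H → x ≠ y →
      join G x b ⨾ g = (g * muHat _ x x y) ⨾ ((join H y d * I _ {x}) ⨾ join H x c)) :
    Passes G H g b := by
  refine ⟨[c, d], by simp [hc, hd], fun A D a f ha hG hH hf => ?_⟩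
  refine addEdge_comp_two ha (Finset.mem_union_right _ hb) (Finset.mem_union_right _ hc)
    (Finset.mem_union_right _ hd) hf ((ty_I D).mul hg) fun x y hx hx' hy hy' hxy => ?_
  rw [Finset.mem_union, not_or] at hx hx' hy hy'
  have h1 : Disjoint D (H ∪ {x}) := by simpa [Finset.disjoint_union_right, hx.1] using hH
  have h2 : Disjoint D (H ∪ ({x} ∪ {y})) := by
    simpa [Finset.disjoint_union_right, hx.1, hy.1] using hH
  have t1 := (ty_join hd y).mul (ty_I (C := (calculus N 𝒰).category) {x})
  rw [join_union_right hG hb, join_union_right hH hc, join_union_right hH hd,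
    id_mul_comp (ty_join hb x) hg hG, h x y hx.2 hx'.2 hy.2 hy'.2 hxy, mul_assoc, mul_assoc,
    id_mul_comp t1 (ty_join hc x) h1,
    id_mul_comp (hg.mul (ty_muHat _ x x y)) ((t1.comp (ty_join hc x)).cast ?_ rfl) h2]
  rw [Finset.union_assoc, Finset.union_comm {y}]

/-- An arrow from `A` to `B` in the normal form of relations. -/
def IsEdges (A B : Finset N) (f : CX N 𝒰) : Prop :=
  ∃ l : List (N × N), (∀ p ∈ l, p.1 ∈ A ∧ p.2 ∈ B) ∧ f = edges A B l

/-- Edges are moved behind `g` one by one: those ending in `D` unchanged, those ending in `G` by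
`h`. What is left in front of `g` is the empty relation, which `h0` carries across. -/
theorem step_isEdges {A G H : Finset N} {g : CX N 𝒰} (hg : Ty g G H)
    (h0 : spawn G ⨾ g = spawn H) (h : ∀ b ∈ G, Passes G H g b) :
    Theory.Step (IsEdges A) G H g := by
  rintro D f hG hH ⟨l, hl, rfl⟩
  induction l with
  | nil =>
    refine ⟨[], by simp, ?_⟩
    have := mul_comp_mul (ty_discard (K := 𝒰) A) ty_one (ty_spawn (D ∪ G)) ((ty_I D).mul hg)
      (Finset.disjoint_empty_left _)
    rw [one_mul] at this
    rw [edges, List.foldr_nil, this, ← I_empty, (ty_discard A).comp_id, spawn_union hG,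
      mul_comp_mul (ty_spawn D) (ty_I D) (ty_spawn G) hg hG, (ty_spawn D).comp_id, h0, edges,
      List.foldr_nil, spawn_union hH]
  | cons p l ih =>
    obtain ⟨a, b⟩ := p
    rw [List.forall_mem_cons] at hl
    obtain ⟨l', hl', e⟩ := ih hl.2
    have ht := ty_edges hl.2
    rcases Finset.mem_union.1 hl.1.2 with hb | hb
    · have hb' := Finset.mem_union_left H hb
      refine ⟨(a, b) :: l', List.forall_mem_cons.2 ⟨⟨hl.1.1, hb'⟩, hl'⟩, ?_⟩
      rw [edges_cons, edges_cons, ← e]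
      refine addEdge_comp_one hl.1.1 hl.1.2 hb' ht ((ty_I D).mul hg) fun x hx hx' => ?_
      rw [Finset.mem_union, not_or] at hx hx'
      rw [join_union hb hG, join_union hb hH,
        mul_comp_mul (ty_join hb x) (ty_I D) (ty_I G) hg hG, (ty_join hb x).comp_id, hg.id_comp,
        mul_right_comm, mul_comp_mul ((ty_I D).mul (ty_I _)) (ty_join hb x) hg (ty_I H),
        hg.comp_id, ← I_union (by simpa using hx.1), (ty_join hb x).id_comp]
      simpa [Finset.disjoint_union_left, hx'.2] using hH
    · obtain ⟨l'', h1, h2⟩ := h b hb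
      have key (l'' : List N) (h1 : ∀ c ∈ l'', c ∈ H) : IsEdges A (D ∪ H)
          (l''.foldr (fun c f => addEdge A (D ∪ H) a c f) (edges A (D ∪ H) l')) := by
        induction l'' with
        | nil => exact ⟨l', hl', rfl⟩
        | cons c l'' ih =>
          rw [List.forall_mem_cons] at h1
          obtain ⟨k, hk, e⟩ := ih h1.2
          exact ⟨(a, c) :: k, List.forall_mem_cons.2
            ⟨⟨hl.1.1, Finset.mem_union_right _ h1.1⟩, hk⟩, by rw [List.foldr_cons, e]; rfl⟩
      rw [edges_cons, h2 A D a _ hl.1.1 hG hH ht, e]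
      exact key l'' h1

theorem isEdges_ren (A : Finset N) (a b : N) : Theory.Step (IsEdges A) {a} {b} (PX.ren _ a b) := by
  refine step_isEdges (ty_ren a b) ?_ fun c hc => ?_
  · rw [spawn_singleton, spawn_singleton, eta_ren]
  · obtain rfl := Finset.mem_singleton.1 hc
    refine passes_one hc (Finset.mem_singleton_self b) (ty_ren _ _) fun x hx hx' => ?_
    rw [Finset.mem_singleton] at hx hx'
    rw [join_singleton, join_singleton, mu_ren, mul_comm, ren_mu_right hx']

/-- Associativity: a wire merged into an input of `μ` may be merged into its output instead. -/
theorem passes_mu {a b : N} (hab : a ≠ b) (c : N) :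
    Passes ({a} ∪ {b}) {c} (mu _ a b c) a := by
  refine passes_one (d := c) (by simp) (by simp) (ty_mu _ _ _ _) fun x hx hx' => ?_
  rw [Finset.mem_singleton] at hx'
  rw [join_union (Finset.mem_singleton_self a) (Finset.disjoint_singleton.2 hab), join_singleton,
    join_singleton, mu_assoc hab hx', mul_comm]

/-- Creating all inputs of a generator creates exactly its outputs, by its laws with `η`. Its laws
with `μ` say how an edge passes: one edge after `μ`, none after `η̂`, and after `μ̂` one to each
output, by the bialgebra law. -/
theorem isEdges_gen (A : Finset N) (γ : CGen N 𝒰) :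
    Theory.Step (IsEdges A) γ.dom γ.cod (gen γ) := by
  have u (k : Kind) : k ∈ 𝒰 := Set.mem_univ k
  refine step_isEdges (ty_gen γ) ?_ ?_
  · cases γ with
    | eta h a =>
      rw [← ev_gen, ← eta_def h, CGen.dom, CGen.cod, spawn_singleton, spawn, Finset.prod_empty,
        ← I_empty, (ty_eta _ a).id_comp]
    | mu h a b c hab =>
      rw [← ev_gen, ← mu_def h hab, CGen.dom, CGen.cod, spawn_singleton, spawn,
        Finset.prod_pair hab,
        mul_eq_comp' (ty_eta _ a) (ty_eta _ b) (Finset.disjoint_empty_left _), comp_assoc,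
        eta_mu (u _) (u _) hab, I_empty, one_mul, eta_ren]
    | etaHat h a =>
      rw [← ev_gen, ← etaHat_def h, CGen.dom, CGen.cod, spawn_singleton,
        eta_etaHat (u _) (u _), spawn, Finset.prod_empty]
    | muHat h a b c hbc =>
      rw [← ev_gen, ← muHat_def h a hbc, CGen.dom, CGen.cod, spawn_singleton,
        eta_muHat (u _) hbc, spawn, Finset.prod_pair hbc]
  · intro d hd
    cases γ with
    | eta h a => exact absurd hd (Finset.notMem_empty d)
    | mu h a b c hab =>
      rw [← ev_gen, ← mu_def h hab, CGen.dom, CGen.cod, Finset.insert_eq]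
      rcases Finset.mem_insert.1 hd with rfl | hd
      · exact passes_mu hab c
      · obtain rfl := Finset.mem_singleton.1 hd
        rw [mu_comm, Finset.union_comm]
        exact passes_mu hab.symm c
    | etaHat h a =>
      obtain rfl := Finset.mem_singleton.1 hd
      rw [← ev_gen, ← etaHat_def h, CGen.dom, CGen.cod]
      refine passes_zero hd (ty_etaHat _ _) fun x hx => ?_
      rw [Finset.mem_singleton] at hx
      rw [join_singleton, mu_etaHat (u _) hx, mul_comm]
    | muHat h a b c hbc =>
      obtain rfl := Finset.mem_singleton.1 hd
      rw [← ev_gen, ← muHat_def h d hbc, CGen.dom, CGen.cod, Finset.insert_eq]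
      refine passes_two (c := b) (d := c) (Finset.mem_singleton_self _) (by simp) (by simp)
        (ty_muHat _ _ _ _) fun x y hx hx' hy hy' hxy => ?_
      simp only [Finset.mem_union, Finset.mem_singleton, not_or] at hx hx' hy hy'
      rw [join_join_ne (by simp) (by simp) hbc (by simpa using hx'), join_singleton,
        mu_muHat (u _) (u _) hx hbc hxy hbc hx'.1 hy'.2 hx'.2 hy'.1]
      have he : (({b} ∪ {c} : Finset N).erase b).erase c = ∅ := by
        ext z; simp; tauto
      rw [he, I_empty, mul_one, mul_comm (muHat _ x x y)]

theorem addEdge_mul {c d : N} (ha : a ∈ A) (hb : b ∈ B) (hf : Ty f A B) (hg : Ty g {c} {d})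
    (hc : c ∉ A) (hd : d ∉ B) :
    addEdge A B a b f * g = addEdge (A ∪ {c}) (B ∪ {d}) a b (f * g) := by
  obtain ⟨x, hx⟩ := Infinite.exists_notMem_finset (A ∪ B ∪ {c} ∪ {d})
  simp only [Finset.mem_union, Finset.mem_singleton, not_or] at hx
  obtain ⟨⟨⟨hxA, hxB⟩, hxc⟩, hxd⟩ := hx
  rw [addEdge_eq ha hb hf hxA hxB, addEdge_eq (Finset.mem_union_left _ ha)
    (Finset.mem_union_left _ hb) (hf.mul hg) (x := x) (by simp [hxA, hxc])
    (by simp [hxB, hxd]),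
    fork_union ha (by simpa using hc), join_union hb (by simpa using hd), mul_right_comm f,
    mul_comp_mul (ty_fork ha x) (hf.mul (ty_I _)) (ty_I _) hg (by simpa [hc] using Ne.symm hxc),
    mul_comp_mul ((ty_fork ha x).comp (hf.mul (ty_I _))) (ty_join hb x) ((ty_I _).comp hg)
      (ty_I _) (by simpa [hd] using Ne.symm hxd), hg.id_comp, hg.comp_id]

/-- An input and an output named `c` with no edges are adjoined; together with `addEdge_etaHat_eta`
this builds the identity wire by wire. -/
theorem edges_mul {c : N} (hA : c ∉ A) (hB : c ∉ B) {l : List (N × N)}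
    (hl : ∀ p ∈ l, p.1 ∈ A ∧ p.2 ∈ B) :
    edges A B l * (etaHat _ c * eta _ c) = edges (A ∪ {c}) (B ∪ {c}) l := by
  induction l with
  | nil =>
    rw [edges, edges, List.foldr_nil, List.foldr_nil, discard_union (by simpa using hA),
      spawn_union (by simpa using hB), discard_singleton, spawn_singleton, mul_mul_mul_comm]
  | cons p l ih =>
    rw [List.forall_mem_cons] at hl
    have ht := ((ty_etaHat 𝒰 c).mul (ty_eta 𝒰 c)).cast (Finset.union_empty _)
      (Finset.empty_union _)
    rw [edges_cons, edges_cons, addEdge_mul hl.1.1 hl.1.2 (ty_edges hl.2) ht hA hB, ih hl.2]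

/-- The copy of `c` survives the discarding of `c` by the counit law and fills the newly created
output `c` by the unit law. -/
theorem addEdge_etaHat_eta {c : N} (hA : c ∉ A) (hB : c ∉ B) (hf : Ty f A B) :
    addEdge (A ∪ {c}) (B ∪ {c}) c c (f * (etaHat _ c * eta _ c)) = f * I _ {c} := by
  obtain ⟨x, hx⟩ := Infinite.exists_notMem_finset (A ∪ B ∪ {c})
  simp only [Finset.mem_union, Finset.mem_singleton, not_or] at hx
  obtain ⟨⟨hxA, hxB⟩, hxc⟩ := hx
  have hc : c ∈ ({c} : Finset N) := Finset.mem_singleton_self c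
  have ht := ((ty_etaHat 𝒰 c).mul (ty_eta 𝒰 c)).cast (Finset.union_empty _)
    (Finset.empty_union _)
  have u (k : Kind) : k ∈ 𝒰 := Set.mem_univ k
  have h1 : muHat 𝒰 c c x ⨾ (etaHat _ c * eta _ c * I _ {x}) ⨾ mu 𝒰 x c c = I _ {c} := by
    rw [mul_right_comm, mul_eq_comp ((ty_etaHat 𝒰 c).mul (ty_I {x})) (ty_eta 𝒰 c)
      (Finset.disjoint_empty_right _), I_empty, mul_one, ← comp_assoc,
      muHat_etaHat (u _) (u _) (Ne.symm hxc), Finset.empty_union, comp_assoc, mul_comm, mu_comm,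
      eta_mu (u _) (u _) (Ne.symm hxc), ren_comp_ren, ren_self]
  rw [addEdge_eq (by simp) (by simp) (hf.mul ht) (x := x) (by simp [hxA, hxc])
    (by simp [hxB, hxc]),
    join_union_right (by simpa using hB) hc, Finset.union_comm A,
    fork_union hc (by simpa using hA), mul_comm (fork _ _ _), mul_assoc f,
    mul_comp_mul (ty_I A) hf (ty_fork hc x) (ht.mul (ty_I _)) (by simp [hA, hxA]), hf.id_comp,
    mul_comp_mul hf (ty_I B) ((ty_fork hc x).comp (ht.mul (ty_I _))) (ty_join hc x)
      (by simp [hB, hxB]), hf.comp_id, fork_singleton, join_singleton, h1]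

theorem isEdges_id (A : Finset N) : IsEdges A A (I _ A) := by
  induction A using Finset.induction_on with
  | empty => exact ⟨[], by simp, (mul_one (1 : CX N 𝒰)).symm⟩
  | insert c A hc ih =>
    obtain ⟨l, hl, e⟩ := ih
    refine ⟨(c, c) :: l, ?_, ?_⟩
    · rw [List.forall_mem_cons]
      exact ⟨by simp, fun p hp => (hl p hp).imp (Finset.mem_insert_of_mem ·)
        (Finset.mem_insert_of_mem ·)⟩
    · rw [I_insert hc, e, Finset.insert_eq, Finset.union_comm, edges_cons, ← edges_mul hc hc hl,
        addEdge_etaHat_eta hc hc (ty_edges hl), mul_comm]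

/-- Every arrow of the calculus of relations is in normal form. -/
theorem exists_edges [Countable N] (f : (calculus N 𝒰).category.Arrow) :
    IsEdges ((calculus N 𝒰).category.dom f) ((calculus N 𝒰).category.cod f) (PX.of f) :=
  Theory.induction_layers (Φ := IsEdges ((calculus N 𝒰).category.dom f))
    (fun _ _ ⟨_, hl, e⟩ => ⟨_, e ▸ ty_edges hl⟩) (isEdges_ren _) (isEdges_gen _) f (isEdges_id _)

end CX

end RelationLayers

/-! ### Soundness, and completeness by reading normal forms off the relation. -/

section Denotation

variable {N : Type u} [DecidableEq N] {K : Set Kind}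

namespace RelArrow

theorem smul_full (π : FinPerm N) (A B : Finset N) : π • full A B = full (π • A) (π • B) :=
  ext_of_iff rfl rfl fun a b => by
    simp only [smul_rel, full, Finset.inv_smul_mem_iff]

end RelArrow

open RelArrow

/-- The relation denoted by a term. -/
def den : Term N (CGen N K) → RelArrow N
  | .gen γ => γ.meaning
  | .idt A => RelArrow.id A
  | .ren a b => full {a} {b}
  | .tensor t s => (den t).union (den s)
  | .comp t s => (den t).comp (den s)
  | .perm π t => π • den t

theorem dom_den (t : Term N (CGen N K)) : (den t).dom = (calculus N K).tdom t := by
  induction t with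
  | gen γ => rfl
  | idt A => rfl
  | ren a b => rfl
  | tensor t s iht ihs => exact congrArg₂ (· ∪ ·) iht ihs
  | comp t s iht ihs => exact iht
  | perm π t iht => exact congrArg (π • ·) iht

theorem cod_den (t : Term N (CGen N K)) : (den t).cod = (calculus N K).tcod t := by
  induction t with
  | gen γ => rfl
  | idt A => rfl
  | ren a b => rfl
  | tensor t s iht ihs => exact congrArg₂ (· ∪ ·) iht ihs
  | comp t s iht ihs => exact ihs
  | perm π t iht => exact congrArg (π • ·) iht

theorem cod_den_eq_dom_den {t s : Term N (CGen N K)}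
    (h : (calculus N K).tcod t = (calculus N K).tdom s) : (den t).cod = (den s).dom :=
  (cod_den t).trans (Eq.trans h (dom_den s).symm)

theorem disjoint_dom_den {t s : Term N (CGen N K)}
    (h : Disjoint ((calculus N K).tdom t) ((calculus N K).tdom s)) :
    Disjoint (den t).dom (den s).dom := by
  rw [dom_den, dom_den]; exact h

theorem disjoint_cod_den {t s : Term N (CGen N K)}
    (h : Disjoint ((calculus N K).tcod t) ((calculus N K).tcod s)) :
    Disjoint (den t).cod (den s).cod := by
  rw [cod_den, cod_den]; exact h

theorem den_eq_of_rel {t s : Term N (CGen N K)}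
    (h : (calculus N K).tdom t = (calculus N K).tdom s ∧
      (calculus N K).tcod t = (calculus N K).tcod s)
    (h' : ∀ u v, (den t).rel u v ↔ (den s).rel u v) : den t = den s :=
  ext_of_iff (by rw [dom_den, dom_den, h.1]) (by rw [cod_den, cod_den, h.2]) h'

theorem den_eq_of_cEq {t s : Term N (CGen N K)} (h : CEq K t s) : den t = den s := by
  refine den_eq_of_rel h.typed.2.2 fun u v => ?_
  cases h <;>
    simp [den, CGen.meaning, RelArrow.comp, RelArrow.union, RelArrow.id, full, CGen.dom,
      CGen.cod, and_or_left, or_and_right, exists_or, and_assoc] <;>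
    grind

/-- The renaming laws of generators hold because a permuted full relation is again full, between the
permuted sets. -/
theorem den_eq_of_basicEq {t s : Term N (calculus N K).Gen}
    (h : Theory.BasicEq (calculus N K) t s) (ht : (calculus N K).WT t)
    (hs : (calculus N K).WT s) : den (K := K) t = den (K := K) s := by
  have hty := h.typed ht hs
  cases h with
  | eqn t s h => exact den_eq_of_cEq h
  | id_comp t =>
    exact (congrArg (fun A => (RelArrow.id A).comp (den s)) (dom_den s).symm).trans
      ((nRel N).id_comp (den s) rfl)
  | comp_id t =>
    exact (congrArg (fun A => (den s).comp (RelArrow.id A)) (cod_den s).symm).trans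
      ((nRel N).comp_id (den s) rfl)
  | comp_assoc t s r =>
    refine den_eq_of_rel hty fun u v => ?_
    simp only [den, RelArrow.comp]
    grind
  | empty_tensor t =>
    refine den_eq_of_rel hty fun u v => ?_
    simp [den, RelArrow.union, RelArrow.id]
  | tensor_empty t =>
    refine den_eq_of_rel hty fun u v => ?_
    simp [den, RelArrow.union, RelArrow.id]
  | tensor_assoc t s r =>
    refine den_eq_of_rel hty fun u v => ?_
    simp only [den, RelArrow.union, or_assoc]
  | tensor_comm t s =>
    refine den_eq_of_rel hty fun u v => ?_
    simp only [den, RelArrow.union, or_comm]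
  | interchange s t p q =>
    obtain ⟨⟨-, -, h1⟩, ⟨-, -, h2⟩, h3, h4⟩ := ht
    obtain ⟨⟨-, -, h5, h6⟩, ⟨-, -, h7, h8⟩, h9⟩ := hs
    exact (nRel N).interchange (den s) (den t) (den p) (den q) (cod_den_eq_dom_den h1)
      (cod_den_eq_dom_den h2) (disjoint_dom_den (t := .comp s t) (s := .comp p q) h3)
      (disjoint_cod_den (t := .comp s t) (s := .comp p q) h4)
      (disjoint_dom_den h5) (disjoint_cod_den h6) (disjoint_dom_den h7) (disjoint_cod_den h8)
      (cod_den_eq_dom_den (t := .tensor s p) (s := .tensor t q) h9)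
  | tensor_id A B =>
    refine den_eq_of_rel hty fun u v => ?_
    simp only [den, RelArrow.union, RelArrow.id, Finset.mem_union, and_or_left]
  | perm_one t => exact one_smul _ _
  | perm_mul π σ t => exact mul_smul _ _ _
  | perm_id π A => exact (nRel N).smul_id π A
  | perm_ren π a b => exact (nRel N).smul_δ π a b
  | perm_gen π γ =>
    refine (smul_full _ _ _).trans ?_
    exact congrArg₂ full ((calculus N K).dom_smul π γ).symm ((calculus N K).cod_smul π γ).symm
  | perm_tensor π t s =>
    refine den_eq_of_rel hty fun u v => ?_
    simp only [den, RelArrow.union, smul_rel]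
  | perm_comp π t s =>
    exact (nRel N).smul_comp π (den t) (den s) (cod_den_eq_dom_den ht.2.2)
      (cod_den_eq_dom_den (t := .perm π t) (s := .perm π s) hs.2.2)
  | ren_self a =>
    refine den_eq_of_rel hty fun u v => ?_
    simp only [den, RelArrow.id, full, Finset.mem_singleton]
    grind
  | ren_comp_ren a b c =>
    refine den_eq_of_rel hty fun u v => ?_
    simp only [den, RelArrow.comp, full, Finset.mem_singleton]
    grind
  | gen_out γ B b x h hb hx =>
    refine den_eq_of_rel hty fun u v => ?_
    obtain ⟨hd, hc⟩ := hty
    -- Agreement of the types of both sides identifies the permuted domain and codomain, so that no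
    -- permutation has to be computed pointwise.
    simp only [Signature.tdom, Signature.tcod] at hd hc
    replace h : CGen.cod γ = B ∪ {b} := h
    replace hd : CGen.dom γ = tr b x • CGen.dom γ := hd
    replace hc : B ∪ {x} = tr b x • CGen.cod γ := hc
    simp only [den, CGen.meaning, smul_full, ← hd, ← hc]
    simp only [full, RelArrow.comp, RelArrow.union, RelArrow.id, h, Finset.mem_union,
      Finset.mem_singleton]
    grind
  | gen_in γ A a x h ha hx =>
    refine den_eq_of_rel hty fun u v => ?_
    obtain ⟨hd, hc⟩ := hty
    simp only [Signature.tdom, Signature.tcod] at hd hc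
    replace h : CGen.dom γ = {a} ∪ A := h
    replace hd : {x} ∪ A = tr x a • CGen.dom γ := hd
    replace hc : CGen.cod γ = tr x a • CGen.cod γ := hc
    simp only [den, CGen.meaning, smul_full, ← hd, ← hc]
    simp only [full, RelArrow.comp, RelArrow.union, RelArrow.id, h, Finset.mem_union,
      Finset.mem_singleton]
    grind
  | gen_both γ A B c x h hA h' hB =>
    refine den_eq_of_rel hty fun u v => ?_
    obtain ⟨hd, hc⟩ := hty
    have hs' := hs.2.2
    simp only [Signature.tdom, Signature.tcod] at hd hc hs'
    replace h : CGen.dom γ = A ∪ {c} := h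
    replace h' : CGen.cod γ = B ∪ {c} := h'
    replace hs' : A ∪ {x} = tr c x • CGen.dom γ := hs'
    replace hc : B ∪ {x} = tr c x • CGen.cod γ := hc
    simp only [den, CGen.meaning, smul_full, ← hs', ← hc]
    simp only [full, RelArrow.comp, RelArrow.union, RelArrow.id, h, h', Finset.mem_union,
      Finset.mem_singleton]
    grind

theorem den_eq_of_eqv {t s : Term N (calculus N K).Gen} (h : Theory.Eqv (calculus N K) t s) :
    den (K := K) t = den (K := K) s := by
  induction h with
  | basic h ht hs => exact den_eq_of_basicEq h ht hs
  | refl h => rfl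
  | symm _ ih => exact ih.symm
  | trans _ _ ih ih' => exact ih.trans ih'
  | tensor _ _ _ ih ih' => exact congrArg₂ RelArrow.union ih ih'
  | comp _ _ _ ih ih' => exact congrArg₂ RelArrow.comp ih ih'
  | perm π _ ih => exact congrArg (π • ·) ih

/-- The relation denoted by an arrow. -/
def interp : (calculus N K).category.Arrow → RelArrow N :=
  Quotient.lift (fun t => den (K := K) t.1) fun _ _ h => den_eq_of_eqv h

theorem interp_mk (t : Term N (calculus N K).Gen) (h : (calculus N K).WT t) :
    interp (Theory.PArrow.mk t h) = den (K := K) t := rfl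

theorem dom_interp (f : (calculus N K).category.Arrow) :
    (interp f).dom = (calculus N K).category.dom f := by
  obtain ⟨t, h, rfl⟩ := Theory.PArrow.exists_rep f
  exact dom_den t

theorem cod_interp (f : (calculus N K).category.Arrow) :
    (interp f).cod = (calculus N K).category.cod f := by
  obtain ⟨t, h, rfl⟩ := Theory.PArrow.exists_rep f
  exact cod_den t

theorem interp_smul (π : FinPerm N) (f : (calculus N K).category.Arrow) :
    interp (π • f) = π • interp f := by
  obtain ⟨t, h, rfl⟩ := Theory.PArrow.exists_rep f
  rfl

theorem interp_id (A : Finset N) : interp ((calculus N K).category.id A) = RelArrow.id A := rfl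

theorem interp_δ (a b : N) : interp ((calculus N K).category.δ a b) = full {a} {b} := rfl

theorem interp_genArrow (γ : CGen N K) : interp ((calculus N K).genArrow γ) = γ.meaning := rfl

theorem interp_comp (f g : (calculus N K).category.Arrow) (h) :
    interp ((calculus N K).category.comp f g h) = (interp f).comp (interp g) := by
  obtain ⟨t, ht, rfl⟩ := Theory.PArrow.exists_rep f
  obtain ⟨s, hs, rfl⟩ := Theory.PArrow.exists_rep g
  exact congrArg interp (Theory.PArrow.comp_mk t s ht hs h)

theorem interp_tensor (f g : (calculus N K).category.Arrow) (h h') :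
    interp ((calculus N K).category.tensor f g h h') = (interp f).union (interp g) := by
  obtain ⟨t, ht, rfl⟩ := Theory.PArrow.exists_rep f
  obtain ⟨s, hs, rfl⟩ := Theory.PArrow.exists_rep g
  exact congrArg interp (Theory.PArrow.tensor_mk t s ht hs h h')

open PX

/-- If `f` is defined then it denotes the relation `r`. -/
def Sem (f : CX N K) (r : N → N → Prop) : Prop :=
  ∀ g, f = PX.of g → ∀ u v, (interp g).rel u v ↔ r u v

theorem sem_of (f : (calculus N K).category.Arrow) : Sem (PX.of f) (interp f).rel := by
  intro g h u v
  rw [of_injective h]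

theorem sem_zero (r : N → N → Prop) : Sem (0 : CX N K) r := fun _ h => absurd h.symm (of_ne_zero _)

theorem Sem.congr {f : CX N K} {r r' : N → N → Prop} (hf : Sem f r)
    (h : ∀ u v, r u v ↔ r' u v) : Sem f r' := fun g hg u v => (hf g hg u v).trans (h u v)

theorem sem_I (A : Finset N) : Sem (K := K) (I _ A) fun u v => u = v ∧ u ∈ A := sem_of _

theorem sem_one : Sem (1 : CX N K) fun _ _ => False :=
  (sem_I ∅).congr fun u v => by simp

theorem sem_ren (a b : N) : Sem (K := K) (ren _ a b) fun u v => u = a ∧ v = b :=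
  (sem_of _).congr fun u v => by simp [interp_δ, full]

theorem sem_gen (γ : CGen N K) : Sem (CX.gen γ) fun u v => u ∈ γ.dom ∧ v ∈ γ.cod := sem_of _

theorem Sem.mul {f g : CX N K} {r s : N → N → Prop} (hf : Sem f r) (hg : Sem g s) :
    Sem (f * g) fun u v => r u v ∨ s u v := by
  rcases eq_zero_or f with rfl | ⟨f, rfl⟩
  · rw [zero_mul]; exact sem_zero _
  rcases eq_zero_or g with rfl | ⟨g, rfl⟩
  · rw [mul_zero]; exact sem_zero _
  by_cases h : Disjoint ((calculus N K).category.dom f) ((calculus N K).category.dom g) ∧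
    Disjoint ((calculus N K).category.cod f) ((calculus N K).category.cod g)
  · rw [mul_of h.1 h.2]
    refine (sem_of _).congr fun u v => ?_
    rw [interp_tensor]
    exact or_congr (hf f rfl u v) (hg g rfl u v)
  · rw [mul_of_not h]; exact sem_zero _

theorem Sem.comp {f g : CX N K} {r s : N → N → Prop} (hf : Sem f r) (hg : Sem g s) :
    Sem (f ⨾ g) fun u v => ∃ w, r u w ∧ s w v := by
  rcases eq_zero_or f with rfl | ⟨f, rfl⟩
  · exact sem_zero _
  rcases eq_zero_or g with rfl | ⟨g, rfl⟩
  · rw [comp_zero]; exact sem_zero _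
  by_cases h : (calculus N K).category.cod f = (calculus N K).category.dom g
  · rw [comp_of h]
    refine (sem_of _).congr fun u v => ?_
    rw [interp_comp]
    exact exists_congr fun w => and_congr (hf f rfl u w) (hg g rfl w v)
  · rw [comp_of_not h]; exact sem_zero _

theorem sem_eta (a : N) : Sem (CX.eta K a) fun _ _ => False := by
  unfold CX.eta; split_ifs
  · exact (sem_gen _).congr fun u v => by simp [CGen.dom]
  · exact sem_zero _

theorem sem_mu (a b c : N) : Sem (CX.mu K a b c) fun u v => (u = a ∨ u = b) ∧ v = c := by
  unfold CX.mu; split_ifs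
  · exact (sem_gen _).congr fun u v => by simp [CGen.dom, CGen.cod]
  · exact sem_zero _

theorem sem_etaHat (a : N) : Sem (CX.etaHat K a) fun _ _ => False := by
  unfold CX.etaHat; split_ifs
  · exact (sem_gen _).congr fun u v => by simp [CGen.cod]
  · exact sem_zero _

theorem sem_muHat (a b c : N) : Sem (CX.muHat K a b c) fun u v => u = a ∧ (v = b ∨ v = c) := by
  unfold CX.muHat; split_ifs
  · exact (sem_gen _).congr fun u v => by simp [CGen.dom, CGen.cod]
  · exact sem_zero _

theorem sem_prod (s : Finset N) (f : N → CX N K) (r : N → N → N → Prop)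
    (h : ∀ i, Sem (f i) (r i)) : Sem (∏ i ∈ s, f i) fun u v => ∃ i ∈ s, r i u v := by
  induction s using Finset.induction_on with
  | empty => exact sem_one.congr fun u v => by simp
  | insert i s hi ih =>
    rw [Finset.prod_insert hi]
    exact ((h i).mul ih).congr fun u v => by simp

theorem sem_discard (U : Finset N) : Sem (CX.discard K U) fun _ _ => False :=
  (sem_prod U _ _ sem_etaHat).congr fun u v => by simp

variable [Infinite N]

theorem sem_merge (l : List N) (b : N) : Sem (CX.merge K l b) fun u v => u ∈ l ∧ v = b := by
  induction l generalizing b with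
  | nil => exact (sem_eta b).congr fun u v => by simp
  | cons a l ih =>
    cases l with
    | nil => exact (sem_ren a b).congr fun u v => by simp
    | cons c l =>
      refine (((sem_I _).mul (ih _)).comp (sem_mu _ _ _)).congr fun u v => ?_
      simp [and_or_left, or_and_right, exists_or, and_assoc]
      grind

theorem sem_fibers (B : Finset N) (p : N → Finset N) :
    Sem (CX.fibers K B p) fun u v => v ∈ B ∧ u ∈ p v :=
  (sem_prod B _ _ fun b => sem_merge _ b).congr fun u v => by simp

/-- Without the comultiplication, arrows are determined by the relations that they denote. -/
theorem interp_injective_of_notMem [Countable N] (hK : Kind.comult ∉ K) :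
    Function.Injective (interp (N := N) (K := K)) := by
  classical
  -- The right side mentions `f` only through `interp f`.
  have key (f : (calculus N K).category.Arrow) : PX.of f =
      CX.fibers K (interp f).cod (fun b => {a ∈ (interp f).dom | (interp f).rel a b}) *
      CX.discard K {a ∈ (interp f).dom | ∀ b, ¬ (interp f).rel a b} := by
    obtain ⟨p, U, e⟩ := CX.exists_fibers hK f
    have hs := fun u v => ((sem_fibers _ p).mul (sem_discard U)) f e.symm u v
    have ht : Ty (PX.of f) _ _ := e ▸ (CX.ty_fibers _ p).mul (CX.ty_discard U)
    -- A product that is not `0` has factors with disjoint domains. Hence no discarded input lies in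
    -- a fibre, and `U` is recovered as the set of unrelated inputs.
    have hd := disjoint_of_mul_ne_zero (CX.ty_fibers _ p) (CX.ty_discard U)
      (e ▸ of_ne_zero f)
    rw [← cod_interp] at e hs
    have hdom := (ht f rfl).1
    rw [← cod_interp] at hd hdom
    rw [← dom_interp] at hdom
    have hp : ∀ b ∈ (interp f).cod, p b = {a ∈ (interp f).dom | (interp f).rel a b} := by
      intro b hb
      ext a
      rw [Finset.mem_filter, hs]
      simp only [hb, true_and, or_false, hdom, Finset.mem_union, Finset.mem_biUnion]
      grind
    have hU : U = {a ∈ (interp f).dom | ∀ b, ¬ (interp f).rel a b} := by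
      ext a
      have h : a ∈ (interp f).cod.biUnion p → a ∉ U := fun h => Finset.disjoint_left.1 hd.1 h
      rw [Finset.mem_biUnion] at h
      simp only [Finset.mem_filter, hs, hdom, Finset.mem_union, Finset.mem_biUnion]
      grind
    rw [e, CX.fibers_congr hp, ← hU]
  intro f g h
  exact of_injective (by rw [key f, key g, h])

theorem sem_addEdge {A B : Finset N} {a b : N} {f : CX N 𝒰} {r : N → N → Prop} (ha : a ∈ A)
    (hb : b ∈ B) (ht : Ty f A B) (hf : Sem f r) (hr : ∀ u v, r u v → u ∈ A ∧ v ∈ B) :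
    Sem (CX.addEdge A B a b f) fun u v => (u = a ∧ v = b) ∨ r u v := by
  obtain ⟨x, hx⟩ := Infinite.exists_notMem_finset (A ∪ B)
  rw [Finset.mem_union, not_or] at hx
  rw [CX.addEdge_eq ha hb ht hx.1 hx.2]
  refine (((((sem_muHat _ _ _).mul (sem_I _)).comp (hf.mul (sem_I _))).comp
    ((sem_mu _ _ _).mul (sem_I _)))).congr fun u v => ?_
  constructor
  · simp only [Finset.mem_erase, Finset.mem_singleton]
    rintro ⟨w, ⟨w', h1, h2⟩, h3⟩
    grind
  · rintro (⟨rfl, rfl⟩ | h)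
    -- The added pair travels along the extra wire `x`.
    · exact ⟨x, ⟨x, by simp⟩, by simp⟩
    · refine ⟨v, ⟨u, ?_, .inl h⟩, ?_⟩
      · simp only [Finset.mem_erase]
        grind
      · simp only [Finset.mem_erase]
        grind

theorem sem_edges {A B : Finset N} {l : List (N × N)} (hl : ∀ p ∈ l, p.1 ∈ A ∧ p.2 ∈ B) :
    Sem (CX.edges A B l) fun u v => (u, v) ∈ l := by
  induction l with
  | nil =>
    exact ((sem_discard A).mul (sem_prod B _ _ sem_eta)).congr fun u v => by simp
  | cons p l ih =>
    rw [List.forall_mem_cons] at hl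
    refine (sem_addEdge hl.1.1 hl.1.2 (CX.ty_edges hl.2) (ih hl.2) fun u v h => hl.2 _ h).congr
      fun u v => ?_
    rw [List.mem_cons, Prod.ext_iff]

/-- Arrows of the calculus of relations are determined by the relations that they denote. -/
theorem interp_injective_univ [Countable N] :
    Function.Injective (interp (N := N) (K := 𝒰)) := by
  intro f g h
  obtain ⟨l, hl, e⟩ := CX.exists_edges f
  obtain ⟨l', hl', e'⟩ := CX.exists_edges g
  rw [← dom_interp, ← cod_interp] at hl hl' e e'
  rw [← h] at hl' e'
  apply of_injective
  rw [e, e']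
  refine CX.edges_congr (fun p => ?_) hl
  have h1 := sem_edges hl _ e.symm p.1 p.2
  have h2 := sem_edges hl' _ e'.symm p.1 p.2
  rw [← h] at h2
  exact h1.symm.trans h2

end Denotation

/-! ### Definedness of normal forms, and fullness. -/

section Fullness

open PX RelArrow

namespace PX

variable {N : Type u} [DecidableEq N] {C : NominalCategory N}

theorem prod_ne_zero {ι : Type*} [DecidableEq ι] (s : Finset ι) (f : ι → PX C)
    (A B : ι → Finset N) (h : ∀ i ∈ s, Ty (f i) (A i) (B i)) (h0 : ∀ i ∈ s, f i ≠ 0)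
    (hA : ∀ i ∈ s, ∀ j ∈ s, i ≠ j → Disjoint (A i) (A j))
    (hB : ∀ i ∈ s, ∀ j ∈ s, i ≠ j → Disjoint (B i) (B j)) : ∏ i ∈ s, f i ≠ 0 := by
  induction s using Finset.induction_on with
  | empty => exact of_ne_zero _
  | insert i s hi ih =>
    simp only [Finset.forall_mem_insert] at h h0 hA hB
    rw [Finset.prod_insert hi]
    refine mul_ne_zero' h.1 (ty_prod s f A B h.2) h0.1
      (ih h.2 h0.2 (fun j hj => (hA.2 j hj).2) fun j hj => (hB.2 j hj).2) ?_ ?_ <;>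
      rw [Finset.disjoint_biUnion_right] <;> intro j hj
    · exact hA.1.2 j hj (fun e => hi (e ▸ hj))
    · exact hB.1.2 j hj (fun e => hi (e ▸ hj))

end PX

namespace CX

variable {N : Type u} [DecidableEq N] {K : Set Kind}

theorem eta_ne_zero (h : Kind.unit ∈ K) (a : N) : eta K a ≠ 0 := by
  rw [eta, dif_pos h]; exact gen_ne_zero _

theorem mu_ne_zero (h : Kind.mult ∈ K) {a b : N} (hab : a ≠ b) (c : N) : mu K a b c ≠ 0 := by
  rw [mu, dif_pos ⟨h, hab⟩]; exact gen_ne_zero _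

theorem etaHat_ne_zero (h : Kind.counit ∈ K) (a : N) : etaHat K a ≠ 0 := by
  rw [etaHat, dif_pos h]; exact gen_ne_zero _

theorem muHat_ne_zero (h : Kind.comult ∈ K) (a : N) {b c : N} (hbc : b ≠ c) :
    muHat K a b c ≠ 0 := by
  rw [muHat, dif_pos ⟨h, hbc⟩]; exact gen_ne_zero _

theorem discard_ne_zero {U : Finset N} (h : ∀ u ∈ U, Kind.counit ∈ K) : discard K U ≠ 0 :=
  prod_ne_zero U _ _ _ (fun u _ => ty_etaHat K u) (fun u hu => etaHat_ne_zero (h u hu) u)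
    (fun _ _ _ _ h => Finset.disjoint_singleton.2 h) fun _ _ _ _ _ => Finset.disjoint_empty_left _

theorem spawn_ne_zero (B : Finset N) : spawn B ≠ 0 :=
  prod_ne_zero B _ _ _ (fun b _ => ty_eta 𝒰 b) (fun b _ => eta_ne_zero (Set.mem_univ _) b)
    (fun _ _ _ _ _ => Finset.disjoint_empty_left _) fun _ _ _ _ h => Finset.disjoint_singleton.2 h

variable [Infinite N]

theorem merge_ne_zero {l : List N} (hl : l.Nodup) (h : l = [] → Kind.unit ∈ K)
    (h' : 2 ≤ l.length → Kind.mult ∈ K) (b : N) : merge K l b ≠ 0 := by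
  induction l generalizing b with
  | nil => exact eta_ne_zero (h rfl) b
  | cons a l ih =>
    cases l with
    | nil => exact ren_ne_zero a b
    | cons c l =>
      rw [List.nodup_cons] at hl
      have hm : Kind.mult ∈ K := h' (by simp)
      exact comp_ne_zero ((ty_I _).mul (ty_merge _ _)) (ty_mu K _ _ _)
        (mul_ne_zero' (ty_I _) (ty_merge _ _) (I_ne_zero _)
          (ih hl.2 (fun h => nomatch h) (fun _ => hm) _) (by simpa using hl.1)
          (Finset.disjoint_singleton.2 (other_ne a).symm))
        (mu_ne_zero hm (other_ne a).symm b)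

theorem fibers_ne_zero {B : Finset N} {p : N → Finset N}
    (hp : ∀ b ∈ B, ∀ c ∈ B, b ≠ c → Disjoint (p b) (p c))
    (h : ∀ b ∈ B, p b = ∅ → Kind.unit ∈ K) (h' : ∀ b ∈ B, 2 ≤ (p b).card → Kind.mult ∈ K) :
    fibers K B p ≠ 0 :=
  prod_ne_zero B _ _ _ (fun b _ => ty_mergeSet (p b) b)
    (fun b hb => merge_ne_zero (Finset.nodup_toList _) (fun e => h b hb (Finset.toList_eq_nil.1 e))
      (fun e => h' b hb (by rwa [Finset.length_toList] at e)) b) hp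
    fun _ _ _ _ h => Finset.disjoint_singleton.2 h

theorem addEdge_ne_zero {A B : Finset N} {a b : N} {f : CX N 𝒰} (ha : a ∈ A) (hb : b ∈ B)
    (hf : Ty f A B) (h : f ≠ 0) : addEdge A B a b f ≠ 0 := by
  obtain ⟨x, hx⟩ := Infinite.exists_notMem_finset (A ∪ B)
  rw [Finset.mem_union, not_or] at hx
  rw [addEdge_eq ha hb hf hx.1 hx.2]
  have hax : a ≠ x := fun e => hx.1 (e ▸ ha)
  have hbx : b ≠ x := fun e => hx.2 (e ▸ hb)
  refine comp_ne_zero ((ty_fork ha x).comp (hf.mul (ty_I _))) (ty_join hb x)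
    (comp_ne_zero (ty_fork ha x) (hf.mul (ty_I _)) ?_ ?_) ?_
  · exact mul_ne_zero' (ty_muHat _ _ _ _) (ty_I _) (muHat_ne_zero (Set.mem_univ _) _ hax)
      (I_ne_zero _) (by simp) (by simp [hx.1])
  · exact mul_ne_zero' hf (ty_I _) h (I_ne_zero _) (by simpa using hx.1) (by simpa using hx.2)
  · exact mul_ne_zero' (ty_mu _ _ _ _) (ty_I _) (mu_ne_zero (Set.mem_univ _) hbx.symm _)
      (I_ne_zero _) (by simp [hx.2]) (by simp)

theorem edges_ne_zero {A B : Finset N} {l : List (N × N)} (hl : ∀ p ∈ l, p.1 ∈ A ∧ p.2 ∈ B) :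
    edges A B l ≠ 0 := by
  induction l with
  | nil =>
    exact mul_ne_zero' (ty_discard A) (ty_spawn B) (discard_ne_zero fun _ _ => Set.mem_univ _)
      (spawn_ne_zero B) (Finset.disjoint_empty_right _) (Finset.disjoint_empty_left _)
  | cons p l ih =>
    rw [List.forall_mem_cons] at hl
    exact addEdge_ne_zero hl.1.1 hl.1.2 (ty_edges hl.2) (ih hl.2)

end CX

variable {N : Type u} [DecidableEq N] {K : Set Kind}

/-- Types and meanings of possibly undefined expressions hold vacuously at `0`; nonvanishing is what
turns them into an actual arrow. -/
theorem exists_interp_of_sem {f : CX N K} {R : RelArrow N} (h0 : f ≠ 0) (ht : Ty f R.dom R.cod)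
    (hs : Sem f R.rel) : ∃ g : (calculus N K).category.Arrow, interp g = R := by
  obtain ⟨g, rfl⟩ := (eq_zero_or f).resolve_left h0
  obtain ⟨h, h'⟩ := ht g rfl
  exact ⟨g, ext_of_iff ((dom_interp g).trans h) ((cod_interp g).trans h') (hs g rfl)⟩

variable [Infinite N]

/-- Partial functions are denoted by arrows, as soon as the generators are present that are needed
for elements with no preimage, with several preimages and with no image. -/
theorem exists_interp_eq {R : RelArrow N} (hR : R.SingleValued)
    (hu : Kind.unit ∈ K ∨ R.Surjective) (hm : Kind.mult ∈ K ∨ R.Injective)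
    (hc : Kind.counit ∈ K ∨ R.Total) : ∃ f : (calculus N K).category.Arrow, interp f = R := by
  classical
  set p : N → Finset N := fun b => {a ∈ R.dom | R.rel a b} with hp
  set U : Finset N := {a ∈ R.dom | ∀ b, ¬ R.rel a b} with hU
  have mem_p (a b : N) : a ∈ p b ↔ R.rel a b := by
    rw [hp, Finset.mem_filter]; exact ⟨And.right, fun h => ⟨(R.mem h).1, h⟩⟩
  have mem_U (a : N) : a ∈ U ↔ a ∈ R.dom ∧ ∀ b, ¬ R.rel a b := by rw [hU, Finset.mem_filter]
  refine exists_interp_of_sem (f := CX.fibers K R.cod p * CX.discard K U)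
    (mul_ne_zero' (CX.ty_fibers _ p) (CX.ty_discard U) (CX.fibers_ne_zero ?_ ?_ ?_)
      (CX.discard_ne_zero ?_) ?_ (Finset.disjoint_empty_right _))
    (((CX.ty_fibers _ p).mul (CX.ty_discard U)).cast ?_ (Finset.union_empty _))
    (((sem_fibers _ p).mul (sem_discard U)).congr fun u v => ?_)
  -- Single-valuedness is what makes the fibres disjoint, so that their merges can be put in
  -- parallel.
  · intro b _ c _ hbc
    rw [Finset.disjoint_left]
    intro a hb hc
    exact hbc (hR a b c ((mem_p _ _).1 hb) ((mem_p _ _).1 hc))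
  · intro b hb e
    refine hu.resolve_right fun h => ?_
    obtain ⟨a, ha⟩ := h b hb
    simpa [e] using (mem_p a b).2 ha
  · intro b hb e
    refine hm.resolve_right fun h => ?_
    obtain ⟨a, ha, a', ha', hne⟩ := Finset.one_lt_card.1 e
    exact hne (h a a' b ((mem_p _ _).1 ha) ((mem_p _ _).1 ha'))
  · intro a ha
    refine hc.resolve_right fun h => ?_
    obtain ⟨b, hb⟩ := h a ((mem_U a).1 ha).1
    exact ((mem_U a).1 ha).2 b hb
  · rw [Finset.disjoint_left]
    intro a ha ha'
    obtain ⟨b, -, hb⟩ := Finset.mem_biUnion.1 ha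
    exact ((mem_U a).1 ha').2 b ((mem_p a b).1 hb)
  · ext a
    simp only [Finset.mem_union, Finset.mem_biUnion, mem_p, mem_U]
    constructor
    · rintro (⟨b, -, hb⟩ | h)
      exacts [(R.mem hb).1, h.1]
    · intro h
      by_cases h' : ∃ b, R.rel a b
      · obtain ⟨b, hb⟩ := h'
        exact .inl ⟨b, (R.mem hb).2, hb⟩
      · exact .inr ⟨h, fun b hb => h' ⟨b, hb⟩⟩
  · rw [mem_p, or_false, and_iff_right_iff_imp]
    exact fun h => (R.mem h).2

/-- All relations are denoted by arrows of the calculus of relations. -/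
theorem exists_interp_eq_univ (R : RelArrow N) :
    ∃ f : (calculus N Set.univ).category.Arrow, interp f = R := by
  classical
  set l : List (N × N) := ((R.dom ×ˢ R.cod).filter fun q => R.rel q.1 q.2).toList with hl
  have mem_l (u v : N) : (u, v) ∈ l ↔ R.rel u v := by
    rw [hl, Finset.mem_toList, Finset.mem_filter, Finset.mem_product]
    exact ⟨And.right, fun h => ⟨R.mem h, h⟩⟩
  have h : ∀ p ∈ l, p.1 ∈ R.dom ∧ p.2 ∈ R.cod := fun p hp => R.mem ((mem_l p.1 p.2).1 hp)
  exact exists_interp_of_sem (CX.edges_ne_zero h) (CX.ty_edges h) ((sem_edges h).congr mem_l)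

end Fullness

/-! ### The isomorphisms. -/

section Presentations

open RelArrow

variable {N : Type u} [DecidableEq N] {K : Set Kind}

theorem interp_mem {P : RelArrow N → Prop} (hP : Closed P) (h : ∀ γ : CGen N K, P γ.meaning)
    (f : (calculus N K).category.Arrow) : P (interp f) := by
  obtain ⟨t, ht, rfl⟩ := Theory.PArrow.exists_rep f
  rw [interp_mk]
  induction t with
  | gen γ => exact h γ
  | idt A => exact hP.id A
  | ren a b => exact hP.δ a b
  | tensor t s iht ihs =>
    exact hP.union _ _ (iht ht.1) (ihs ht.2.1) (disjoint_dom_den ht.2.2.1)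
      (disjoint_cod_den ht.2.2.2)
  | comp t s iht ihs =>
    exact hP.comp _ _ (iht ht.1) (ihs ht.2.1) (cod_den_eq_dom_den ht.2.2)
  | perm π t iht => exact hP.smul π _ (iht ht)

/-- Here `hi` is completeness and `hs` is fullness; soundness is contained in the existence of
`interp`. -/
theorem exists_iso {P : RelArrow N → Prop} (hP : Closed P) (h : ∀ γ : CGen N K, P γ.meaning)
    (hi : Function.Injective (interp (N := N) (K := K)))
    (hs : ∀ R, P R → ∃ f : (calculus N K).category.Arrow, interp f = R) :
    ∃ F : (calculus N K).category.Iso hP.category,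
      ∀ γ, Closed.val (F.equiv ((calculus N K).genArrow γ)) = CGen.meaning γ :=
  ⟨{ equiv := Equiv.ofBijective
        (fun f => (⟨interp f, interp_mem hP h f⟩ : {R : RelArrow N // P R}))
        ⟨fun _ _ e => hi (congrArg Subtype.val e), fun R =>
          (hs R.1 R.2).imp fun _ e => Subtype.ext e⟩
     dom_equiv := dom_interp
     cod_equiv := cod_interp
     map_smul := fun π f => Subtype.ext (interp_smul π f)
     map_id := fun A => Subtype.ext (interp_id (K := K) A)
     map_comp := fun f g h _ => Subtype.ext (interp_comp f g h)
     map_tensor := fun f g h h' _ _ => Subtype.ext (interp_tensor f g h h')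
     map_δ := fun a b => Subtype.ext (interp_δ (K := K) a b) }, interp_genArrow⟩

/-- Each generator violates exactly one of four properties: `μ̂` single-valuedness, `η̂` totality,
`μ` injectivity, `η` surjectivity. This matches the sets of generators with the classes of
relations. -/
theorem singleValued_meaning (hK : Kind.comult ∉ K) (γ : CGen N K) :
    γ.meaning.SingleValued := by
  cases γ with
  | muHat h => exact absurd h hK
  | _ => intro a b b'; simp [CGen.meaning, full, CGen.cod]; try grind

theorem total_meaning (hK : Kind.comult ∉ K) (hK' : Kind.counit ∉ K) (γ : CGen N K) :
    γ.meaning.Total := by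
  cases γ with
  | muHat h => exact absurd h hK
  | etaHat h => exact absurd h hK'
  | _ => intro a; simp [CGen.meaning, full, CGen.dom, CGen.cod]

theorem injective_meaning (hK : Kind.mult ∉ K) (γ : CGen N K) : γ.meaning.Injective := by
  cases γ with
  | mu h => exact absurd h hK
  | _ => intro a b b'; simp [CGen.meaning, full, CGen.dom]; try grind

theorem surjective_meaning (hK : Kind.unit ∉ K) (γ : CGen N K) : γ.meaning.Surjective := by
  cases γ with
  | eta h => exact absurd h hK
  | _ => intro a; simp [CGen.meaning, full, CGen.dom, CGen.cod]

end Presentations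

end NominalDiagrams

open NominalDiagrams in
theorem mainTheorem3 {N : Type u} [DecidableEq N] [Countable N] [Infinite N] :
    Nonempty ((calculus N ∅).category.Iso (nBij N)) ∧
    (∃ F : (calculus N {Kind.unit}).category.Iso (nInj N),
      ∀ γ, Closed.val (F.equiv ((calculus N {Kind.unit}).genArrow γ)) = CGen.meaning γ) ∧
    (∃ F : (calculus N {Kind.mult}).category.Iso (nSurj N),
      ∀ γ, Closed.val (F.equiv ((calculus N {Kind.mult}).genArrow γ)) = CGen.meaning γ) ∧
    (∃ F : (calculus N {Kind.unit, Kind.mult}).category.Iso (nFun N),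
      ∀ γ, Closed.val (F.equiv ((calculus N {Kind.unit, Kind.mult}).genArrow γ)) =
        CGen.meaning γ) ∧
    (∃ F : (calculus N {Kind.unit, Kind.mult, Kind.counit}).category.Iso (nPFun N),
      ∀ γ, Closed.val (F.equiv ((calculus N {Kind.unit, Kind.mult, Kind.counit}).genArrow γ)) =
        CGen.meaning γ) ∧
    (∃ F : (calculus N Set.univ).category.Iso (nRel N),
      ∀ γ, F.equiv ((calculus N Set.univ).genArrow γ) = CGen.meaning γ) := by
  refine ⟨?_, ?_, ?_, ?_, ?_, ?_⟩
  · have hK : Kind.comult ∉ (∅ : Set Kind) := by simp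
    -- There are no generators here, so the condition on their images is vacuous and only the
    -- isomorphism is kept.
    exact ⟨(exists_iso _ (fun γ => ⟨⟨singleValued_meaning hK γ, total_meaning hK (by simp) γ⟩,
      injective_meaning (by simp) γ, surjective_meaning (by simp) γ⟩)
      (interp_injective_of_notMem hK) fun R hR =>
        exists_interp_eq hR.1.1 (.inr hR.2.2) (.inr hR.2.1) (.inr hR.1.2)).choose⟩
  · have hK : Kind.comult ∉ ({Kind.unit} : Set Kind) := by simp
    exact exists_iso _ (fun γ => ⟨⟨singleValued_meaning hK γ, total_meaning hK (by simp) γ⟩,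
      injective_meaning (by simp) γ⟩)
      (interp_injective_of_notMem hK) fun R hR =>
        exists_interp_eq hR.1.1 (.inl (by simp)) (.inr hR.2) (.inr hR.1.2)
  · have hK : Kind.comult ∉ ({Kind.mult} : Set Kind) := by simp
    exact exists_iso _ (fun γ => ⟨⟨singleValued_meaning hK γ, total_meaning hK (by simp) γ⟩,
      surjective_meaning (by simp) γ⟩)
      (interp_injective_of_notMem hK) fun R hR =>
        exists_interp_eq hR.1.1 (.inr hR.2) (.inl (by simp)) (.inr hR.1.2)
  · have hK : Kind.comult ∉ ({Kind.unit, Kind.mult} : Set Kind) := by simp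
    exact exists_iso _ (fun γ => ⟨singleValued_meaning hK γ, total_meaning hK (by simp) γ⟩)
      (interp_injective_of_notMem hK) fun R hR =>
        exists_interp_eq hR.1 (.inl (by simp)) (.inl (by simp)) (.inr hR.2)
  · have hK : Kind.comult ∉ ({Kind.unit, Kind.mult, Kind.counit} : Set Kind) := by simp
    exact exists_iso _ (fun γ => singleValued_meaning hK γ)
      (interp_injective_of_notMem hK) fun R hR =>
        exists_interp_eq hR (.inl (by simp)) (.inl (by simp)) (.inl (by simp))
  · exact ⟨{ equiv := Equiv.ofBijective interp ⟨interp_injective_univ, exists_interp_eq_univ⟩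
             dom_equiv := dom_interp
             cod_equiv := cod_interp
             map_smul := interp_smul
             map_id := interp_id (K := Set.univ)
             map_comp := fun f g h _ => interp_comp f g h
             map_tensor := fun f g h h' _ _ => interp_tensor f g h h'
             map_δ := interp_δ (K := Set.univ) }, interp_genArrow⟩
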